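/- **Burling graphs.** Define pairs $(B_k,\mathcal S_k)$, $k\ge 1$, where $B_k$ is a graph and $\mathcal S_k$ is a family of sets of vertices of $B_k$, as follows. $B_1$ has a single vertex $v$, and $\mathcal S_1=\{\{v\}\}$. Given $(B_k,\mathcal S_k)$, the graph $B_{k+1}$ consists of a copy $H$ of $B_k$; for every $S\in\mathcal S_k$ (viewed in $H$), a further disjoint copy $H_S$ of $B_k$; and, for every $S\in\mathcal S_k$ and every $Q\in\mathcal S_k$ (viewed in $H_S$), one new vertex $v_{S,Q}$ whose neighbors are exactly the vertices in $Q$. The family $\mathcal S_{k+1}$ consists of the sets $S\cup Q$ and $S\cup\{v_{S,Q}\}$ for all such $S$ and $Q$. A *Burling graph* is a graph isomorphic to an induced subgraph of $B_k$ for some $k$. **Theorem.** There is a polynomial-time algorithm for the maximum independent set problem in Burling graphs with weights: there are a program and a polynomial $p$ such that for every Burling graph $G$ on $n$ vertices, given by its adjacency matrix alone, and every weight assignment $w\colon V(G)\to\mathbb R$, the program run on $(G,w)$ halts after at most $p(n)$ steps and returns an independent set $I$ of $G$ such that $\sum_{v\in J}w(v)\le\sum_{v\in I}w(v)$ for every independent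 set $J$ of $G$. Here programs are those of a random access machine in which addition, (truncated) subtraction and comparison of natural numbers, and addition, subtraction and comparison of real numbers, take unit time each. Moreover, the class of Burling graphs is hereditary (closed under induced subgraphs) and not $\chi$-bounded (there is no function $f$ such that $\chi(G)\le f(\omega(G))$ for every Burling graph $G$). Hence not every hereditary class of graphs that admits a polynomial-time algorithm for the maximum independent set problem is $\chi$-bounded, which answers a question of Thomassé, Trotignon and Vušković in the negative. -/

import Mathlib

/-! ## Burling graphs -/

namespace Burling

/-- A graph together with a distinguished family of sets of its vertices. -/
structure GraphWithSets where
  V : Type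
  graph : SimpleGraph V
  sets : Set (Set V)

/-- The vertices of the graph that follows `(G, 𝒮)` in Burling's construction: a base copy of `G`;
for each `S ∈ 𝒮` a further copy of `G`; and for each `S ∈ 𝒮` and each `Q ∈ 𝒮`, the latter viewed
as a set of vertices of the copy that belongs to `S`, one new vertex. -/
inductive NextVertex (B : GraphWithSets) : Type
  | base (v : B.V) : NextVertex B
  | copy (S : B.sets) (v : B.V) : NextVertex B
  | apex (S Q : B.sets) : NextVertex B

/-- The edges inside the copies, and the edges between the new vertex `apex S Q` and the
elements of `Q` in the copy that belongs to `S`. -/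
inductive NextAdj (B : GraphWithSets) : NextVertex B → NextVertex B → Prop
  | base {u v : B.V} (h : B.graph.Adj u v) : NextAdj B (.base u) (.base v)
  | copy (S : B.sets) {u v : B.V} (h : B.graph.Adj u v) : NextAdj B (.copy S u) (.copy S v)
  | apex_copy (S Q : B.sets) {v : B.V} (h : v ∈ Q.1) : NextAdj B (.apex S Q) (.copy S v)
  | copy_apex (S Q : B.sets) {v : B.V} (h : v ∈ Q.1) : NextAdj B (.copy S v) (.apex S Q)

/-- One step of Burling's construction. The new family of sets consists of the sets `S ∪ Q` and
`S ∪ {apex S Q}`, where `S` is taken in the base copy and `Q` in the copy that belongs to `S`. -/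
def GraphWithSets.next (B : GraphWithSets) : GraphWithSets where
  V := NextVertex B
  graph :=
    { Adj := NextAdj B
      symm := ⟨fun _ _ h => by
        cases h with
        | base h => exact .base h.symm
        | copy S h => exact .copy S h.symm
        | apex_copy S Q h => exact .copy_apex S Q h
        | copy_apex S Q h => exact .apex_copy S Q h⟩
      loopless := ⟨fun _ h => by
        cases h with
        | base h => exact B.graph.loopless.irrefl _ h
        | copy S h => exact B.graph.loopless.irrefl _ h⟩ }
  sets := {T | ∃ S Q : B.sets,
    T = NextVertex.base '' S.1 ∪ NextVertex.copy S '' Q.1 ∨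
    T = NextVertex.base '' S.1 ∪ {NextVertex.apex S Q}}

/-- The Burling sequence. It starts with the one-vertex graph, whose distinguished family consists
of the set of that vertex alone. The index is shifted: `burlingSeq k` is usually called
`B_{k+1}`. -/
def burlingSeq : ℕ → GraphWithSets
  | 0 => { V := Unit, graph := ⊥, sets := {Set.univ} }
  | k + 1 => (burlingSeq k).next

/-- A class of graphs. -/
abbrev GraphClass : Type 1 := (V : Type) → SimpleGraph V → Prop

/-- A Burling graph is a graph isomorphic to an induced subgraph of some member of the
Burling sequence. -/
def IsBurlingGraph : GraphClass := fun _ G => ∃ k, Nonempty (G ↪g (burlingSeq k).graph)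

/-- Closure under isomorphism and induced subgraphs. -/
def Hereditary (𝒞 : GraphClass) : Prop :=
  ∀ (V W : Type) (G : SimpleGraph V) (H : SimpleGraph W), 𝒞 V G → Nonempty (H ↪g G) → 𝒞 W H

/-- The chromatic number of the finite members is bounded by a function of the clique number. -/
def ChiBounded (𝒞 : GraphClass) : Prop :=
  ∃ f : ℕ → ℕ, ∀ (V : Type) [Finite V] (G : SimpleGraph V),
    𝒞 V G → G.chromaticNumber ≤ (f G.cliqueNum : ℕ∞)

end Burling

/-! ## A random access machine

The machine has finitely many (as many as the program names) unbounded arrays of natural numbers,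
and finitely many unbounded arrays of real numbers. Natural numbers and real numbers can be added,
subtracted and compared, at unit cost each; there is no multiplication, no conversion between real
and natural numbers, and array indices are natural numbers. On inputs without real numbers this is
the usual unit-cost random access machine with addition and subtraction, with structured programs
instead of jumps. The real arithmetic is that of strongly polynomial algorithms: every real number
in memory is an integer combination of input numbers, with coefficients of bit length at most
linear in the time used. -/

namespace RAM

/-- Memory contents: `s.nat a i` and `s.real a i` are the contents of the cell with index `i` in
the array of natural numbers, or of real numbers, with name `a`. -/
structure State where
  nat : ℕ → ℕ → ℕ
  real : ℕ → ℕ → ℝ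

/-- Expressions with values in the natural numbers; subtraction is truncated. -/
inductive NatExpr : Type
  | const (k : ℕ) : NatExpr
  | read (a : ℕ) (i : NatExpr) : NatExpr
  | add (e f : NatExpr) : NatExpr
  | sub (e f : NatExpr) : NatExpr

def NatExpr.eval (s : State) : NatExpr → ℕ
  | .const k => k
  | .read a i => s.nat a (i.eval s)
  | .add e f => e.eval s + f.eval s
  | .sub e f => e.eval s - f.eval s

/-- The number of operations in an expression. -/
def NatExpr.cost : NatExpr → ℕ
  | .const _ => 1
  | .read _ i => i.cost + 1
  | .add e f => e.cost + f.cost + 1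
  | .sub e f => e.cost + f.cost + 1

/-- Expressions with values in the real numbers. -/
inductive RealExpr : Type
  | read (a : ℕ) (i : NatExpr) : RealExpr
  | add (e f : RealExpr) : RealExpr
  | sub (e f : RealExpr) : RealExpr

def RealExpr.eval (s : State) : RealExpr → ℝ
  | .read a i => s.real a (i.eval s)
  | .add e f => e.eval s + f.eval s
  | .sub e f => e.eval s - f.eval s

/-- The number of operations in an expression. -/
def RealExpr.cost : RealExpr → ℕ
  | .read _ i => i.cost + 1
  | .add e f => e.cost + f.cost + 1
  | .sub e f => e.cost + f.cost + 1

/-- Conditions of branches and loops. -/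
inductive Test : Type
  | natEq (e f : NatExpr) : Test
  | natLt (e f : NatExpr) : Test
  | realLt (e f : RealExpr) : Test
  | not (b : Test) : Test
  | and (b c : Test) : Test

def Test.Holds (s : State) : Test → Prop
  | .natEq e f => e.eval s = f.eval s
  | .natLt e f => e.eval s < f.eval s
  | .realLt e f => e.eval s < f.eval s
  | .not b => ¬ b.Holds s
  | .and b c => b.Holds s ∧ c.Holds s

/-- The number of operations in a condition. -/
def Test.cost : Test → ℕ
  | .natEq e f => e.cost + f.cost + 1
  | .natLt e f => e.cost + f.cost + 1
  | .realLt e f => e.cost + f.cost + 1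
  | .not b => b.cost + 1
  | .and b c => b.cost + c.cost + 1

/-- Programs: writing the value of an expression to an array cell, composition, branching, and
loops that run as long as a condition holds. -/
inductive Program : Type
  | skip : Program
  | setNat (a : ℕ) (i e : NatExpr) : Program
  | setReal (a : ℕ) (i : NatExpr) (e : RealExpr) : Program
  | seq (p q : Program) : Program
  | ite (b : Test) (p q : Program) : Program
  | loop (b : Test) (p : Program) : Program

/-- `s.setNat a i v` is `s` with `v` written to cell `i` of array `a` of natural numbers. -/
def State.setNat (s : State) (a i v : ℕ) : State :=
  { s with nat := Function.update s.nat a (Function.update (s.nat a) i v) }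

/-- `s.setReal a i x` is `s` with `x` written to cell `i` of array `a` of real numbers. -/
def State.setReal (s : State) (a i : ℕ) (x : ℝ) : State :=
  { s with real := Function.update s.real a (Function.update (s.real a) i x) }

/-- `Runs p s t s'`: the program `p`, started in the state `s`, halts in the state `s'` after
exactly `t` time units. -/
inductive Runs : Program → State → ℕ → State → Prop
  | skip (s : State) : Runs .skip s 1 s
  | setNat (a : ℕ) (i e : NatExpr) (s : State) :
      Runs (.setNat a i e) s (i.cost + e.cost + 1) (s.setNat a (i.eval s) (e.eval s))
  | setReal (a : ℕ) (i : NatExpr) (e : RealExpr) (s : State) :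
      Runs (.setReal a i e) s (i.cost + e.cost + 1) (s.setReal a (i.eval s) (e.eval s))
  | seq {p q : Program} {s s' s'' : State} {t t' : ℕ}
      (hp : Runs p s t s') (hq : Runs q s' t' s'') : Runs (.seq p q) s (t + t') s''
  | ite_true {b : Test} {p q : Program} {s s' : State} {t : ℕ}
      (hb : b.Holds s) (hp : Runs p s t s') : Runs (.ite b p q) s (b.cost + t) s'
  | ite_false {b : Test} {p q : Program} {s s' : State} {t : ℕ}
      (hb : ¬ b.Holds s) (hq : Runs q s t s') : Runs (.ite b p q) s (b.cost + t) s'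
  | loop_done {b : Test} {p : Program} {s : State}
      (hb : ¬ b.Holds s) : Runs (.loop b p) s b.cost s
  | loop_step {b : Test} {p : Program} {s s' s'' : State} {t t' : ℕ}
      (hb : b.Holds s) (hp : Runs p s t s') (hl : Runs (.loop b p) s' t' s'') :
      Runs (.loop b p) s (b.cost + t + t') s''

end RAM

/-! ## The maximum-weight independent set problem -/

namespace MaxIndepSet

open Classical in
/-- The memory that holds a graph on the vertices `0, …, n - 1` with vertex weights `w`. Natural
numbers: `n` is in cell `0` of array `0`, and the adjacency matrix is stored row by row in
array `1`. Real numbers: the weights are in array `0`. All other cells contain `0`. -/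
noncomputable def input {n : ℕ} (G : SimpleGraph (Fin n)) (w : Fin n → ℝ) : RAM.State where
  nat a c :=
    if a = 0 ∧ c = 0 then n
    else if a = 1 ∧ ∃ i j : Fin n, c = (i : ℕ) * n + (j : ℕ) ∧ G.Adj i j then 1
    else 0
  real a c := if h : a = 0 ∧ c < n then w ⟨c, h.2⟩ else 0

/-- The set of vertices that is returned: vertex `i` belongs to it if and only if cell `i` of
array `2` of natural numbers contains `1`. -/
def output (n : ℕ) (s : RAM.State) : Finset (Fin n) :=
  Finset.univ.filter fun i => s.nat 2 (i : ℕ) = 1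

/-- `I` is an independent set of maximum weight among all independent sets of `G`. -/
def IsMaxWeightIndepSet {V : Type} (G : SimpleGraph V) (w : V → ℝ) (I : Finset V) : Prop :=
  G.IsIndepSet (I : Set V) ∧
    ∀ J : Finset V, G.IsIndepSet (J : Set V) → ∑ v ∈ J, w v ≤ ∑ v ∈ I, w v

/-- There is a polynomial-time algorithm for the maximum independent set problem in the graphs
of the class `𝒞` with arbitrary real vertex weights: one program, and one polynomial in the number
of vertices that bounds its running time. -/
def PolynomialTime (𝒞 : Burling.GraphClass) : Prop :=
  ∃ (P : RAM.Program) (f : Polynomial ℕ),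
    ∀ (n : ℕ) (G : SimpleGraph (Fin n)) (w : Fin n → ℝ), 𝒞 (Fin n) G →
      ∃ (t : ℕ) (s : RAM.State),
        RAM.Runs P (input G w) t s ∧ t ≤ f.eval n ∧ IsMaxWeightIndepSet G w (output n s)

end MaxIndepSet

/-! Each step of Burling's construction extends an acyclic orientation and a strict descendant order
(`BurlingOrder`). Let `D u` be the set of strict descendants of `u`. No vertex of `D u` is adjacent
to `u`, and the neighbours of `u` separate `D u` from the rest of the graph. Moreover, every
nonempty connected set of vertices without a cut vertex has a root `u`: each of its vertices is `u`,
a neighbour of `u`, or in `D u`. These facts are collected in `Nested`. They serve only to prove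
correctness; the program never sees the order.

The algorithm is dynamic programming. If an independent set `I` in `C` avoids a cut `K`, then it
splits into independent sets in the components of `C \ K`. Trying all cuts and keeping the best
union of solutions therefore finds the optimum, provided that for every `I` a suitable cut occurs in
a list of polynomial length and leads to sets in another such list. This is the predicate `Solv`;
`solved_of_solv` turns it into correctness of the tables.

The lists come from peeling. In a starting set `F`, take the block of an edge `xy` and its root `c`.
Each round deletes the vertices `z` of the current block for which the component of `c` in `G -
N[z]` misses the block (`sel`). The first round deletes exactly `c`; afterwards the root of the
remaining block qualifies, so peeling does not stall (`Nested.sel_nonempty`). If `I` avoids the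
selected vertices, they form a cut that leads to the next round. If `I` contains a selected `z`, the
neighbours of `z` that attach to the component of `c` form a cut, the gate; a block vertex other
than `c` and outside the gate lies in a new, smaller starting set, which the earlier rounds have not
touched (`Nested.fresh`). Pieces that avoid the block are components behind a single vertex or
behind a closed neighbourhood (`Nested.solv_attached`, `Nested.solv_gate`). An induction on the size
of the pieces (`Nested.outSolv_inSolv`) shows that all components of `G` are solvable. Eight
vertices and a number of rounds determine a row, so `4 * n ^ 9` rows suffice.

The program is written in a small language of vertex sets with a connectivity predicate, which
compiles to the machine with polynomial overhead. As for colourings, Burling graphs are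
triangle-free, while every proper colouring of a member of the sequence uses many colours on some
distinguished set. -/

namespace Burling

/-! ### Walks and components inside a set of vertices. -/

section Connectivity

variable {V : Type} {G : SimpleGraph V}

/-- `x` and `y` are joined by a walk all of whose vertices lie in `W`. -/
def Conn (G : SimpleGraph V) (W : Set V) (x y : V) : Prop :=
  ∃ p : G.Walk x y, ∀ v ∈ p.support, v ∈ W

/-- The component of `x` in the subgraph induced by `W`; it is empty if `x ∉ W`. -/
def comp (G : SimpleGraph V) (W : Set V) (x : V) : Set V := {y | Conn G W x y}

variable {W W' K B Y : Set V} {x y z v w q e k : V}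

theorem mem_comp : y ∈ comp G W x ↔ Conn G W x y := Iff.rfl

theorem Conn.refl (h : x ∈ W) : Conn G W x x := ⟨.nil, by simpa using h⟩

theorem Conn.symm (h : Conn G W x y) : Conn G W y x := by
  obtain ⟨p, hp⟩ := h
  exact ⟨p.reverse, by simpa using hp⟩

theorem Conn.trans (h : Conn G W x y) (h' : Conn G W y z) : Conn G W x z := by
  obtain ⟨p, hp⟩ := h
  obtain ⟨r, hr⟩ := h'
  refine ⟨p.append r, fun v hv => ?_⟩
  rcases (SimpleGraph.Walk.mem_support_append_iff _ _).1 hv with h | h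
  exacts [hp v h, hr v h]

theorem Conn.mono (h : Conn G W x y) (hW : W ⊆ W') : Conn G W' x y := by
  obtain ⟨p, hp⟩ := h
  exact ⟨p, fun v hv => hW (hp v hv)⟩

theorem Conn.left_mem (h : Conn G W x y) : x ∈ W := by
  obtain ⟨p, hp⟩ := h
  exact hp _ p.start_mem_support

theorem Conn.right_mem (h : Conn G W x y) : y ∈ W := h.symm.left_mem

theorem Conn.of_adj (h : G.Adj x y) (hx : x ∈ W) (hy : y ∈ W) : Conn G W x y :=
  ⟨h.toWalk, by simp [hx, hy]⟩

theorem Conn.tail (h : Conn G W x y) (ha : G.Adj y z) (hz : z ∈ W) : Conn G W x z :=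
  h.trans (.of_adj ha h.right_mem hz)

theorem Conn.head (ha : G.Adj x y) (hx : x ∈ W) (h : Conn G W y z) : Conn G W x z :=
  (Conn.of_adj ha hx h.left_mem).trans h

theorem Conn.induct {P : V → Prop} (h : Conn G W x y) (hx : P x)
    (hs : ∀ u v, P u → G.Adj u v → u ∈ W → v ∈ W → P v) : P y := by
  obtain ⟨p, hp⟩ := h
  induction p with
  | nil => exact hx
  | @cons a b c ha p ih =>
    refine ih (hs _ _ hx ha (hp _ (by simp)) (hp _ (by simp))) fun v hv => hp v ?_
    simp [hv]

theorem comp_subset : comp G W x ⊆ W := fun _ h => Conn.right_mem h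

theorem mem_comp_self (h : x ∈ W) : x ∈ comp G W x := Conn.refl h

theorem comp_adj (h : y ∈ comp G W x) (ha : G.Adj y z) (hz : z ∈ W) : z ∈ comp G W x :=
  Conn.tail h ha hz

theorem comp_eq_of_mem (h : y ∈ comp G W x) : comp G W y = comp G W x := by
  ext z
  exact ⟨fun hz => Conn.trans h hz, fun hz => (Conn.symm h).trans hz⟩

theorem comp_mono (h : W ⊆ W') : comp G W x ⊆ comp G W' x := fun _ hy => Conn.mono hy h

theorem Conn.in_comp (h : Conn G W x y) : Conn G (comp G W x) x y := by
  refine (Conn.induct (P := fun y => Conn G W x y ∧ Conn G (comp G W x) x y) h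
    ⟨.refl h.left_mem, .refl (.refl h.left_mem)⟩ ?_).2
  rintro u v ⟨h1, h2⟩ ha hu hv
  exact ⟨h1.tail ha hv, h2.tail ha (h1.tail ha hv)⟩

/-- Two elements of a component are joined inside of it. -/
theorem Conn.in_comp₂ (hy : y ∈ comp G W x) (hz : z ∈ comp G W x) :
    Conn G (comp G W x) y z :=
  (Conn.in_comp hy).symm.trans (Conn.in_comp hz)

theorem subset_comp (hx : x ∈ K) (hK : ∀ y ∈ K, ∀ z ∈ K, Conn G K y z) (hW : K ⊆ W) :
    K ⊆ comp G W x := fun y hy => (hK x hx y hy).mono hW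

/-- A component of `W` all of which lies in `W'`, and which cannot be left inside `W'`, is a
component of `W'`. -/
theorem comp_congr (hx : x ∈ W) (h1 : comp G W x ⊆ W')
    (h2 : ∀ u ∈ comp G W x, ∀ z ∈ W', G.Adj u z → z ∈ W) : comp G W' x = comp G W x := by
  ext y
  constructor
  · intro h
    refine Conn.induct (P := fun y => y ∈ comp G W x) h (.refl hx) ?_
    intro u v hu ha _ hv
    exact comp_adj hu ha (h2 u hu v hv ha)
  · intro h
    exact (Conn.in_comp h).mono h1

theorem comp_subset_of_closed (hx : x ∈ W → x ∈ K)
    (h : ∀ u ∈ K, ∀ v ∈ W, G.Adj u v → v ∈ K) : comp G W x ⊆ K := by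
  intro y hy
  exact Conn.induct hy (hx (Conn.left_mem hy)) fun u v hu ha _ hv => h u hu v hv ha

theorem comp_eq_of_subset (h : W ⊆ W') (hs : comp G W' x ⊆ W) : comp G W' x = comp G W x := by
  refine Set.Subset.antisymm (fun y hy => ?_) (comp_mono h)
  exact (Conn.in_comp hy).mono hs

end Connectivity

/-! ### Blocks of edges and their attachments. -/

section Blocks

variable {V : Type} {G : SimpleGraph V} {Y Y' K : Set V} {x y v w q e k n b : V}

/-- The block of the edge `xy` in the subgraph induced by `Y`: the vertices that cannot be
separated from the edge by another vertex. -/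
def blk (G : SimpleGraph V) (Y : Set V) (x y : V) : Set V :=
  {v | v ∈ Y ∧ ∀ q, q ≠ v → Conn G (Y \ {q}) v x ∨ Conn G (Y \ {q}) v y}

theorem blk_subset : blk G Y x y ⊆ Y := fun _ h => h.1

theorem blk_mono (h : Y ⊆ Y') : blk G Y x y ⊆ blk G Y' x y := fun _ hv =>
  ⟨h hv.1, fun q hq => (hv.2 q hq).imp (·.mono (Set.sdiff_subset_sdiff_left h))
    (·.mono (Set.sdiff_subset_sdiff_left h))⟩

theorem left_mem_blk (hx : x ∈ Y) : x ∈ blk G Y x y :=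
  ⟨hx, fun _ hq => .inl (.refl ⟨hx, fun h => hq h.symm⟩)⟩

theorem right_mem_blk (hy : y ∈ Y) : y ∈ blk G Y x y :=
  ⟨hy, fun _ hq => .inr (.refl ⟨hy, fun h => hq h.symm⟩)⟩

/-- Two vertices of a block are not separated by a third one. -/
theorem blk_conn (hxy : G.Adj x y) (hv : v ∈ blk G Y x y) (hw : w ∈ blk G Y x y)
    (hvq : v ≠ q) (hwq : w ≠ q) : Conn G (Y \ {q}) v w := by
  rcases hv.2 q hvq.symm with h | h <;> rcases hw.2 q hwq.symm with h' | h'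
  · exact h.trans h'.symm
  · exact (h.tail hxy h'.right_mem).trans h'.symm
  · exact (h.tail hxy.symm h'.right_mem).trans h'.symm
  · exact h.trans h'.symm

/-- A vertex other than `e` is avoided by stepping from `n` to `e`; the vertex `e` itself is avoided
by going from `n` to `b`. This is how blocks grow along walks. -/
theorem blk_step (he : e ∈ blk G Y x y) (hn : n ∈ Y) (hne : G.Adj n e)
    (hb : b ∈ blk G Y x y) (hbe : b ≠ e) (hc : Conn G (Y \ {e}) n b) : n ∈ blk G Y x y := by
  refine ⟨hn, fun r hr => ?_⟩
  rcases eq_or_ne r e with rfl | hre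
  · exact (hb.2 r hbe.symm).imp hc.trans hc.trans
  · have hn' : n ∈ Y \ {r} := ⟨hn, fun h => hr h.symm⟩
    exact (he.2 r hre).imp (Conn.head hne hn') (Conn.head hne hn')

/-- A block remains connected after the removal of a vertex. -/
theorem blk_conn_self (hxy : G.Adj x y) (hv : v ∈ blk G Y x y) (hw : w ∈ blk G Y x y)
    (hvq : v ≠ q) (hwq : w ≠ q) : Conn G (blk G Y x y \ {q}) v w := by
  classical
  have key : ∀ (a b : V) (p : G.Walk a b), p.IsPath → (∀ u ∈ p.support, u ∈ Y \ {q}) →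
      a ∈ blk G Y x y → b ∈ blk G Y x y → Conn G (blk G Y x y \ {q}) a b := by
    intro a b p
    induction p with
    | nil =>
      intro _ h ha _
      exact .refl ⟨ha, (h _ (by simp)).2⟩
    | @cons a c b hac p ih =>
      intro hp h ha hb
      rw [SimpleGraph.Walk.cons_isPath_iff] at hp
      have hsup : ∀ u ∈ p.support, u ∈ Y \ {q} := fun u hu => h u (by simp [hu])
      -- The rest of the path ends in the block and never returns to `a`, so `blk_step` applies to
      -- its first vertex.
      have hc : c ∈ blk G Y x y := by
        refine blk_step ha (hsup c p.start_mem_support).1 hac.symm hb ?_ ⟨p, ?_⟩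
        · rintro rfl
          exact hp.2 p.end_mem_support
        · intro u hu
          refine ⟨(hsup u hu).1, ?_⟩
          rintro rfl
          exact hp.2 hu
      exact Conn.head hac ⟨ha, (h a (by simp)).2⟩ (ih hp.1 hsup hc hb)
  obtain ⟨p, hp⟩ := blk_conn hxy hv hw hvq hwq
  exact key v w p.bypass p.bypass_isPath
    (fun u hu => hp u (p.support_bypass_subset_support hu)) hv hw

/-- A connected set disjoint from a block has at most one neighbour in the block. -/
theorem blk_attach (hxy : G.Adj x y) (hK : ∀ u ∈ K, ∀ v ∈ K, Conn G K u v) (hKY : K ⊆ Y)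
    (hKB : Disjoint K (blk G Y x y)) {s t a b : V} (hs : s ∈ blk G Y x y)
    (ht : t ∈ blk G Y x y) (ha : a ∈ K) (hb : b ∈ K) (has : G.Adj a s) (hbt : G.Adj b t) :
    s = t := by
  by_contra hst
  have hsK : s ∉ K := fun h => Set.disjoint_left.1 hKB h hs
  -- With a second attachment `t`, the vertex `a` reaches the block through `K` without passing `s`,
  -- so `a` would belong to the block.
  refine Set.disjoint_left.1 hKB ha (blk_step hs (hKY ha) has ht (Ne.symm hst) ?_)
  have hKs : K ⊆ Y \ {s} := fun u hu => ⟨hKY hu, fun h => hsK (h ▸ hu)⟩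
  exact ((hK a ha b hb).mono hKs).tail hbt ⟨ht.1, Ne.symm hst⟩

/-- A vertex `q` cannot be both ends of the edge `ek`, and an end different from `q` is not
separated by `q` from the rest of the block. This gives one inclusion; the other follows by
exchanging the two edges. -/
theorem blk_eq_of_edge (hxy : G.Adj x y) (hx : x ∈ Y) (hy : y ∈ Y) (he : e ∈ blk G Y x y)
    (hk : k ∈ blk G Y x y) (hek : G.Adj e k) : blk G Y e k = blk G Y x y := by
  have key : ∀ {x y e k : V}, G.Adj x y → e ∈ blk G Y x y → k ∈ blk G Y x y → G.Adj e k →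
      blk G Y x y ⊆ blk G Y e k := by
    intro x y e k hxy he hk hek v hv
    refine ⟨hv.1, fun q hq => ?_⟩
    rcases eq_or_ne e q with rfl | heq
    · exact .inr (blk_conn hxy hv hk hq.symm hek.ne')
    · exact .inl (blk_conn hxy hv he hq.symm heq)
  have h := key hxy he hk hek
  exact (key hek (h (left_mem_blk hx)) (h (right_mem_blk hy)) hxy).antisymm h

end Blocks

end Burling

namespace Burling

/-! ### The descendant order and the orientation of the Burling sequence. -/

section Order

/-- An orientation `arc` of a graph together with a strict order `lt` that are related as in a
Burling tree, where `lt` is the strict descendant relation. -/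
structure BurlingOrder {V : Type} (G : SimpleGraph V) where
  lt : V → V → Prop
  arc : V → V → Prop
  rank : V → ℕ
  adj_iff : ∀ x y, G.Adj x y ↔ arc x y ∨ arc y x
  rank_lt : ∀ {x y}, lt x y → rank x < rank y
  rank_arc : ∀ {x y}, arc x y → rank x < rank y
  trans : ∀ {x y z}, lt x y → lt y z → lt x z
  total_lt : ∀ {x y z}, lt x y → lt x z → lt y z ∨ lt z y ∨ y = z
  total_arc : ∀ {x y z}, arc x y → arc x z → lt y z ∨ lt z y ∨ y = z
  arc_lt : ∀ {x y z}, arc x y → lt x z → lt y z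
  arc_comp : ∀ {x y z}, arc x y → lt y z → lt x z ∨ arc x z

variable {V W : Type} {G : SimpleGraph V} {H : SimpleGraph W}

/-- Restriction to an induced subgraph. -/
def BurlingOrder.comap (T : BurlingOrder H) (f : G ↪g H) : BurlingOrder G where
  lt x y := T.lt (f x) (f y)
  arc x y := T.arc (f x) (f y)
  rank x := T.rank (f x)
  adj_iff x y := by rw [← T.adj_iff, f.map_adj_iff]
  rank_lt h := T.rank_lt h
  rank_arc h := T.rank_arc h
  trans h h' := T.trans h h'
  total_lt h h' := by simpa using T.total_lt h h'
  total_arc h h' := by simpa using T.total_arc h h'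
  arc_lt h h' := T.arc_lt h h'
  arc_comp h h' := T.arc_comp h h'

variable {B : GraphWithSets}

/-- The copy and the new vertices that belong to `S` are placed below all elements of `S` in the
base copy. -/
inductive NextLt (lt : B.V → B.V → Prop) : NextVertex B → NextVertex B → Prop
  | base {u v} (h : lt u v) : NextLt lt (.base u) (.base v)
  | copy (S : B.sets) {u v} (h : lt u v) : NextLt lt (.copy S u) (.copy S v)
  | copy_base (S : B.sets) {u v} (h : v ∈ S.1) : NextLt lt (.copy S u) (.base v)
  | apex_base (S Q : B.sets) {v} (h : v ∈ S.1) : NextLt lt (.apex S Q) (.base v)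

inductive NextArc (arc : B.V → B.V → Prop) : NextVertex B → NextVertex B → Prop
  | base {u v} (h : arc u v) : NextArc arc (.base u) (.base v)
  | copy (S : B.sets) {u v} (h : arc u v) : NextArc arc (.copy S u) (.copy S v)
  | apex_copy (S Q : B.sets) {v} (h : v ∈ Q.1) : NextArc arc (.apex S Q) (.copy S v)

/-- New vertices come lowest, then the copies, then the base copy. The number `N` is a bound for the
old ranks, so the base copy starts above all ranks used in the copies. -/
def nextRank (rank : B.V → ℕ) (N : ℕ) : NextVertex B → ℕ
  | .base v => N + 2 + rank v
  | .copy _ v => rank v + 1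
  | .apex _ _ => 0

/-- A Burling order in which the distinguished sets are up-closed chains. -/
structure GoodOrder (B : GraphWithSets) extends BurlingOrder B.graph where
  bound : ℕ
  rank_le : ∀ v, rank v ≤ bound
  chain : ∀ S ∈ B.sets, ∀ x ∈ S, ∀ y ∈ S, lt x y ∨ lt y x ∨ x = y
  up : ∀ S ∈ B.sets, ∀ x ∈ S, ∀ y, lt x y → y ∈ S

/-- Comparability above a copy or a new vertex comes from `S` being a chain, and comparability of
the out-neighbours of a new vertex from `Q` being one. Up-closure of `S` gives transitivity, and
that of `Q` gives `arc_comp` at a new vertex. The new distinguished sets inherit both properties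
because `S` lies on top. -/
def GoodOrder.next (T : GoodOrder B) : GoodOrder B.next where
  lt := NextLt T.lt
  arc := NextArc T.arc
  rank := nextRank T.rank T.bound
  bound := T.bound + 2 + T.bound
  adj_iff x y := by
    constructor
    · rintro (h | ⟨_, h⟩ | ⟨S, Q, h⟩ | ⟨S, Q, h⟩)
      · exact ((T.adj_iff _ _).1 h).imp .base .base
      · exact ((T.adj_iff _ _).1 h).imp (.copy _) (.copy _)
      · exact .inl (.apex_copy S Q h)
      · exact .inr (.apex_copy S Q h)
    · rintro ((h | ⟨_, h⟩ | ⟨S, Q, h⟩) | (h | ⟨_, h⟩ | ⟨S, Q, h⟩))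
      · exact .base ((T.adj_iff _ _).2 (.inl h))
      · exact .copy _ ((T.adj_iff _ _).2 (.inl h))
      · exact .apex_copy S Q h
      · exact .base ((T.adj_iff _ _).2 (.inr h))
      · exact .copy _ ((T.adj_iff _ _).2 (.inr h))
      · exact .copy_apex S Q h
  rank_lt {x y} h := by
    cases h with
    | base h => simpa [nextRank] using T.rank_lt h
    | copy S h => simpa [nextRank] using T.rank_lt h
    | @copy_base S u v h =>
      have := T.rank_le u
      simp only [nextRank]; omega
    | apex_base => simp only [nextRank]; omega
  rank_arc {x y} h := by
    cases h with
    | base h => simpa [nextRank] using T.rank_arc h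
    | copy S h => simpa [nextRank] using T.rank_arc h
    | apex_copy => simp only [nextRank]; omega
  trans {x y z} h h' := by
    cases h with
    | base h => cases h' with
      | base h' => exact .base (T.trans h h')
    | copy S h => cases h' with
      | copy _ h' => exact .copy _ (T.trans h h')
      | copy_base _ h' => exact .copy_base _ h'
    | copy_base S h => cases h' with
      | base h' => exact .copy_base _ (T.up _ S.2 _ h _ h')
    | apex_base S Q h => cases h' with
      | base h' => exact .apex_base _ _ (T.up _ S.2 _ h _ h')
  total_lt {x y z} h h' := by
    cases h with
    | base h => cases h' with
      | base h' => exact (T.total_lt h h').imp .base (.imp .base (congrArg _))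
    | copy S h => cases h' with
      | copy _ h' => exact (T.total_lt h h').imp (.copy _) (.imp (.copy _) (congrArg _))
      | copy_base _ h' => exact .inl (.copy_base _ h')
    | copy_base S h => cases h' with
      | copy _ h' => exact .inr (.inl (.copy_base _ h))
      | copy_base _ h' => exact (T.chain _ S.2 _ h _ h').imp .base (.imp .base (congrArg _))
    | apex_base S Q h => cases h' with
      | apex_base _ _ h' => exact (T.chain _ S.2 _ h _ h').imp .base (.imp .base (congrArg _))
  total_arc {x y z} h h' := by
    cases h with
    | base h => cases h' with
      | base h' => exact (T.total_arc h h').imp .base (.imp .base (congrArg _))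
    | copy S h => cases h' with
      | copy _ h' => exact (T.total_arc h h').imp (.copy _) (.imp (.copy _) (congrArg _))
    | apex_copy S Q h => cases h' with
      | apex_copy _ _ h' =>
        exact (T.chain _ Q.2 _ h _ h').imp (.copy _) (.imp (.copy _) (congrArg _))
  arc_lt {x y z} h h' := by
    cases h with
    | base h => cases h' with
      | base h' => exact .base (T.arc_lt h h')
    | copy S h => cases h' with
      | copy _ h' => exact .copy _ (T.arc_lt h h')
      | copy_base _ h' => exact .copy_base _ h'
    | apex_copy S Q h => cases h' with
      | apex_base _ _ h' => exact .copy_base _ h'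
  arc_comp {x y z} h h' := by
    cases h with
    | base h => cases h' with
      | base h' => exact (T.arc_comp h h').imp .base .base
    | copy S h => cases h' with
      | copy _ h' => exact (T.arc_comp h h').imp (.copy _) (.copy _)
      | copy_base _ h' => exact .inl (.copy_base _ h')
    | apex_copy S Q h => cases h' with
      | copy _ h' => exact .inr (.apex_copy _ _ (T.up _ Q.2 _ h _ h'))
      | copy_base _ h' => exact .inl (.apex_base _ _ h')
  rank_le v := by
    cases v with
    | base v => simpa [nextRank] using T.rank_le v
    | copy S v => have := T.rank_le v; simp only [nextRank]; omega
    | apex => simp [nextRank]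
  chain := by
    rintro _ ⟨S, Q, rfl | rfl⟩
    · rintro _ (⟨x, hx, rfl⟩ | ⟨x, hx, rfl⟩) _ (⟨y, hy, rfl⟩ | ⟨y, hy, rfl⟩)
      · exact (T.chain _ S.2 _ hx _ hy).imp .base (.imp .base (congrArg _))
      · exact .inr (.inl (.copy_base _ hx))
      · exact .inl (.copy_base _ hy)
      · exact (T.chain _ Q.2 _ hx _ hy).imp (.copy _) (.imp (.copy _) (congrArg _))
    · rintro _ (⟨x, hx, rfl⟩ | rfl) _ (⟨y, hy, rfl⟩ | rfl)
      · exact (T.chain _ S.2 _ hx _ hy).imp .base (.imp .base (congrArg _))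
      · exact .inr (.inl (.apex_base _ _ hx))
      · exact .inl (.apex_base _ _ hy)
      · exact .inr (.inr rfl)
  up := by
    rintro _ ⟨S, Q, rfl | rfl⟩
    · rintro _ (⟨x, hx, rfl⟩ | ⟨x, hx, rfl⟩) y h
      · cases h with
        | base h => exact .inl ⟨_, T.up _ S.2 _ hx _ h, rfl⟩
      · cases h with
        | copy _ h => exact .inr ⟨_, T.up _ Q.2 _ hx _ h, rfl⟩
        | copy_base _ h => exact .inl ⟨_, h, rfl⟩
    · rintro _ (⟨x, hx, rfl⟩ | rfl) y h
      · cases h with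
        | base h => exact .inl ⟨_, T.up _ S.2 _ hx _ h, rfl⟩
      · cases h with
        | apex_base _ _ h => exact .inl ⟨_, h, rfl⟩

def goodOrder : ∀ k, GoodOrder (burlingSeq k)
  | 0 =>
    { lt := fun _ _ => False
      arc := fun _ _ => False
      rank := fun _ => 0
      bound := 0
      adj_iff := fun _ _ => ⟨False.elim, fun h => (or_self_iff.1 h).elim⟩
      rank_lt := False.elim
      rank_arc := False.elim
      trans := fun h => h.elim
      total_lt := fun h => h.elim
      total_arc := fun h => h.elim
      arc_lt := fun h => h.elim
      arc_comp := fun h => h.elim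
      rank_le := fun _ => le_rfl
      chain := fun _ _ _ _ _ _ => .inr (.inr rfl)
      up := fun _ _ _ _ _ h => h.elim }
  | k + 1 => (goodOrder k).next

theorem IsBurlingGraph.nonempty_order (h : IsBurlingGraph V G) : Nonempty (BurlingOrder G) := by
  obtain ⟨k, ⟨f⟩⟩ := h
  exact ⟨(goodOrder k).toBurlingOrder.comap f⟩

theorem hereditary_isBurlingGraph : Hereditary IsBurlingGraph := by
  rintro V W G H ⟨k, ⟨f⟩⟩ ⟨g⟩
  exact ⟨k, ⟨f.comp g⟩⟩

end Order

/-! ### Triangle-freeness. -/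

section Basic

variable {V : Type} {G : SimpleGraph V} (T : BurlingOrder G) {x y z u v : V}
include T

theorem BurlingOrder.not_adj (h : T.lt x y) : ¬ G.Adj x y := by
  rw [T.adj_iff]
  rintro (h' | h')
  · exact (T.rank_lt (T.arc_lt h' h)).false
  · exact (T.rank_lt h).not_gt (T.rank_arc h')

/-- The rank excludes cyclic triangles, so some vertex of a triangle points to the other two. These
are then comparable, hence not adjacent. -/
theorem BurlingOrder.triangle_free (hxy : G.Adj x y) (hyz : G.Adj y z) (hxz : G.Adj x z) :
    False := by
  have key : ∀ {a b c}, T.arc a b → T.arc a c → G.Adj b c → False := by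
    intro a b c h h' ha
    rcases T.total_arc h h' with h | h | h
    · exact T.not_adj h ha
    · exact T.not_adj h ha.symm
    · exact ha.ne h
  rcases (T.adj_iff _ _).1 hxy with h1 | h1 <;> rcases (T.adj_iff _ _).1 hyz with h2 | h2 <;>
    rcases (T.adj_iff _ _).1 hxz with h3 | h3
  · exact key h1 h3 hyz
  · have := T.rank_arc h1; have := T.rank_arc h2; have := T.rank_arc h3; omega
  · exact key h1 h3 hyz
  · exact key h3 h2 hxy
  · exact key h1 h2 hxz
  · exact key h1 h2 hxz
  · have := T.rank_arc h1; have := T.rank_arc h2; have := T.rank_arc h3; omega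
  · exact key h3 h2 hxy

theorem BurlingOrder.cliqueNum_le [Finite V] : G.cliqueNum ≤ 2 := by
  classical
  by_contra! h
  obtain ⟨s, hs⟩ := G.exists_isNClique_cliqueNum
  obtain ⟨t, hts, ht⟩ := Finset.exists_subset_card_eq (hs.card_eq ▸ h)
  obtain ⟨a, b, c, hab, hac, hbc, rfl⟩ := Finset.card_eq_three.1 ht
  have := hs.isClique
  have ha : a ∈ s := hts (by simp)
  have hb : b ∈ s := hts (by simp)
  have hc : c ∈ s := hts (by simp)
  exact T.triangle_free (this ha hb hab) (this hb hc hbc) (this ha hc hac)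

end Basic

/-! ### Separation by neighbourhoods, and roots of blocks. -/

section Nested

variable {V : Type}

/-- The properties of the sets `D u` of strict descendants in a Burling tree that the algorithm
relies on. -/
structure Nested (G : SimpleGraph V) (D : V → Set V) : Prop where
  triangle_free : ∀ {x y z}, G.Adj x y → G.Adj y z → G.Adj x z → False
  not_adj : ∀ {x u}, x ∈ D u → ¬ G.Adj x u
  closed : ∀ {x y u}, x ∈ D u → G.Adj x y → y ∈ D u ∨ G.Adj y u
  asymm : ∀ {x u}, x ∈ D u → u ∉ D x
  root : ∀ B : Set V, B.Nonempty → (∀ v ∈ B, ∀ w ∈ B, Conn G B v w) →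
    (∀ q, ∀ v ∈ B, ∀ w ∈ B, v ≠ q → w ≠ q → Conn G (B \ {q}) v w) →
    ∃ u ∈ B, (∀ v ∈ B, v = u ∨ G.Adj v u ∨ v ∈ D u) ∧
      ∀ p ∈ B, G.Adj p u → ∀ x ∈ B, x ∉ D p

variable {G : SimpleGraph V} (T : BurlingOrder G) {x y z u v w k c p p' : V} {K : Set V}
include T

/-- The descendants of `u` can be left only through neighbours of `u`. -/
theorem BurlingOrder.closed (h : T.lt x u) (ha : G.Adj x y) : T.lt y u ∨ G.Adj y u := by
  rcases (T.adj_iff _ _).1 ha with h' | h'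
  · exact .inl (T.arc_lt h' h)
  · exact (T.arc_comp h' h).imp_right fun h => (T.adj_iff _ _).2 (.inl h)

/-- If `p` were below `p'`, the arc from `p` would put `u` below `p'`, whereas the arc from `p'` to
`u` increases the rank. -/
theorem BurlingOrder.antichain (h : T.arc p u) (h' : T.arc p' u) : ¬ T.lt p p' := fun hl =>
  (T.rank_lt (T.arc_lt h hl)).not_gt (T.rank_arc h')

theorem BurlingOrder.total_out (h : T.lt x y ∨ T.arc x y) (h' : T.lt x z ∨ T.arc x z) :
    T.lt y z ∨ T.lt z y ∨ y = z := by
  rcases h with h | h <;> rcases h' with h' | h'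
  · exact T.total_lt h h'
  · exact .inr (.inl (T.arc_lt h' h))
  · exact .inl (T.arc_lt h h')
  · exact T.total_arc h h'

omit T in
/-- Reachability of `c` from `x` inside `K` along `lt` and `arc`. -/
def BurlingOrder.Up (T : BurlingOrder G) (K : Set V) (x c : V) : Prop :=
  Relation.ReflTransGen (fun a b => a ∈ K ∧ b ∈ K ∧ (T.lt a b ∨ T.arc a b)) x c

/-- Climb from `k` to `c`. What a vertex sees above itself is comparable with the next vertex of the
climb: either `w` is at or below that vertex, or that vertex is below `w` and the climb goes on. -/
theorem BurlingOrder.Up.propagate (hc : c ∈ K) (h : T.Up K k c) (hw : T.lt k w ∨ T.arc k w) :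
    (T.lt c w ∨ T.arc c w) ∨ ∃ k' ∈ K, T.Up K k' c ∧ (w = k' ∨ T.lt w k') := by
  induction h using Relation.ReflTransGen.head_induction_on with
  | refl => exact .inl hw
  | head h h' ih =>
    rcases T.total_out hw h.2.2 with h1 | h1 | h1
    · exact .inr ⟨_, h.2.1, h', .inr h1⟩
    · exact ih (.inl h1)
    · exact .inr ⟨_, h.2.1, h', .inl h1⟩

/-- A vertex `u` of maximal rank is a root. Otherwise some vertices of the set are neither `u`, nor
adjacent to `u`, nor below `u`, and a component `K` of the non-neighbours of `u` consists of such
vertices. All of `K` climbs to its vertex `c` of maximal rank, so the neighbours of `u` that attach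
to `K` are all seen from `c` and form a chain. They also form an antichain, as they point to `u`;
hence there is at most one, and it would be a cut vertex. -/
theorem BurlingOrder.root [Finite V] (B : Set V) (hB : B.Nonempty)
    (h0 : ∀ v ∈ B, ∀ w ∈ B, Conn G B v w)
    (h1 : ∀ q, ∀ v ∈ B, ∀ w ∈ B, v ≠ q → w ≠ q → Conn G (B \ {q}) v w) :
    ∃ u ∈ B, (∀ v ∈ B, v = u ∨ G.Adj v u ∨ T.lt v u) ∧
      ∀ p ∈ B, G.Adj p u → ∀ x ∈ B, ¬ T.lt x p := by
  obtain ⟨u, hu, hmax⟩ := Set.exists_max_image B T.rank (Set.toFinite B) hB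
  have harc : ∀ v ∈ B, G.Adj v u → T.arc v u := by
    intro v hv h
    rcases (T.adj_iff _ _).1 h with h | h
    · exact h
    · exact absurd (T.rank_arc h) (hmax v hv).not_gt
  have first : ∀ v ∈ B, v = u ∨ G.Adj v u ∨ T.lt v u := by
    by_contra! hx
    obtain ⟨x, hxB, hxu, hxa, hxl⟩ := hx
    set W := {v ∈ B | v ≠ u ∧ ¬ G.Adj v u} with hW
    set K := comp G W x with hK
    have hxK : x ∈ K := mem_comp_self ⟨hxB, hxu, hxa⟩
    have hKW : K ⊆ W := comp_subset
    have hKl : ∀ y ∈ K, ¬ T.lt y u := by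
      intro y hy
      refine Conn.induct (P := fun y => ¬ T.lt y u) hy hxl fun a b ha hab haW _ hb => ?_
      rcases T.closed hb hab.symm with h | h
      exacts [ha h, haW.2.2 h]
    have hcmp : ∀ y ∈ K, ¬ (T.lt y u ∨ T.lt u y ∨ y = u) := by
      rintro y hy (h | h | h)
      · exact hKl y hy h
      · exact (T.rank_lt h).not_ge (hmax y (hKW hy).1)
      · exact (hKW hy).2.1 h
    -- If `v` pointed to `y`, then `y` and `u` would be two out-neighbours of `v`, hence comparable
    -- or equal.
    have hatt : ∀ y ∈ K, ∀ v ∈ B, G.Adj v u → G.Adj y v → T.arc y v := by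
      intro y hy v hv hvu hyv
      rcases (T.adj_iff _ _).1 hyv with h | h
      · exact h
      · exact (hcmp y hy (T.total_arc h (harc v hv hvu))).elim
    obtain ⟨c, hc, hcmax⟩ := Set.exists_max_image K T.rank (Set.toFinite K) ⟨x, hxK⟩
    -- Induction along a walk from `c`. An arc that leaves an already treated vertex ends at or
    -- below a vertex that climbs to `c`, since otherwise its head would be seen from `c` and exceed
    -- the maximal rank.
    have hup : ∀ y ∈ K, T.Up K y c := by
      intro y hy
      refine Conn.induct (P := fun y => T.Up K y c) (Conn.in_comp₂ hc hy) .refl ?_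
      intro a b ha hab haK hbK
      rcases (T.adj_iff _ _).1 hab with h | h
      · rcases ha.propagate T hc (.inr h) with h' | ⟨k, hk, hkc, rfl | hl⟩
        · have h2 : T.rank c < T.rank b := h'.elim T.rank_lt T.rank_arc
          exact absurd h2 (hcmax b hbK).not_gt
        · exact hkc
        · exact .head ⟨hbK, hk, .inl hl⟩ hkc
      · exact .head ⟨hbK, haK, .inr h⟩ ha
    have hout : ∀ y ∈ K, ∀ v ∈ B, G.Adj v u → G.Adj y v → T.lt c v ∨ T.arc c v := by
      intro y hy v hv hvu hyv
      rcases (hup y hy).propagate T hc (.inr (hatt y hy v hv hvu hyv)) with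
        h | ⟨k, hk, -, rfl | hl⟩
      · exact h
      · exact ((hKW hk).2.2 hvu).elim
      · exact (hcmp k hk (T.total_out (.inl hl) (.inr (harc v hv hvu)))).elim
    have huniq : ∀ y ∈ K, ∀ v ∈ B, G.Adj v u → G.Adj y v →
        ∀ y' ∈ K, ∀ v' ∈ B, G.Adj v' u → G.Adj y' v' → v = v' := by
      intro y hy v hv hvu hyv y' hy' v' hv' hvu' hyv'
      rcases T.total_out (hout y hy v hv hvu hyv) (hout y' hy' v' hv' hvu' hyv') with h | h | h
      · exact (T.antichain (harc v hv hvu) (harc v' hv' hvu') h).elim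
      · exact (T.antichain (harc v' hv' hvu') (harc v hv hvu) h).elim
      · exact h
    -- Without an attachment in `B'`, a walk in `B'` cannot leave `K`.
    have stay : ∀ B' ⊆ B, (∀ y ∈ K, ∀ v ∈ B', G.Adj v u → ¬ G.Adj y v) →
        ¬ Conn G B' x u := by
      intro B' hB' hno hcon
      have : u ∈ K := by
        refine Conn.induct (P := fun y => y ∈ K) hcon hxK fun a b ha hab _ hb => ?_
        refine comp_adj ha hab ⟨hB' hb, ?_, fun h => hno a ha b hb h hab⟩
        rintro rfl
        exact (hKW ha).2.2 hab
      exact (hKW this).2.1 rfl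
    by_cases hex : ∃ y ∈ K, ∃ v ∈ B, G.Adj v u ∧ G.Adj y v
    · obtain ⟨y, hy, v, hv, hvu, hyv⟩ := hex
      refine stay _ Set.sdiff_subset ?_ (h1 v x hxB u hu ?_ hvu.ne')
      · intro y' hy' v' hv' hvu' hyv'
        exact hv'.2 (huniq y hy v hv hvu hyv y' hy' v' hv'.1 hvu' hyv').symm
      · rintro rfl
        exact hxa hvu
    · push Not at hex
      exact stay B subset_rfl hex (h0 x hxB u hu)
  refine ⟨u, hu, first, fun p hp hpu x hx hxp => ?_⟩
  -- The three positions of `x` relative to `u` contradict in turn the maximality of `u`, the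
  -- antichain of in-neighbours of `u`, and the non-adjacency of comparable vertices applied to `p`
  -- and `u`.
  rcases first x hx with rfl | h | h
  · exact (T.rank_lt hxp).not_ge (hmax p hp)
  · exact T.antichain (harc x hx h) (harc p hp hpu) hxp
  · rcases T.total_lt hxp h with h | h | h
    · exact T.not_adj h hpu
    · exact T.not_adj h hpu.symm
    · exact hpu.ne h

theorem BurlingOrder.nested [Finite V] : Nested G fun u => {x | T.lt x u} where
  triangle_free := T.triangle_free
  not_adj := T.not_adj
  closed := T.closed
  asymm h h' := (T.rank_lt h).not_gt (T.rank_lt h')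
  root := T.root

end Nested

/-! ### Unbounded chromatic number. -/

section Chromatic

theorem finite_burlingSeq (k : ℕ) : Finite (burlingSeq k).V := by
  induction k with
  | zero => exact inferInstanceAs (Finite Unit)
  | succ k ih =>
    refine Finite.of_surjective (Sum.elim NextVertex.base (Sum.elim
      (fun p : (burlingSeq k).sets × (burlingSeq k).V => NextVertex.copy p.1 p.2)
      fun p : (burlingSeq k).sets × (burlingSeq k).sets => .apex p.1 p.2)) ?_
    rintro (v | ⟨S, v⟩ | ⟨S, Q⟩)
    exacts [⟨.inl v, rfl⟩, ⟨.inr (.inl (S, v)), rfl⟩, ⟨.inr (.inr (S, Q)), rfl⟩]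

/-- Take a colourful `S` in the base copy and a colourful `Q` in the copy that belongs to `S`. The
new vertex for `S` and `Q` has a colour missing on `Q`. If this colour occurs on `S`, then the union
of `S` and `Q` gains a colour over `Q`; if not, adding the new vertex to `S` gains one. -/
theorem exists_colorful_set {m : ℕ} (k : ℕ) (c : (burlingSeq k).graph.Coloring (Fin m)) :
    ∃ S ∈ (burlingSeq k).sets, k + 1 ≤ (c '' S).ncard := by
  induction k with
  | zero =>
    refine ⟨Set.univ, rfl, ?_⟩
    rw [Nat.succ_le_iff, Set.ncard_pos]
    exact ⟨c (), (), trivial, rfl⟩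
  | succ k ih =>
    let ι : (burlingSeq k).graph →g (burlingSeq (k + 1)).graph := ⟨NextVertex.base, .base⟩
    obtain ⟨S, hS, hSc⟩ := ih (c.comp ι)
    let κ : (burlingSeq k).graph →g (burlingSeq (k + 1)).graph :=
      ⟨NextVertex.copy ⟨S, hS⟩, .copy ⟨S, hS⟩⟩
    obtain ⟨Q, hQ, hQc⟩ := ih (c.comp κ)
    have e1 : (c.comp ι) '' S = c '' (ι '' S) := Set.image_comp c ι S
    have e2 : (c.comp κ) '' Q = c '' (κ '' Q) := Set.image_comp c κ Q
    rw [e1] at hSc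
    rw [e2] at hQc
    set A := c '' (ι '' S)
    set D := c '' (κ '' Q)
    have ha : c (NextVertex.apex ⟨S, hS⟩ ⟨Q, hQ⟩) ∉ D := by
      rintro ⟨_, ⟨v, hv, rfl⟩, h⟩
      exact c.valid (NextAdj.copy_apex ⟨S, hS⟩ ⟨Q, hQ⟩ hv) h
    by_cases hA : c (NextVertex.apex ⟨S, hS⟩ ⟨Q, hQ⟩) ∈ A
    · refine ⟨_, ⟨⟨S, hS⟩, ⟨Q, hQ⟩, .inl rfl⟩, ?_⟩
      have hu : (c '' (NextVertex.base '' S ∪ NextVertex.copy ⟨S, hS⟩ '' Q)) = A ∪ D :=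
        Set.image_union _ _ _
      have h1 : insert (c (NextVertex.apex ⟨S, hS⟩ ⟨Q, hQ⟩)) D ⊆ A ∪ D :=
        Set.insert_subset (.inl hA) Set.subset_union_right
      have h2 := Set.ncard_le_ncard h1 (Set.toFinite _)
      rw [Set.ncard_insert_of_notMem ha (Set.toFinite _)] at h2
      exact (Nat.add_le_add_right hQc 1).trans (h2.trans (le_of_eq (congrArg _ hu.symm)))
    · refine ⟨_, ⟨⟨S, hS⟩, ⟨Q, hQ⟩, .inr rfl⟩, ?_⟩
      have hu : c '' (NextVertex.base '' S ∪ {NextVertex.apex ⟨S, hS⟩ ⟨Q, hQ⟩}) =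
          insert (c (NextVertex.apex ⟨S, hS⟩ ⟨Q, hQ⟩)) A :=
        (Set.image_union _ _ _).trans
          ((congrArg _ Set.image_singleton).trans Set.union_singleton)
      refine le_trans ?_ (le_of_eq (congrArg _ hu.symm))
      rw [Set.ncard_insert_of_notMem hA (Set.toFinite _)]
      exact Nat.add_le_add_right hSc 1

theorem not_chiBounded_isBurlingGraph : ¬ ChiBounded IsBurlingGraph := by
  rintro ⟨f, hf⟩
  -- The clique number is at most `2`, so `m` colours would suffice, while some distinguished set of
  -- `burlingSeq m` sees `m + 1` colours.
  let m := f 0 + f 1 + f 2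
  have := finite_burlingSeq m
  have h := hf _ (burlingSeq m).graph ⟨m, ⟨SimpleGraph.Embedding.refl⟩⟩
  have hω := (goodOrder m).toBurlingOrder.cliqueNum_le
  have hm : f (burlingSeq m).graph.cliqueNum ≤ m := by
    interval_cases (burlingSeq m).graph.cliqueNum <;> omega
  obtain ⟨c⟩ := SimpleGraph.chromaticNumber_le_iff_colorable.1
    (h.trans (Nat.cast_le.2 hm))
  obtain ⟨S, -, hS⟩ := exists_colorful_set m c
  have := hS.trans (Set.ncard_le_card _)
  simp at this

end Chromatic

end Burling

namespace Burling

/-! ### Gates, selections and peeling in terms of the graph alone, and solvable sets. -/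

section Definitions

variable {V : Type} (G : SimpleGraph V)

/-- The closed neighbourhood. -/
def cl (z : V) : Set V := {v | v = z ∨ G.Adj v z}

/-- The open neighbourhood. -/
def nb (z : V) : Set V := {v | G.Adj v z}

/-- The component of `c` in the graph of the non-neighbours of `z`. -/
def far (c z : V) : Set V := comp G (cl G z)ᶜ c

/-- The neighbours of `z` that attach to `far G c z`; all neighbours of `z` if `c = z`. -/
def gate (c z : V) : Set V := {p | G.Adj p z ∧ (c = z ∨ ∃ o ∈ far G c z, G.Adj p o)}

/-- The vertices of `B` that separate `c` from `B`. -/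
def sel (c : V) (B : Set V) : Set V := {v | v ∈ B ∧ ¬ G.Adj c v ∧ ∀ o ∈ far G c v, o ∉ B}

/-- The vertices removed from `F` in the first `i` rounds of the peeling of the block of `xy`. -/
def del (F : Set V) (c x y : V) : ℕ → Set V
  | 0 => ∅
  | i + 1 => del F c x y i ∪ sel G c (blk G (F \ del F c x y i) x y)

/-- What is left of `F` after `i` rounds of peeling. -/
def lev (F : Set V) (c x y : V) (i : ℕ) : Set V := F \ del G F c x y i

/-- The block of `xy` after `i` rounds of peeling. -/
def bl (F : Set V) (c x y : V) (i : ℕ) : Set V := blk G (lev G F c x y i) x y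

/-- The sets of vertices for which the algorithm solves the problem. -/
def IsRow (C : Set V) : Prop :=
  ∃ a z f c x y e g : V, ∃ i < Nat.card V,
    C = comp G (lev G (comp G (gate G a z)ᶜ f) c x y i \ {e}) g ∨
    C = comp G (lev G (comp G (gate G a z)ᶜ f) c x y i \ cl G e) g ∨
    C = {g} ∨
    C = comp G (lev G (comp G (gate G a z)ᶜ f) c x y i) g

/-- The sets of vertices whose removal the algorithm tries. -/
def IsCut (C : Set V) : Prop :=
  ∃ a z f c x y e : V, ∃ i < Nat.card V,
    C = {e} ∨ C = nb G e ∨ C = gate G a z ∨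
    C = sel G c (bl G (comp G (gate G a z)ᶜ f) c x y i)

/-- The sets `C` of vertices on which dynamic programming over rows and cuts succeeds: for each
independent set `I` there is a cut `K I` that `I` avoids and that splits `C` into such sets. -/
inductive Solv : Set V → Prop
  | single (g : V) : Solv {g}
  | step (C : Set V) (hC : IsRow G C) (K : Set V → Set V)
      (hK : ∀ I ⊆ C, G.IsIndepSet I → IsCut G (K I) ∧ Disjoint I (K I) ∧ (K I ∩ C).Nonempty)
      (h : ∀ I ⊆ C, G.IsIndepSet I → ∀ v ∈ C \ K I, Solv (comp G (C \ K I) v)) : Solv C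

end Definitions

/-! ### Rules for solvability, and monotonicity of peeling. -/

section Basic

variable {V : Type} {G : SimpleGraph V} {D : V → Set V} {F B C K Y W X : Set V}
  {a b c e f g k p q t u v w x y z : V} {i j m : ℕ}

theorem Solv.of_cuts (hC : IsRow G C) (h : ∀ I ⊆ C, G.IsIndepSet I → ∃ K, IsCut G K ∧
    Disjoint I K ∧ (K ∩ C).Nonempty ∧ ∀ v ∈ C \ K, Solv G (comp G (C \ K) v)) : Solv G C := by
  classical
  choose! K h1 h2 h3 h4 using h
  exact .step C hC K (fun I hI hi => ⟨h1 I hI hi, h2 I hI hi, h3 I hI hi⟩) h4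

theorem comp_connected : ∀ u ∈ comp G W x, ∀ v ∈ comp G W x, Conn G (comp G W x) u v :=
  fun _ hu _ hv => Conn.in_comp₂ hu hv

theorem comp_eq_self (hK : ∀ u ∈ K, ∀ v ∈ K, Conn G K u v) (hx : x ∈ K) : comp G K x = K :=
  comp_subset.antisymm (subset_comp hx hK subset_rfl)

theorem comp_comp (hv : v ∈ comp G W x) : comp G (comp G W x) v = comp G W x :=
  comp_eq_self comp_connected hv

theorem comp_diff (hv : v ∈ comp G W x) (X : Set V) :
    comp G (comp G W x \ X) v = comp G (W \ X) v := by
  refine (comp_eq_of_subset (Set.sdiff_subset_sdiff_left comp_subset) fun u hu => ?_).symm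
  refine ⟨?_, (comp_subset hu).2⟩
  rw [← comp_eq_of_mem hv]
  exact comp_mono Set.sdiff_subset hu

/-- A walk that leaves `K` does so along an edge. -/
theorem Conn.exists_exit (h : Conn G W x y) (hx : x ∈ K) (hy : y ∉ K) :
    ∃ k ∈ K, ∃ t ∈ W, t ∉ K ∧ G.Adj k t := by
  by_contra! hno
  exact hy (Conn.induct (P := fun v => v ∈ K) h hx fun u v hu ha _ hv => by
    by_contra hvK
    exact hno u hu v hv hvK ha)

theorem exists_neighbor (h : Conn G W v q) (hne : v ≠ q) :
    ∃ k, G.Adj k q ∧ k ∈ comp G (W \ {q}) v := by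
  have hv : v ∈ comp G (W \ {q}) v := .refl ⟨h.left_mem, hne⟩
  obtain ⟨k, hk, t, ht, htK, hkt⟩ := h.exists_exit hv fun hq => (comp_subset hq).2 rfl
  by_cases htq : t = q
  · exact ⟨k, htq ▸ hkt, hk⟩
  · exact (htK (comp_adj hk hkt ⟨ht, htq⟩)).elim

/-- Branching on `q`: an independent set without `q` avoids the cut `{q}`, and one with `q` avoids
the neighbours of `q`. The latter cut isolates `q`, and the other components are those of `C`
without the closed neighbourhood. -/
theorem Solv.of_vertex (hC : IsRow G C) (hcon : ∀ u ∈ C, ∀ v ∈ C, Conn G C u v) (hq : q ∈ C)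
    (h1 : IsCut G {q}) (h2 : IsCut G (nb G q))
    (hout : ∀ v ∈ C, v ≠ q → Solv G (comp G (C \ {q}) v))
    (hin : ∀ v ∈ C, v ≠ q → ¬ G.Adj v q → Solv G (comp G (C \ cl G q) v)) : Solv G C := by
  by_cases hs : ∃ v ∈ C, v ≠ q
  swap
  · push Not at hs
    have : C = {q} := Set.eq_singleton_iff_unique_mem.2 ⟨hq, hs⟩
    exact this ▸ .single q
  obtain ⟨v, hv, hvq⟩ := hs
  obtain ⟨k, hkq, hk⟩ := exists_neighbor (hcon v hv q hq) hvq
  refine .of_cuts hC fun I hI hi => ?_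
  by_cases hqI : q ∈ I
  · refine ⟨nb G q, h2, ?_, ⟨k, hkq, (comp_subset hk).1⟩, ?_⟩
    · rw [Set.disjoint_left]
      intro u hu huq
      exact hi hu hqI huq.ne huq
    · rintro u ⟨huC, huq⟩
      by_cases hne : u = q
      · subst hne
        have : comp G (C \ nb G u) u = {u} := by
          refine (comp_subset_of_closed (K := {u}) (fun _ => rfl) ?_).antisymm
            (Set.singleton_subset_iff.2 (mem_comp_self (show u ∈ C \ nb G u from ⟨huC, huq⟩)))
          rintro _ rfl w hw ha
          exact (hw.2 ha.symm).elim
        exact this ▸ .single u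
      · have : comp G (C \ nb G q) u = comp G (C \ cl G q) u := by
          refine (comp_congr ⟨huC, ?_⟩ (comp_subset.trans ?_) ?_)
          · rintro (h | h)
            exacts [hne h, huq h]
          · exact Set.sdiff_subset_sdiff_right fun w hw => .inr hw
          · rintro w hw w' hw' ha
            refine ⟨hw'.1, ?_⟩
            rintro (rfl | h)
            · exact (comp_subset hw).2 (.inr ha)
            · exact hw'.2 h
        rw [this]
        exact hin u huC hne huq
  · exact ⟨{q}, h1, by simpa using hqI, ⟨q, rfl, hq⟩, fun u hu => hout u hu.1 hu.2⟩

/-- Branching on `S`: an independent set that avoids `S` is treated with the cut `S`; one that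
contains some `z` of `S` avoids all neighbours of `z`, in particular the gate. -/
theorem Solv.of_sel {S : Set V} (hC : IsRow G C) (hcon : ∀ u ∈ C, ∀ v ∈ C, Conn G C u v)
    (hS : IsCut G S) (hSC : (S ∩ C).Nonempty) (hQ : ∀ z, IsCut G (gate G c z))
    (h1 : ∀ v ∈ C \ S, Solv G (comp G (C \ S) v))
    (h2 : ∀ z ∈ S ∩ C, ∀ v ∈ C \ gate G c z, Solv G (comp G (C \ gate G c z) v)) :
    Solv G C := by
  -- A cut has to meet `C`. If the gate of some `z` does not, then `C` itself is the piece behind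
  -- this gate and is solvable by `h2`.
  by_cases hex : ∃ z ∈ S ∩ C, ¬ (gate G c z ∩ C).Nonempty
  · obtain ⟨z, hz, hne⟩ := hex
    have hd : C \ gate G c z = C := by
      refine Set.Subset.antisymm Set.sdiff_subset fun u hu => ⟨hu, fun h => hne ⟨u, h, hu⟩⟩
    have := h2 z hz z (by rw [hd]; exact hz.2)
    rwa [hd, comp_eq_self hcon hz.2] at this
  push Not at hex
  refine .of_cuts hC fun I hI hi => ?_
  by_cases hz : ∃ z ∈ I, z ∈ S
  · obtain ⟨z, hzI, hzS⟩ := hz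
    refine ⟨gate G c z, hQ z, ?_, hex z ⟨hzS, hI hzI⟩, h2 z ⟨hzS, hI hzI⟩⟩
    rw [Set.disjoint_left]
    intro u hu huz
    exact hi hu hzI huz.1.ne huz.1
  · push Not at hz
    exact ⟨S, hS, Set.disjoint_left.2 hz, hSC, h1⟩

theorem lev_zero : lev G F c x y 0 = F := by simp [lev, del]

theorem lev_succ : lev G F c x y (i + 1) = lev G F c x y i \ sel G c (bl G F c x y i) := by
  simp only [lev, bl, del, Set.sdiff_sdiff]

theorem lev_antitone : Antitone (lev G F c x y) :=
  antitone_nat_of_succ_le fun i => by rw [lev_succ]; exact Set.sdiff_subset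

theorem bl_antitone : Antitone (bl G F c x y) := fun _ _ h => blk_mono (lev_antitone h)

theorem bl_subset : bl G F c x y i ⊆ lev G F c x y i := blk_subset

/-- A vertex removed between rounds `j` and `i` belongs to the block of round `j`. -/
theorem mem_bl_of_lev (hj : v ∈ lev G F c x y j) (hi : v ∉ lev G F c x y i) (hji : j ≤ i) :
    v ∈ bl G F c x y j := by
  induction i, hji using Nat.le_induction with
  | base => exact (hi hj).elim
  | succ i hji ih =>
    by_cases h : v ∈ lev G F c x y i
    · rw [lev_succ] at hi
      have : v ∈ sel G c (bl G F c x y i) := by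
        by_contra hs
        exact hi ⟨h, hs⟩
      exact bl_antitone hji this.1
    · exact ih h

theorem far_self : far G z z = ∅ :=
  Set.eq_empty_of_forall_notMem fun _ h => h.left_mem (.inl rfl)

end Basic

/-! ### The progress of peeling. -/

section Structure

variable {V : Type} {G : SimpleGraph V} {D : V → Set V} {F B C K Y W X : Set V}
  {a b c e f g k p q t u v w x y z : V} {i j m : ℕ}

/-- The sets from which the peeling may start. -/
def Valid (G : SimpleGraph V) (D : V → Set V) (F : Set V) : Prop :=
  (∃ a z f, F = comp G (gate G a z)ᶜ f) ∧ ∀ u ∈ F, ∀ x ∈ F, x ∈ D u → far G x u ⊆ F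

/-- `c` is a root of the block of `xy` in `F`, and `i` rounds of peeling succeed, the edge `xy`
being present before each of them. -/
structure Peel (G : SimpleGraph V) (D : V → Set V) (F : Set V) (c x y : V) (i : ℕ) : Prop where
  valid : Valid G D F
  adj : G.Adj x y
  left : ∀ j < i, x ∈ lev G F c x y j
  right : ∀ j < i, y ∈ lev G F c x y j
  left₀ : x ∈ F
  right₀ : y ∈ F
  mem : c ∈ bl G F c x y 0
  root : ∀ v ∈ bl G F c x y 0, v = c ∨ G.Adj v c ∨ v ∈ D c
  free : ∀ p ∈ bl G F c x y 0, G.Adj p c → ∀ v ∈ bl G F c x y 0, v ∉ D p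
  nonempty : ∀ j < i, (sel G c (bl G F c x y j)).Nonempty

/-- The edge `xy` is still present after `i` rounds of peeling. -/
structure Node (G : SimpleGraph V) (D : V → Set V) (F : Set V) (c x y : V) (i : ℕ) : Prop
    extends Peel G D F c x y i where
  left_mem : x ∈ lev G F c x y i
  right_mem : y ∈ lev G F c x y i

/-- Each successful round deletes a vertex and `q` is still there. Hence the round number stays in
the range over which rows and cuts are enumerated. -/
theorem Peel.lt_card [Finite V] (h : Peel G D F c x y i) (hq : q ∈ lev G F c x y i) :
    i < Nat.card V := by
  have key : ∀ j ≤ i, j ≤ (del G F c x y j).ncard := by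
    intro j hj
    induction j with
    | zero => exact Nat.zero_le _
    | succ j ih =>
      obtain ⟨s, hs⟩ := h.nonempty j hj
      have hs' : s ∉ del G F c x y j := (bl_subset hs.1).2
      have h1 : del G F c x y j ⊂ del G F c x y (j + 1) :=
        ⟨Set.subset_union_left, fun h => hs' (h (.inr hs))⟩
      exact (ih (by omega)).trans_lt (Set.ncard_lt_ncard h1)
  refine (key i le_rfl).trans_lt ?_
  rw [← Set.ncard_univ]
  exact Set.ncard_lt_ncard ⟨Set.subset_univ _, fun h => hq.2 (h trivial)⟩

theorem Peel.mono (h : Peel G D F c x y i) (hj : j ≤ i) : Peel G D F c x y j :=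
  { h with
    left := fun k hk => h.left k (hk.trans_le hj)
    right := fun k hk => h.right k (hk.trans_le hj)
    nonempty := fun k hk => h.nonempty k (hk.trans_le hj) }

theorem Node.succ (h : Node G D F c x y i) (hs : (sel G c (bl G F c x y i)).Nonempty) :
    Peel G D F c x y (i + 1) :=
  { h.toPeel with
    left := fun j hj => lev_antitone (Nat.lt_succ_iff.1 hj) h.left_mem
    right := fun j hj => lev_antitone (Nat.lt_succ_iff.1 hj) h.right_mem
    nonempty := fun j hj => by
      rcases Nat.lt_succ_iff_lt_or_eq.1 hj with hj | rfl
      exacts [h.nonempty j hj, hs] }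

theorem Node.left_bl (h : Node G D F c x y i) (hj : j ≤ i) : x ∈ bl G F c x y j :=
  left_mem_blk (lev_antitone hj h.left_mem)

theorem Node.right_bl (h : Node G D F c x y i) (hj : j ≤ i) : y ∈ bl G F c x y j :=
  right_mem_blk (lev_antitone hj h.right_mem)

section

variable (N : Nested G D)
include N

theorem Nested.exists_node (hF : Valid G D F) (hx : x ∈ F) (hy : y ∈ F) (hxy : G.Adj x y) :
    ∃ c, Node G D F c x y 0 := by
  have hxB : x ∈ blk G F x y := left_mem_blk hx
  have hyB : y ∈ blk G F x y := right_mem_blk hy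
  have hcx : ∀ v ∈ blk G F x y, Conn G (blk G F x y) v x := by
    intro v hv
    rcases eq_or_ne v y with rfl | hne
    · exact .of_adj hxy.symm hyB hxB
    · exact (blk_conn_self hxy hv hxB hne hxy.ne).mono Set.sdiff_subset
  obtain ⟨c, hc, h1, h2⟩ := N.root (blk G F x y) ⟨x, hxB⟩
    (fun v hv w hw => (hcx v hv).trans (hcx w hw).symm)
    (fun q v hv w hw hvq hwq => blk_conn_self hxy hv hw hvq hwq)
  have hb : bl G F c x y 0 = blk G F x y := by rw [bl, lev_zero]
  exact ⟨c, ⟨⟨hF, hxy, by simp, by simp, hx, hy, hb ▸ hc, hb ▸ h1, hb ▸ h2, by simp⟩,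
    by rwa [lev_zero], by rwa [lev_zero]⟩⟩

/-- A walk that starts in `D u` and avoids the closed neighbourhood of `u` cannot leave `D u`. -/
theorem Nested.far_subset (hx : x ∈ D u) : far G x u ⊆ D u := by
  refine comp_subset_of_closed (fun _ => hx) fun v hv w hw ha => ?_
  exact (N.closed hv ha).resolve_right fun h => hw (.inr h)

theorem Nested.not_mem_self : u ∉ D u := fun h => N.asymm h h

theorem Nested.mem_far (hz : z ∈ D c) : c ∈ far G c z := by
  refine .refl ?_
  rintro (rfl | h)
  exacts [N.not_mem_self hz, N.not_adj hz h.symm]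

/-- The root is selected because `far` is empty at equal arguments. A neighbour of `c` is never
selected, and for `v` in `D c` the root itself lies both in `far G c v` and in the block. -/
theorem Nested.sel_zero (h : Peel G D F c x y i) : sel G c (bl G F c x y 0) = {c} := by
  refine Set.eq_singleton_iff_unique_mem.2 ⟨⟨h.mem, fun h => h.ne rfl, ?_⟩, ?_⟩
  · rw [far_self]
    simp
  · rintro v ⟨hv, hcv, hfar⟩
    rcases h.root v hv with hr | hr | hr
    · exact hr
    · exact (hcv hr.symm).elim
    · exact (hfar c (N.mem_far hr) h.mem).elim

theorem Nested.root_notMem_lev (h : Peel G D F c x y i) (hj : 0 < j) : c ∉ lev G F c x y j := by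
  intro hc
  have := lev_antitone hj hc
  rw [lev_succ, N.sel_zero h] at this
  exact this.2 rfl

/-- If the root is still present, no round has taken place. -/
theorem Nested.sel_eq_root (h : Peel G D F c x y i) (hc : c ∈ lev G F c x y i)
    (hz : z ∈ sel G c (bl G F c x y i)) : z = c := by
  rcases Nat.eq_zero_or_pos i with rfl | hi
  · rw [N.sel_zero h] at hz
    exact hz
  · exact (N.root_notMem_lev h hi hc).elim

/-- After the first round the current block has a root `u` different from `c`. It turns out that `u`
lies in `D c`, and then `u` is selected. The third vertex `w` rules out a block that is a single
edge. -/
theorem Nested.sel_nonempty (h : Node G D F c x y i) (hw : w ∈ bl G F c x y i) (hwx : w ≠ x)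
    (hwy : w ≠ y) : (sel G c (bl G F c x y i)).Nonempty := by
  rcases Nat.eq_zero_or_pos i with rfl | hi
  · rw [N.sel_zero h.toPeel]
    exact Set.singleton_nonempty c
  set B := bl G F c x y i with hB
  have hxB : x ∈ B := h.left_bl le_rfl
  have hyB : y ∈ B := h.right_bl le_rfl
  have hB0 : B ⊆ bl G F c x y 0 := bl_antitone (Nat.zero_le i)
  have hcx : ∀ v ∈ B, Conn G B v x := by
    intro v hv
    rcases eq_or_ne v y with rfl | hne
    · exact .of_adj h.adj.symm hyB hxB
    · exact (blk_conn_self h.adj hv hxB hne h.adj.ne).mono Set.sdiff_subset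
  obtain ⟨u, hu, h1, -⟩ := N.root B ⟨x, hxB⟩
    (fun v hv w hw => (hcx v hv).trans (hcx w hw).symm)
    (fun q v hv w hw hvq hwq => blk_conn_self h.adj hv hw hvq hwq)
  have huc : u ≠ c := by
    rintro rfl
    exact N.root_notMem_lev h.toPeel hi (bl_subset hu)
  have huD : u ∈ D c := by
    rcases h.root u (hB0 hu) with hr | hr | hr
    · exact (huc hr).elim
    -- If `u` were a neighbour of `c`, then by `free` nothing in the block would be below `u`, so
    -- all its other vertices would be neighbours of `u`. Two of them are joined in the block
    -- without `u`, which yields a triangle.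
    · exfalso
      have hadj : ∀ v ∈ B, v ≠ u → G.Adj v u := fun v hv hvu =>
        ((h1 v hv).resolve_left hvu).resolve_right (h.free u (hB0 hu) hr v (hB0 hv))
      have hpair : ∀ v ∈ B, ∀ w ∈ B, v ≠ u → w ≠ u → v ≠ w → False := by
        intro v hv w hw hvu hwu hvw
        obtain ⟨k, hkw, hk⟩ := exists_neighbor (blk_conn_self h.adj hv hw hvu hwu) hvw
        have hk' := (comp_subset hk).1
        exact N.triangle_free hkw (hadj w hw hwu) (hadj k hk'.1 hk'.2)
      by_cases hxu : x = u
      · exact hpair y hyB w hw (hxu ▸ h.adj.ne') (hxu ▸ hwx) hwy.symm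
      · by_cases hyu : y = u
        · exact hpair x hxB w hw hxu (hyu ▸ hwy) hwx.symm
        · exact hpair x hxB y hyB hxu hyu h.adj.ne
    · exact hr
  -- A block vertex `o` in `far G c u` would lie in `D u` as `u` is a root. Its component, which
  -- contains `c`, would then lie in `D u` too, although `u` is in `D c`.
  refine ⟨u, hu, fun ha => N.not_adj huD ha.symm, fun o ho hoB => ?_⟩
  have hou : o ∉ cl G u := comp_subset ho
  rcases h1 o hoB with h2 | h2 | h2
  · exact hou (.inl h2)
  · exact hou (.inr h2)
  · refine N.asymm huD (N.far_subset h2 ?_)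
    exact Conn.symm ho

end

/-- Peeling depends only on the block. -/
theorem Peel.change_edge (h : Peel G D F c x y i) (hx : ∀ j < i, u ∈ bl G F c x y j)
    (hy : ∀ j < i, v ∈ bl G F c x y j) (huv : G.Adj u v) :
    ∀ j ≤ i, del G F c u v j = del G F c x y j := by
  intro j hj
  induction j with
  | zero => rfl
  | succ j ih =>
    have hb : blk G (F \ del G F c x y j) u v = blk G (F \ del G F c x y j) x y :=
      blk_eq_of_edge h.adj (h.left j hj) (h.right j hj) (hx j hj) (hy j hj) huv
    simp only [del, ih (by omega), hb]

/-- An edge that stayed in the block during all rounds can replace `xy`. At least one round is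
needed for the edge to be known to lie in the block whose root is `c`. -/
theorem Peel.node_of_edge (h : Peel G D F c x y i) (hi : 0 < i)
    (hx : ∀ j < i, u ∈ bl G F c x y j) (hy : ∀ j < i, v ∈ bl G F c x y j) (huv : G.Adj u v)
    (hu : u ∈ lev G F c x y i) (hv : v ∈ lev G F c x y i) :
    Node G D F c u v i ∧ lev G F c u v i = lev G F c x y i := by
  have hl : ∀ j ≤ i, lev G F c u v j = lev G F c x y j := fun j hj => by
    rw [lev, lev, h.change_edge hx hy huv j hj]
  have hb : ∀ j < i, bl G F c u v j = bl G F c x y j := fun j hj => by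
    rw [bl, bl, hl j hj.le]
    exact blk_eq_of_edge h.adj (h.left j hj) (h.right j hj) (hx j hj) (hy j hj) huv
  refine ⟨⟨⟨h.valid, huv, ?_, ?_, hu.1, hv.1, ?_, ?_, ?_, ?_⟩, ?_, ?_⟩, hl i le_rfl⟩
  · intro j hj
    rw [hl j hj.le]
    exact bl_subset (hx j hj)
  · intro j hj
    rw [hl j hj.le]
    exact bl_subset (hy j hj)
  · rw [hb 0 hi]
    exact h.mem
  · rw [hb 0 hi]
    exact h.root
  · rw [hb 0 hi]
    exact h.free
  · intro j hj
    rw [hb j hj]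
    exact h.nonempty j hj
  · rwa [hl i le_rfl]
  · rwa [hl i le_rfl]

theorem exists_first_failure (P : ℕ → Prop) (i : ℕ) :
    ∃ j ≤ i, (∀ j' < j, P j') ∧ (j = i ∨ ¬ P j) := by
  induction i with
  | zero => exact ⟨0, le_rfl, by simp, .inl rfl⟩
  | succ i ih =>
    obtain ⟨j, hj, h1, h2⟩ := ih
    by_cases hP : P j
    · rcases h2 with rfl | h2
      · refine ⟨j + 1, le_rfl, fun j' hj' => ?_, .inl rfl⟩
        rcases Nat.lt_succ_iff_lt_or_eq.1 hj' with h | rfl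
        exacts [h1 j' h, hP]
      · exact (h2 hP).elim
    · exact ⟨j, by omega, h1, .inr hP⟩

/-- The part of a round behind an edge whose first end has survived in the block is seen by the
peeling that starts from this edge. -/
theorem Nested.relocate (N : Nested G D) (h : Peel G D F c x y i) (hq : q ∈ lev G F c x y i)
    (hk : k ∈ lev G F c x y i) (hqk : G.Adj q k) (hqB : ∀ j < i, q ∈ bl G F c x y j) :
    ∃ c' j, Node G D F c' q k j ∧
      comp G (lev G F c' q k j \ {q}) k = comp G (lev G F c x y i \ {q}) k ∧
      ∀ g ∈ comp G (lev G F c x y i \ {q}) k,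
        comp G (lev G F c' q k j \ cl G q) g = comp G (lev G F c x y i \ cl G q) g := by
  obtain ⟨j, hji, hkB, hj⟩ := exists_first_failure (fun j => k ∈ bl G F c x y j) i
  -- For `j = 0` the peeling restarts in `F` with a root of the block of `qk`. For positive `j` the
  -- edge `qk` was in all blocks before round `j`, so the root `c` can be kept.
  have hnode : ∃ c', Node G D F c' q k j ∧ lev G F c' q k j = lev G F c x y j := by
    rcases Nat.eq_zero_or_pos j with rfl | hj0
    · obtain ⟨c', hc'⟩ := N.exists_node h.valid hq.1 hk.1 hqk
      exact ⟨c', hc', by rw [lev_zero, lev_zero]⟩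
    · exact ⟨c, (h.mono hji).node_of_edge hj0 (fun j' hj' => hqB j' (hj'.trans_le hji)) hkB hqk
        (lev_antitone hji hq) (lev_antitone hji hk)⟩
  obtain ⟨c', hc', hlev⟩ := hnode
  -- The later rounds do not reach behind `q`: a vertex deleted there would belong to the block of
  -- round `j`, and then so would `k` by `blk_step`.
  have hsub : comp G (lev G F c x y j \ {q}) k ⊆ lev G F c x y i := by
    intro v hv
    by_contra hvi
    have hne : j ≠ i := by
      rintro rfl
      exact hvi (comp_subset hv).1
    have hvB := mem_bl_of_lev (comp_subset hv).1 hvi hji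
    refine hj.resolve_left hne (blk_step (hqB j (by omega)) (lev_antitone hji hk)
      hqk.symm hvB (comp_subset hv).2 hv)
  have hmono : lev G F c x y i ⊆ lev G F c x y j := lev_antitone hji
  refine ⟨c', j, hc', ?_, fun g hg => ?_⟩
  · rw [hlev]
    exact comp_eq_of_subset (Set.sdiff_subset_sdiff_left hmono) fun v hv =>
      ⟨hsub hv, (comp_subset hv).2⟩
  · rw [hlev]
    refine comp_eq_of_subset (Set.sdiff_subset_sdiff_left hmono) fun v hv =>
      ⟨hsub ?_, (comp_subset hv).2⟩
    rw [← comp_eq_of_mem (comp_mono (Set.sdiff_subset_sdiff_left hmono) hg)]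
    refine comp_mono (Set.sdiff_subset_sdiff_right ?_) hv
    exact Set.singleton_subset_iff.2 (.inl rfl)

end Structure

end Burling

namespace Burling

/-! ### Pieces that are solvable by induction. -/

section Solvable

variable {V : Type} {G : SimpleGraph V} {D : V → Set V} {F B C K Y W X : Set V}
  {a b c e f g k p q t u v w x y z : V} {i j m : ℕ}

/-- Vertex `b` of the block that is not separated from `z` by `gate G c z`: its component in the
complement of the gate is a new starting set, and no round of peeling has touched it. -/
theorem Nested.fresh [Finite V] (N : Nested G D) (h : Node G D F c x y i)
    (hz : z ∈ sel G c (bl G F c x y i)) (hb : b ∈ bl G F c x y i) (hbQ : b ∉ gate G c z)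
    (hbc : b ≠ c) :
    Valid G D (comp G (gate G c z)ᶜ b) ∧ comp G (gate G c z)ᶜ b ⊆ lev G F c x y i ∧
      (comp G (gate G c z)ᶜ b).ncard < F.ncard := by
  set Q := gate G c z with hQ
  set L := comp G Qᶜ b with hL
  have hnc : ∀ p, G.Adj p c → p ∈ far G c z ∨ p ∈ Q := by
    intro p hp
    by_cases hcz : c = z
    · exact .inr ⟨hcz ▸ hp, .inl hcz⟩
    · have hc : c ∈ far G c z := .refl fun h => h.elim hcz hz.2.1 |>.elim
      by_cases hpz : G.Adj p z
      · exact .inr ⟨hpz, .inr ⟨c, hc, hp⟩⟩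
      · refine .inl (comp_adj hc hp.symm ?_)
        rintro (rfl | h)
        exacts [hz.2.1 hp.symm, hpz h]
  have hexit : ∀ o ∈ far G c z, ∀ w, G.Adj o w → w ∈ far G c z ∨ w ∈ Q := by
    intro o ho w how
    by_cases hwz : G.Adj w z
    · exact .inr ⟨hwz, .inr ⟨o, ho, how.symm⟩⟩
    · refine .inl (comp_adj ho how ?_)
      rintro (rfl | h)
      exacts [comp_subset ho (.inr how), hwz h]
  -- `far G c z` can be left only through the gate. If `L` met it, then `L` would lie inside it, but
  -- `z` is selected and so no block vertex is in it.
  have hLfar : ∀ u ∈ L, u ∉ far G c z := by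
    intro u hu huf
    have : L ⊆ far G c z := by
      rw [hL, ← comp_eq_of_mem hu]
      exact comp_subset_of_closed (fun _ => huf) fun o ho w hw ha =>
        (hexit o ho w ha).resolve_right hw
    exact hz.2.2 b (this (mem_comp_self hbQ)) hb
  have hbD : b ∈ D c := by
    rcases h.root b (bl_antitone (Nat.zero_le i) hb) with hr | hr | hr
    · exact (hbc hr).elim
    · rcases hnc b hr with h' | h'
      exacts [(hLfar b (mem_comp_self hbQ) h').elim, (hbQ h').elim]
    · exact hr
  -- To leave `D c`, `L` would have to pass a neighbour of `c`, and these lie in `far G c z` or in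
  -- the gate.
  have hLD : L ⊆ D c := by
    have : L ⊆ {u | u ∈ D c ∧ u ∉ far G c z ∧ u ∉ Q} := by
      refine comp_subset_of_closed (fun hbQ => ⟨hbD, hLfar b (mem_comp_self hbQ), hbQ⟩) ?_
      rintro u ⟨huD, huf, huQ⟩ w hw ha
      have hwf : w ∉ far G c z := fun hwf => (hexit w hwf u ha.symm).elim huf huQ
      exact ⟨(N.closed huD ha).resolve_right fun hwc => (hnc w hwc).elim hwf hw, hwf, hw⟩
    exact fun u hu => (this hu).1
  -- `L` avoids the closed neighbourhood of `c`, so it lies in `far G b c`, which the validity of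
  -- `F` keeps inside `F`.
  have hLF : L ⊆ F := by
    have hbF : b ∈ F := (bl_subset hb).1
    have hcF : c ∈ F := (bl_subset h.mem).1
    refine Set.Subset.trans ?_ (h.valid.2 c hcF b hbF hbD)
    refine subset_comp (mem_comp_self hbQ) comp_connected fun u hu => ?_
    rintro (rfl | hc)
    exacts [N.not_mem_self (hLD hu), N.not_adj (hLD hu) hc]
  have hcL : c ∉ L := fun hc => N.not_mem_self (hLD hc)
  refine ⟨⟨⟨c, z, b, rfl⟩, ?_⟩, ?_, ?_⟩
  -- If the component of `x'` left `L`, it would do so through a gate vertex in `D u`. From there `D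
  -- u` would spread over `far G c z` up to `c`, as no vertex of `far G c z` is adjacent to `u`; but
  -- `u` is in `D c`. If `c = z`, the gate vertex is adjacent to `c` directly.
  · intro u hu x' hx' hxu
    by_contra hsub
    obtain ⟨w', hw', hwL'⟩ := Set.not_subset.1 hsub
    obtain ⟨k, hk, w, hw, hwL, hkw⟩ := (Conn.in_comp hw').exists_exit hx' hwL'
    have hwQ : w ∈ Q := by
      by_contra hwQ
      exact hwL (comp_adj hk hkw hwQ)
    have hwD : w ∈ D u := N.far_subset hxu hw
    obtain ⟨hwz, rfl | ⟨o, ho, hwo⟩⟩ := hwQ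
    · rcases N.closed hwD hwz with h' | h'
      exacts [N.asymm h' (hLD hu), N.not_adj (hLD hu) h'.symm]
    · have hno : ∀ o ∈ far G c z, ¬ G.Adj o u := fun o ho hou =>
        (hexit o ho u hou).elim (hLfar u hu) (comp_subset hu)
      have hoD : o ∈ D u := (N.closed hwD hwo).resolve_right (hno o ho)
      refine N.asymm (hLD hu) (Conn.induct (P := fun v => v ∈ D u)
        (Conn.in_comp ho).symm hoD fun v w hv ha _ hw => ?_)
      exact (N.closed hv ha).resolve_right (hno w hw)
  -- If some round `j < i` had deleted `d`, then it would also have deleted `z`: `far G c z`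
  -- contains no neighbour of `d`, so it lies in `far G c d`, which misses the block of that round.
  · intro d hd
    by_contra hdi
    have : ∀ j ≤ i, d ∈ lev G F c x y j := by
      intro j hj
      induction j with
      | zero => rw [lev_zero]; exact hLF hd
      | succ j ih =>
        rw [lev_succ]
        refine ⟨ih (by omega), fun hdS => ?_⟩
        have hfar : far G c z ⊆ far G c d := by
          intro o ho
          refine (Conn.in_comp ho).mono fun o' ho' => ?_
          rintro (rfl | ha)
          · exact hLfar _ hd ho'
          · exact (hexit o' ho' d ha).elim (hLfar d hd) (comp_subset hd)
        have hzi : z ∈ lev G F c x y (j + 1) := lev_antitone hj (bl_subset hz.1)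
        rw [lev_succ] at hzi
        exact hzi.2 ⟨bl_antitone (by omega) hz.1, hz.2.1, fun o ho => hdS.2.2 o (hfar ho)⟩
    exact hdi (this i le_rfl)
  · exact Set.ncard_lt_ncard ⟨hLF, fun hF => hcL (hF (bl_subset h.mem).1)⟩

/-- All sets of fewer than `m` vertices behind a vertex are solvable. -/
def OutSolv (G : SimpleGraph V) (D : V → Set V) (m : ℕ) : Prop :=
  ∀ F c x y i, Node G D F c x y i → (comp G (lev G F c x y i \ {x}) y).ncard < m →
    Solv G (comp G (lev G F c x y i \ {x}) y)

/-- All sets of fewer than `m` vertices behind a closed neighbourhood are solvable. -/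
def InSolv (G : SimpleGraph V) (D : V → Set V) (m : ℕ) : Prop :=
  ∀ F c x y i g, Node G D F c x y i → g ∈ comp G (lev G F c x y i \ {x}) y → ¬ G.Adj g x →
    (comp G (lev G F c x y i \ cl G x) g).ncard < m →
    Solv G (comp G (lev G F c x y i \ cl G x) g)

/-- By relocation, the induction hypothesis covers the pieces behind every vertex that has survived
in the block, not only those behind `x` along the edge `xy`. -/
theorem OutSolv.peel (N : Nested G D) (ho : OutSolv G D m) (h : Peel G D F c x y i)
    (hq : q ∈ lev G F c x y i) (hk : k ∈ lev G F c x y i) (hqk : G.Adj q k)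
    (hqB : ∀ j < i, q ∈ bl G F c x y j)
    (hm : (comp G (lev G F c x y i \ {q}) k).ncard < m) :
    Solv G (comp G (lev G F c x y i \ {q}) k) := by
  obtain ⟨c', j, hn, he, -⟩ := N.relocate h hq hk hqk hqB
  rw [← he] at hm ⊢
  exact ho _ _ _ _ _ hn hm

theorem InSolv.peel (N : Nested G D) (ho : InSolv G D m) (h : Peel G D F c x y i)
    (hq : q ∈ lev G F c x y i) (hk : k ∈ lev G F c x y i) (hqk : G.Adj q k)
    (hqB : ∀ j < i, q ∈ bl G F c x y j) (hg : g ∈ comp G (lev G F c x y i \ {q}) k)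
    (hgq : ¬ G.Adj g q) (hm : (comp G (lev G F c x y i \ cl G q) g).ncard < m) :
    Solv G (comp G (lev G F c x y i \ cl G q) g) := by
  obtain ⟨c', j, hn, he, he'⟩ := N.relocate h hq hk hqk hqB
  rw [← he' g hg] at hm ⊢
  exact ho _ _ _ _ _ _ hn (he ▸ hg) hgq hm

section Rows

theorem Peel.isRow_comp [Finite V] (h : Peel G D F c x y i) (hq : q ∈ lev G F c x y i) (g : V) :
    IsRow G (comp G (lev G F c x y i) g) := by
  have hi := h.lt_card hq
  obtain ⟨⟨a, z, f, rfl⟩, -⟩ := h.valid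
  exact ⟨a, z, f, c, x, y, x, g, i, hi, .inr (.inr (.inr rfl))⟩

theorem Peel.isRow_out [Finite V] (h : Peel G D F c x y i) (hq : q ∈ lev G F c x y i) (e g : V) :
    IsRow G (comp G (lev G F c x y i \ {e}) g) := by
  have hi := h.lt_card hq
  obtain ⟨⟨a, z, f, rfl⟩, -⟩ := h.valid
  exact ⟨a, z, f, c, x, y, e, g, i, hi, .inl rfl⟩

theorem Peel.isRow_in [Finite V] (h : Peel G D F c x y i) (hq : q ∈ lev G F c x y i) (e g : V) :
    IsRow G (comp G (lev G F c x y i \ cl G e) g) := by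
  have hi := h.lt_card hq
  obtain ⟨⟨a, z, f, rfl⟩, -⟩ := h.valid
  exact ⟨a, z, f, c, x, y, e, g, i, hi, .inr (.inl rfl)⟩

theorem Peel.isCut_sel [Finite V] (h : Peel G D F c x y i) (hq : q ∈ lev G F c x y i) :
    IsCut G (sel G c (bl G F c x y i)) := by
  have hi := h.lt_card hq
  obtain ⟨⟨a, z, f, rfl⟩, -⟩ := h.valid
  exact ⟨a, z, f, c, x, y, x, i, hi, .inr (.inr (.inr rfl))⟩

theorem isCut_singleton [Finite V] (e : V) : IsCut G {e} :=
  have := Nonempty.intro e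
  ⟨e, e, e, e, e, e, e, 0, Nat.card_pos, .inl rfl⟩

theorem isCut_nb [Finite V] (e : V) : IsCut G (nb G e) :=
  have := Nonempty.intro e
  ⟨e, e, e, e, e, e, e, 0, Nat.card_pos, .inr (.inl rfl)⟩

theorem isCut_gate [Finite V] (a z : V) : IsCut G (gate G a z) :=
  have := Nonempty.intro a
  ⟨a, z, a, a, a, a, a, 0, Nat.card_pos, .inr (.inr (.inl rfl))⟩

end Rows

variable [Finite V] (N : Nested G D)
include N

/-- Branching on `q`: all pieces that remain lie behind `q` or its closed neighbourhood and have
lost `q`, so they fall under the induction hypotheses for `m`. -/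
theorem Nested.solv_comp (ho : OutSolv G D m) (hi : InSolv G D m) (h : Peel G D F c x y i)
    (hq : q ∈ lev G F c x y i) (hqB : ∀ j < i, q ∈ bl G F c x y j)
    (hm : (comp G (lev G F c x y i) q).ncard ≤ m) : Solv G (comp G (lev G F c x y i) q) := by
  have hlt : ∀ K ⊆ comp G (lev G F c x y i) q, q ∉ K → K.ncard < m := fun K hK hqK =>
    (Set.ncard_lt_ncard ⟨hK, fun h => hqK (h (mem_comp_self hq))⟩).trans_le hm
  refine .of_vertex (h.isRow_comp hq q) comp_connected (mem_comp_self hq) (isCut_singleton q)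
    (isCut_nb q) ?_ ?_
  · intro v hv hvq
    obtain ⟨k, hkq, hk⟩ := exists_neighbor (Conn.symm hv) hvq
    have he : comp G (comp G (lev G F c x y i) q \ {q}) v = comp G (lev G F c x y i \ {q}) k := by
      rw [comp_diff hv, comp_eq_of_mem hk]
    have hs : comp G (comp G (lev G F c x y i) q \ {q}) v ⊆ comp G (lev G F c x y i) q \ {q} :=
      comp_subset
    have := hlt _ (hs.trans Set.sdiff_subset) fun h => (hs h).2 rfl
    rw [he] at this ⊢
    exact ho.peel N h hq (comp_subset hk).1 hkq.symm hqB this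
  · intro v hv hvq hvq'
    obtain ⟨k, hkq, hk⟩ := exists_neighbor (Conn.symm hv) hvq
    have hs : comp G (comp G (lev G F c x y i) q \ cl G q) v ⊆
      comp G (lev G F c x y i) q \ cl G q := comp_subset
    have := hlt _ (hs.trans Set.sdiff_subset) fun h => (hs h).2 (.inl rfl)
    rw [comp_diff hv] at this ⊢
    exact hi.peel N h hq (comp_subset hk).1 hkq.symm hqB (Conn.symm hk) hvq' this

/-- Any edge at `q` starts a peeling of `F` with zero rounds; without such an edge the connected set
`F` is a single vertex. -/
theorem Nested.solv_valid (ho : OutSolv G D m) (hi : InSolv G D m) (hF : Valid G D F)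
    (hq : q ∈ F) (hm : F.ncard ≤ m) : Solv G F := by
  have hFc : comp G F q = F := by
    obtain ⟨⟨a, z, f, rfl⟩, -⟩ := hF
    exact comp_comp hq
  by_cases hex : ∃ k ∈ F, G.Adj q k
  · obtain ⟨k, hk, hqk⟩ := hex
    obtain ⟨c, hc⟩ := N.exists_node hF hq hk hqk
    have := N.solv_comp (q := q) ho hi hc.toPeel (by rwa [lev_zero]) (by simp)
    rw [lev_zero, hFc] at this
    exact this hm
  · push Not at hex
    have : F = {q} := by
      refine Set.Subset.antisymm ?_ (Set.singleton_subset_iff.2 hq)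
      rw [← hFc]
      refine comp_subset_of_closed (fun _ => rfl) ?_
      rintro _ rfl v hv ha
      exact (hex v hv ha).elim
    exact this ▸ .single q

/-- A connected set whose attachments lie in the block, but which avoids it, is solvable. -/
theorem Nested.solv_attached (ho : OutSolv G D m) (h : Node G D F c x y i)
    (hK : ∀ u ∈ K, ∀ v ∈ K, Conn G K u v) (hKY : K ⊆ lev G F c x y i)
    (hKB : Disjoint K (bl G F c x y i)) (ht : t ∈ bl G F c x y i) (hk : k ∈ K) (hkt : G.Adj k t)
    (hN : ∀ u ∈ K, ∀ v ∈ lev G F c x y i, G.Adj u v → v ∈ K ∨ v ∈ bl G F c x y i)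
    (hm : K.ncard < m) : Solv G K := by
  have htK : t ∉ K := fun h => Set.disjoint_left.1 hKB h ht
  -- By `blk_attach` the vertex `t` is the only attachment of `K` in the block, so deleting it
  -- already isolates `K`.
  have he : comp G (lev G F c x y i \ {t}) k = K := by
    refine (comp_subset_of_closed (fun _ => hk) fun u hu v hv ha => ?_).antisymm
      (subset_comp hk hK fun u hu => ⟨hKY hu, ?_⟩)
    · refine (hN u hu v hv.1 ha).resolve_right fun hvB => hv.2 ?_
      exact blk_attach h.adj hK hKY hKB hvB ht hu hk ha hkt
    · rintro rfl
      exact htK hu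
  rw [← he] at hm ⊢
  exact ho.peel N h.toPeel (bl_subset ht) (hKY hk) hkt.symm
    (fun j hj => bl_antitone hj.le ht) hm

/-- The pieces behind a gate that avoid the block. -/
theorem Nested.solv_gate (ho : OutSolv G D m) (hi : InSolv G D m) (h : Node G D F c x y i)
    (hz : z ∈ bl G F c x y i) (hzX : z ∉ X) {a : V}
    (hv : v ∈ (lev G F c x y i \ X) \ gate G a z)
    (hKB : Disjoint (comp G ((lev G F c x y i \ X) \ gate G a z) v) (bl G F c x y i))
    (hX : ∀ u ∈ comp G ((lev G F c x y i \ X) \ gate G a z) v, ∀ t ∈ lev G F c x y i, t ∈ X →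
      G.Adj u t → t ∈ bl G F c x y i)
    (hp : p ∈ lev G F c x y i \ X) (hpQ : p ∈ gate G a z)
    (hk : k ∈ comp G ((lev G F c x y i \ X) \ gate G a z) v) (hkp : G.Adj k p)
    (hm : (comp G ((lev G F c x y i \ X) \ gate G a z) v).ncard < m) :
    Solv G (comp G ((lev G F c x y i \ X) \ gate G a z) v) := by
  set Y := lev G F c x y i with hY
  set B := bl G F c x y i with hB
  set K := comp G ((Y \ X) \ gate G a z) v with hKdef
  have hKc : ∀ u ∈ K, ∀ v ∈ K, Conn G K u v := comp_connected
  have hKY : K ⊆ Y := fun u hu => (comp_subset hu).1.1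
  have hzY : z ∈ Y := bl_subset hz
  have hzK : z ∉ K := fun h => Set.disjoint_left.1 hKB h hz
  have hNb : ∀ u ∈ K, ∀ t ∈ Y, G.Adj u t → t ∈ K ∨ t ∈ gate G a z ∨ t ∈ X := by
    intro u hu t ht ha
    by_contra! hno
    exact hno.1 (comp_adj hu ha ⟨⟨ht, hno.2.2⟩, hno.2.1⟩)
  -- a neighbour in the gate outside of the block lets `K` attach to the block only in `z`
  have key : ∀ u ∈ K, ∀ s ∈ Y, s ∈ gate G a z → s ∉ B → G.Adj u s →
      ∀ u' ∈ K, ∀ t ∈ B, G.Adj u' t → t = z := by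
    intro u hu s hsY hs hsB hus u' hu' t ht hut
    have hc : ∀ w ∈ insert s K, Conn G (insert s K) w u := by
      rintro w (rfl | hw)
      · exact Conn.of_adj hus.symm (Set.mem_insert _ _) (.inr hu)
      · exact (hKc w hw u hu).mono (Set.subset_insert _ _)
    refine blk_attach (K := insert s K) h.adj (fun w hw w' hw' => (hc w hw).trans (hc w' hw').symm)
      (Set.insert_subset hsY hKY) ?_ ht hz (.inr hu') (Set.mem_insert _ _) hut hs.1
    rw [Set.disjoint_left]
    rintro w (rfl | hw)
    exacts [hsB, Set.disjoint_left.1 hKB hw]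
  by_cases hpB : p ∈ B
  -- All attachments of `K` lie in the block. Otherwise `key` would force `p = z`, but `p` is a
  -- neighbour of `z`.
  · refine N.solv_attached ho h hKc hKY hKB hpB hk hkp ?_ hm
    intro u hu t ht ha
    rcases hNb u hu t ht ha with h' | h' | h'
    · exact .inl h'
    · refine .inr (by_contra fun htB => ?_)
      exact hpQ.1.ne (key u hu t ht h' htB ha k hk p hpB hkp)
    · exact .inr (hX u hu t ht h' ha)
  -- By `key` the only possible neighbour of `K` in the block is `z`. As `z` is neither in `X` nor
  -- in the gate, it would then belong to `K`. Hence `K` is a component behind the closed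
  -- neighbourhood of `z`.
  · have hallB : ∀ u ∈ K, ∀ t ∈ B, ¬ G.Adj u t := by
      intro u hu t ht ha
      have : t = z := key k hk p hp.1 hpQ hpB hkp u hu t ht ha
      subst this
      exact hzK (comp_adj hu ha ⟨⟨hzY, hzX⟩, fun h' => h'.1.ne rfl⟩)
    have hKcl : ∀ u ∈ K, u ∉ cl G z := by
      rintro u hu (rfl | ha)
      exacts [hzK hu, hallB u hu z hz ha]
    have hvK : v ∈ K := mem_comp_self hv
    have he : comp G (Y \ cl G z) v = K := by
      refine (comp_subset_of_closed (fun _ => hvK) fun u hu t ht ha => ?_).antisymm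
        (subset_comp hvK hKc fun u hu => ⟨hKY hu, hKcl u hu⟩)
      rcases hNb u hu t ht.1 ha with h' | h' | h'
      · exact h'
      · exact (ht.2 (.inr h'.1)).elim
      · exact (hallB u hu t (hX u hu t ht.1 h' ha) ha).elim
    rw [← he] at hm ⊢
    refine hi.peel N h.toPeel hzY hp.1 hpQ.1.symm (fun j hj => bl_antitone hj.le hz)
      ?_ (fun h' => hKcl v hvK (.inr h')) hm
    have h1 : K ⊆ Y \ {z} := fun u hu => ⟨hKY hu, fun h' => hzK (h' ▸ hu)⟩
    exact Conn.head hkp.symm ⟨hp.1, hpQ.1.ne⟩ ((hKc k hk v hvK).mono h1)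

end Solvable

end Burling

namespace Burling

/-! ### The induction on the size of the pieces. -/

section Induction

variable {V : Type} [Finite V] {G : SimpleGraph V} {D : V → Set V} {F B C K Y W X : Set V}
  {a b c e f g k p q t u v w x y z : V} {i j m : ℕ}

theorem comp_diff_nb (hu : u ∈ W) : comp G (W \ nb G u) u = {u} := by
  refine (comp_subset_of_closed (K := {u}) (fun _ => rfl) ?_).antisymm
    (Set.singleton_subset_iff.2 (mem_comp_self ⟨hu, fun h => h.ne rfl⟩))
  rintro _ rfl w hw ha
  exact (hw.2 ha.symm).elim

variable (N : Nested G D)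
include N

/-- The piece that contains the root behind a gate is a single vertex. -/
theorem Nested.solv_root (h : Peel G D F c x y i) (hz : z ∈ sel G c (bl G F c x y i))
    (hW : W ⊆ lev G F c x y i) (hc : c ∈ comp G (W \ gate G c z) v) :
    Solv G (comp G (W \ gate G c z) v) := by
  have hcW := (comp_subset hc).1
  obtain rfl := N.sel_eq_root h (hW hcW) hz
  have he : gate G z z = nb G z := by
    ext p
    exact ⟨fun h => h.1, fun h => ⟨h, .inl rfl⟩⟩
  rw [← comp_eq_of_mem hc, he, comp_diff_nb hcW]
  exact .single z

/-- If the block is the edge `xy`, branch on `y`; otherwise branch on the selected vertices. A piece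
that avoids the block is attached to it or lies behind a gate. A piece that meets it belongs to the
next round or to a fresh starting set. In the last case the piece need not be smaller than `C`, but
the starting set is smaller than `F`, which is what `hrec` is for. -/
theorem Nested.solv_out_step (ho : OutSolv G D m) (hi : InSolv G D m) (h : Node G D F c x y i)
    (hrec : ∀ F' c' x' y' i', F'.ncard < F.ncard → Node G D F' c' x' y' i' →
      (comp G (lev G F' c' x' y' i' \ {x'}) y').ncard ≤ m →
      Solv G (comp G (lev G F' c' x' y' i' \ {x'}) y'))
    (hm : (comp G (lev G F c x y i \ {x}) y).ncard ≤ m) :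
    Solv G (comp G (lev G F c x y i \ {x}) y) := by
  have hxB : x ∈ bl G F c x y i := h.left_bl le_rfl
  have hyB : y ∈ bl G F c x y i := h.right_bl le_rfl
  set Y := lev G F c x y i with hY
  set B := bl G F c x y i with hB
  set C := comp G (Y \ {x}) y with hC
  have hrow : IsRow G C := h.isRow_out h.left_mem x y
  have hCc : ∀ u ∈ C, ∀ v ∈ C, Conn G C u v := comp_connected
  have hyC : y ∈ C := mem_comp_self ⟨h.right_mem, h.adj.ne'⟩
  have hCY : C ⊆ Y := fun u hu => (comp_subset hu).1
  have hxC : x ∉ C := fun hx => (comp_subset hx).2 rfl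
  have hBC : ∀ v ∈ B, v ≠ x → v ∈ C := fun v hv hvx => blk_conn h.adj hyB hv h.adj.ne' hvx
  have hlt : ∀ K ⊆ C, ∀ q ∈ C, q ∉ K → K.ncard < m := fun K hK q hq hqK =>
    (Set.ncard_lt_ncard ⟨hK, fun h => hqK (h hq)⟩).trans_le hm
  have hle : ∀ K ⊆ C, K.ncard ≤ m := fun K hK => (Set.ncard_le_ncard hK).trans hm
  by_cases hthird : ∃ w ∈ B, w ≠ x ∧ w ≠ y
  swap
  · -- the block is a single edge
    push Not at hthird
    refine .of_vertex hrow hCc hyC (isCut_singleton y) (isCut_nb y) ?_ ?_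
    · intro v hv hvy
      obtain ⟨k, hky, hk⟩ := exists_neighbor (Conn.symm hv) hvy
      have hkY : k ∈ Y := (comp_subset hk).1.1
      have hkv : comp G (Y \ {y}) k = comp G (Y \ {y}) v :=
        comp_eq_of_mem (comp_mono (Set.sdiff_subset_sdiff_left Set.sdiff_subset) hk)
      have he : comp G (C \ {y}) v = comp G (Y \ {y}) k := by
        rw [comp_diff hv, hkv]
        refine (comp_eq_of_subset (Set.sdiff_subset_sdiff_left Set.sdiff_subset)
          fun u hu => ⟨⟨(comp_subset hu).1, ?_⟩, (comp_subset hu).2⟩).symm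
        rintro rfl
        rw [← hkv] at hu
        have := blk_step hyB hkY hky hxB h.adj.ne hu
        exact (comp_subset hk).1.2 (by_contra fun hne => (comp_subset hk).2 (hthird k this hne))
      have hs : comp G (C \ {y}) v ⊆ C \ {y} := comp_subset
      have hm' := hlt _ (hs.trans Set.sdiff_subset) y hyC fun h => (hs h).2 rfl
      rw [he] at hm' ⊢
      exact ho.peel N h.toPeel h.right_mem hkY hky.symm (fun j hj => h.right_bl hj.le) hm'
    · intro v hv hvy hva
      obtain ⟨k, hky, hk⟩ := exists_neighbor (Conn.symm hv) hvy
      have hs : comp G (C \ cl G y) v ⊆ C \ cl G y := comp_subset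
      have hm' := hlt _ (hs.trans Set.sdiff_subset) y hyC fun h => (hs h).2 (.inl rfl)
      have he : comp G (C \ cl G y) v = comp G (Y \ cl G y) v := by
        rw [comp_diff hv]
        congr 1
        ext u
        refine ⟨fun hu => ⟨hu.1.1, hu.2⟩, fun hu => ⟨⟨hu.1, ?_⟩, hu.2⟩⟩
        rintro rfl
        exact hu.2 (.inr h.adj)
      rw [he] at hm' ⊢
      refine hi.peel N h.toPeel h.right_mem (comp_subset hk).1.1 hky.symm
        (fun j hj => h.right_bl hj.le) ?_ hva hm'
      exact comp_mono (Set.sdiff_subset_sdiff_left Set.sdiff_subset) (Conn.symm hk)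
  obtain ⟨w, hwB, hwx, hwy⟩ := hthird
  have hS := N.sel_nonempty h hwB hwx hwy
  have hsucc := h.succ hS
  set S := sel G c B with hSdef
  have hlev : lev G F c x y (i + 1) = Y \ S := lev_succ
  by_cases hSC : (S ∩ C).Nonempty
  swap
  -- All block vertices other than `x` lie in `C`, so only `x` is selected. Then the next round
  -- deletes just `x`, and `C` is a component of the next level.
  · have hSx : S = {x} := by
      obtain ⟨s, hs⟩ := hS
      have : ∀ s ∈ S, s = x := fun s hs => by_contra fun hsx => hSC ⟨s, hs, hBC s hs.1 hsx⟩
      exact Set.eq_singleton_iff_unique_mem.2 ⟨this s hs ▸ hs, this⟩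
    have he : C = comp G (lev G F c x y (i + 1)) y := by rw [hlev, hSx]
    rw [he] at hm ⊢
    refine N.solv_comp ho hi hsucc (q := y) ?_
      (fun j hj => h.right_bl (Nat.lt_succ_iff.1 hj)) hm
    rw [hlev, hSx]
    exact ⟨h.right_mem, h.adj.ne'⟩
  refine .of_sel hrow hCc (h.isCut_sel h.left_mem) hSC (isCut_gate c) ?_ ?_
  · -- the pieces of `C \ S`
    rintro v ⟨hv, hvS⟩
    obtain ⟨s, hsS, hsC⟩ := hSC
    have hs : comp G (C \ S) v ⊆ C \ S := comp_subset
    have hm' := hlt _ (hs.trans Set.sdiff_subset) s hsC fun h => (hs h).2 hsS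
    have hvK : v ∈ comp G (C \ S) v := mem_comp_self ⟨hv, hvS⟩
    set K := comp G (C \ S) v with hK
    have hKe : K = comp G (lev G F c x y (i + 1) \ {x}) v := by
      rw [hK, comp_diff hv, hlev, Set.sdiff_sdiff_comm]
    have hKc : ∀ u ∈ K, ∀ v ∈ K, Conn G K u v := comp_connected
    -- If `x` survives the round and is adjacent to the piece, the piece lies behind `x` in the next
    -- level. Otherwise `x` does not matter, and the piece is a component of the whole next level.
    by_cases hxK : x ∉ S ∧ ∃ k ∈ K, G.Adj x k
    · obtain ⟨hxS, k, hk, hxk⟩ := hxK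
      rw [hKe] at hk hm' ⊢
      rw [← comp_eq_of_mem hk] at hm' ⊢
      exact ho.peel N hsucc (by rw [hlev]; exact ⟨h.left_mem, hxS⟩) (comp_subset hk).1 hxk
        (fun j hj => h.left_bl (Nat.lt_succ_iff.1 hj)) hm'
    have hKe' : comp G (lev G F c x y (i + 1)) v = K := by
      rw [hKe]
      refine comp_congr ?_ (comp_subset.trans Set.sdiff_subset) fun u hu t ht ha => ⟨ht, ?_⟩
      · rw [hlev]
        exact ⟨⟨hCY hv, hvS⟩, fun hvx => hxC (hvx ▸ hv)⟩
      · rintro rfl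
        rw [hlev] at ht
        rw [← hKe] at hu
        exact hxK ⟨ht.2, u, hu, ha.symm⟩
    by_cases hKB : Disjoint K B
    · obtain ⟨k, hk, t, ht, htK, hkt⟩ := (hCc v hv y hyC).exists_exit hvK
        (fun hyK => Set.disjoint_left.1 hKB hyK hyB)
      have htS : t ∈ S := by_contra fun htS => htK (comp_adj hk hkt ⟨ht, htS⟩)
      refine N.solv_attached ho h hKc (fun u hu => hCY (hs hu).1) hKB htS.1 hk hkt ?_ hm'
      intro u hu t' ht' ha
      by_contra! hno
      refine hno.1 (comp_adj hu ha ⟨comp_adj (hs hu).1 ha ⟨ht', ?_⟩, fun h' => hno.2 h'.1⟩)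
      rintro rfl
      exact hno.2 hxB
    · obtain ⟨b, hbK, hbB⟩ := Set.not_disjoint_iff.1 hKB
      rw [← hKe'] at hbK hm' ⊢
      rw [← comp_eq_of_mem hbK] at hm' ⊢
      exact N.solv_comp ho hi hsucc (comp_subset hbK)
        (fun j hj => bl_antitone (Nat.lt_succ_iff.1 hj) hbB) hm'.le
  · -- the pieces of `C` behind the gate
    rintro z ⟨hzS, hzC⟩ v ⟨hv, hvQ⟩
    have hs : comp G (C \ gate G c z) v ⊆ C \ gate G c z := comp_subset
    have hvK : v ∈ comp G (C \ gate G c z) v := mem_comp_self ⟨hv, hvQ⟩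
    have hmK := hle _ (hs.trans Set.sdiff_subset)
    by_cases hcK : c ∈ comp G (C \ gate G c z) v
    · exact N.solv_root h.toPeel hzS hCY hcK
    have hKe : comp G (C \ gate G c z) v = comp G ((Y \ {x}) \ gate G c z) v := comp_diff hv _
    set K := comp G (C \ gate G c z) v with hK
    have hKc : ∀ u ∈ K, ∀ v ∈ K, Conn G K u v := comp_connected
    by_cases hKB : Disjoint K B
    · obtain ⟨k, hk, p, hp, hpK, hkp⟩ := (hCc v hv y hyC).exists_exit hvK
        (fun hyK => Set.disjoint_left.1 hKB hyK hyB)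
      have hpQ : p ∈ gate G c z := by_contra fun hpQ => hpK (comp_adj hk hkp ⟨hp, hpQ⟩)
      have hm' := hlt _ (hs.trans Set.sdiff_subset) p hp hpK
      rw [hKe] at hKB hk hm' ⊢
      refine N.solv_gate ho hi h (X := {x}) hzS.1 (fun hzx => hxC (hzx ▸ hzC))
        ⟨comp_subset hv, hvQ⟩ hKB ?_ (comp_subset hp) hpQ hk hkp hm'
      rintro u - t - rfl -
      exact hxB
    · obtain ⟨b, hbK, hbB⟩ := Set.not_disjoint_iff.1 hKB
      have hbQ : b ∉ gate G c z := (hs hbK).2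
      have hbx : b ≠ x := fun hbx => hxC (hbx ▸ (hs hbK).1)
      obtain ⟨hL, hLY, hLF⟩ := N.fresh h hzS hbB hbQ fun hbc => hcK (hbc ▸ hbK)
      have hbL : b ∈ comp G (gate G c z)ᶜ b := mem_comp_self hbQ
      set L := comp G (gate G c z)ᶜ b with hLdef
      have hKL : K = comp G (L \ {x}) b := by
        rw [hKe, ← comp_eq_of_mem (hKe ▸ hbK)]
        refine comp_eq_of_subset (fun u hu => ⟨⟨hLY hu.1, hu.2⟩, comp_subset hu.1⟩) fun u hu => ?_
        exact ⟨comp_mono (fun u hu => hu.2) hu, (comp_subset hu).1.2⟩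
      -- If `x` lies in the fresh starting set, the piece is behind `x` there, with a new edge at
      -- `x` and no rounds yet; if not, the piece is the starting set itself.
      by_cases hxL : x ∈ L
      · obtain ⟨k, hkx, hk⟩ := exists_neighbor (comp_connected b hbL x hxL) hbx
        obtain ⟨c', hc'⟩ := N.exists_node hL hxL (comp_subset hk).1 hkx.symm
        have := hrec L c' x k 0 hLF hc'
        rw [lev_zero, comp_eq_of_mem hk, ← hKL] at this
        exact this hmK
      · have hKL' : K = L := by
          rw [hKL, Set.sdiff_singleton_eq_self hxL]
          exact comp_comp hbL
        rw [hKL'] at hmK ⊢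
        exact N.solv_valid ho hi hL hbL hmK

/-- As for deleting `x` alone, but the next round may produce a piece behind the closed
neighbourhood of `x` that is no smaller than `C`. The recursion therefore also has to descend in the
level while the size of `F` stays the same. -/
theorem Nested.solv_in_step (ho : OutSolv G D (m + 1)) (hi : InSolv G D m)
    (h : Node G D F c x y i) (hg : g ∈ comp G (lev G F c x y i \ {x}) y) (hgx : ¬ G.Adj g x)
    (hrec : ∀ F' c' x' y' i' g', (F'.ncard < F.ncard ∨ F'.ncard = F.ncard ∧
      (lev G F' c' x' y' i').ncard < (lev G F c x y i).ncard) → Node G D F' c' x' y' i' →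
      g' ∈ comp G (lev G F' c' x' y' i' \ {x'}) y' → ¬ G.Adj g' x' →
      (comp G (lev G F' c' x' y' i' \ cl G x') g').ncard ≤ m →
      Solv G (comp G (lev G F' c' x' y' i' \ cl G x') g'))
    (hm : (comp G (lev G F c x y i \ cl G x) g).ncard ≤ m) :
    Solv G (comp G (lev G F c x y i \ cl G x) g) := by
  have ho' : OutSolv G D m := fun F c x y i h hm => ho F c x y i h (by omega)
  have hxB : x ∈ bl G F c x y i := h.left_bl le_rfl
  have hyB : y ∈ bl G F c x y i := h.right_bl le_rfl
  have hrow : IsRow G (comp G (lev G F c x y i \ cl G x) g) := h.isRow_in h.left_mem x g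
  set Y := lev G F c x y i with hY
  set B := bl G F c x y i with hB
  have hgW : g ∈ Y \ cl G x := ⟨(comp_subset hg).1, fun h => h.elim (comp_subset hg).2 hgx⟩
  have hsub : Y \ cl G x ⊆ Y \ {x} :=
    Set.sdiff_subset_sdiff_right (Set.singleton_subset_iff.2 (.inl rfl))
  set C := comp G (Y \ cl G x) g with hC
  have hCc : ∀ u ∈ C, ∀ v ∈ C, Conn G C u v := comp_connected
  have hgC : g ∈ C := mem_comp_self hgW
  have hCY : C ⊆ Y := fun u hu => (comp_subset hu).1
  have hCcl : ∀ u ∈ C, u ∉ cl G x := fun u hu => (comp_subset hu).2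
  have hCo : C ⊆ comp G (Y \ {x}) y := by
    rw [← comp_eq_of_mem hg]
    exact comp_mono hsub
  -- the neighbours of `x` that are seen from `C` belong to the block
  have hnb : ∀ n ∈ comp G (Y \ {x}) y, G.Adj n x → n ∈ B := fun n hn hnx =>
    blk_step hxB (comp_subset hn).1 hnx hyB h.adj.ne' (Conn.symm hn)
  have hnb' : ∀ u ∈ C, ∀ t ∈ Y, t ∈ cl G x → G.Adj u t → t ∈ B := by
    rintro u hu t ht (rfl | htx) ha
    · exact hxB
    · exact hnb t (comp_adj (hCo hu) ha ⟨ht, htx.ne⟩) htx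
  have hlt : ∀ K ⊆ C, ∀ q ∈ C, q ∉ K → K.ncard < m := fun K hK q hq hqK =>
    (Set.ncard_lt_ncard ⟨hK, fun h => hqK (h hq)⟩).trans_le hm
  have hle : ∀ K ⊆ C, K.ncard ≤ m := fun K hK => (Set.ncard_le_ncard hK).trans hm
  -- A set that avoids the block is solved as a piece behind one block vertex without shrinking
  -- first; this is why `OutSolv` is assumed for `m + 1`.
  by_cases hCB : Disjoint C B
  · obtain ⟨k, hk, n, hn, hnC, hkn⟩ := (Conn.symm hg).exists_exit hgC
      (fun hyC => Set.disjoint_left.1 hCB hyC hyB)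
    have hnx : n ∈ cl G x := by_contra fun hnx => hnC (comp_adj hk hkn ⟨hn.1, hnx⟩)
    refine N.solv_attached ho h hCc hCY hCB (hnb' k hk n hn.1 hnx hkn) hk hkn ?_
      (Nat.lt_succ_of_le hm)
    intro u hu t ht ha
    by_cases htx : t ∈ cl G x
    · exact .inr (hnb' u hu t ht htx ha)
    · exact .inl (comp_adj hu ha ⟨ht, htx⟩)
  obtain ⟨b₀, hb₀C, hb₀B⟩ := Set.not_disjoint_iff.1 hCB
  have hS : (sel G c B).Nonempty := N.sel_nonempty h hb₀B (fun h' => hCcl b₀ hb₀C (.inl h'))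
    fun h' => hCcl b₀ hb₀C (.inr (h' ▸ h.adj.symm))
  have hsucc := h.succ hS
  set S := sel G c B with hSdef
  have hlev : lev G F c x y (i + 1) = Y \ S := lev_succ
  -- the pieces behind a gate that meet the block
  have key : ∀ z ∈ S, ¬ G.Adj x z → ∀ b ∈ B, b ∈ (Y \ cl G x) \ gate G c z → b ≠ c →
      (comp G ((Y \ cl G x) \ gate G c z) b).ncard ≤ m →
      Solv G (comp G ((Y \ cl G x) \ gate G c z) b) := by
    intro z hzS hxz b hbB hb hbc hmK
    obtain ⟨hL, hLY, hLF⟩ := N.fresh h hzS hbB hb.2 hbc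
    have hbL : b ∈ comp G (gate G c z)ᶜ b := mem_comp_self hb.2
    set L := comp G (gate G c z)ᶜ b with hLdef
    have hKL : comp G ((Y \ cl G x) \ gate G c z) b = comp G (L \ cl G x) b := by
      refine comp_eq_of_subset (fun u hu => ⟨⟨hLY hu.1, hu.2⟩, comp_subset hu.1⟩) fun u hu => ?_
      exact ⟨comp_mono (fun u hu => hu.2) hu, (comp_subset hu).1.2⟩
    rw [hKL] at hmK ⊢
    by_cases hxL : x ∈ L
    · obtain ⟨k, hkx, hk⟩ := exists_neighbor (comp_connected b hbL x hxL)
        (fun h' => hb.1.2 (.inl h'))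
      obtain ⟨c', hc'⟩ := N.exists_node hL hxL (comp_subset hk).1 hkx.symm
      have := hrec L c' x k 0 b (.inl hLF) hc'
      rw [lev_zero] at this
      exact this (Conn.symm hk) (fun h' => hb.1.2 (.inr h')) hmK
    -- Since `x` is not adjacent to `z`, it is not in the gate. So a neighbour of `x` in `L` would
    -- bring `x` into `L`.
    · have hcl : L \ cl G x = L := by
        refine Set.Subset.antisymm Set.sdiff_subset fun u hu => ⟨hu, ?_⟩
        rintro (rfl | hux)
        · exact hxL hu
        · exact hxL (comp_adj hu hux fun h' => hxz h'.1)
      rw [hcl] at hmK ⊢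
      have : comp G L b = L := comp_comp hbL
      rw [this] at hmK ⊢
      exact N.solv_valid ho' hi hL hbL hmK
  by_cases hxS : x ∈ S
  · -- `x` is selected itself
    -- The gate of `x` consists of neighbours of `x`, which are deleted anyway, so `C` is already a
    -- piece behind this gate.
    have hd : (Y \ cl G x) \ gate G c x = Y \ cl G x :=
      Set.Subset.antisymm Set.sdiff_subset fun u hu => ⟨hu, fun h' => hu.2 (.inr h'.1)⟩
    have hb₀c : b₀ ≠ c := by
      rintro rfl
      exact hCcl b₀ hb₀C (.inl (N.sel_eq_root h.toPeel (hCY hb₀C) hxS).symm)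
    have := key x hxS (fun h' => h'.ne rfl) b₀ hb₀B (by rw [hd]; exact comp_subset hb₀C) hb₀c
    rw [hd, comp_eq_of_mem hb₀C] at this
    exact this hm
  -- the pieces of `C \ S`
  have hpieces : ∀ v ∈ C \ S, Solv G (comp G (C \ S) v) := by
    rintro v ⟨hv, hvS⟩
    have hs : comp G (C \ S) v ⊆ C \ S := comp_subset
    have hvK : v ∈ comp G (C \ S) v := mem_comp_self ⟨hv, hvS⟩
    have hmK := hle _ (hs.trans Set.sdiff_subset)
    set K := comp G (C \ S) v with hK
    have hKe : K = comp G (lev G F c x y (i + 1) \ cl G x) v := by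
      rw [hK, comp_diff hv, hlev, Set.sdiff_sdiff_comm]
    have hKc : ∀ u ∈ K, ∀ v ∈ K, Conn G K u v := comp_connected
    by_cases hKB : Disjoint K B
    · obtain ⟨k, hk, t, ht, htK, hkt⟩ := (hCc v hv b₀ hb₀C).exists_exit hvK
        (fun hK => Set.disjoint_left.1 hKB hK hb₀B)
      have htS : t ∈ S := by_contra fun htS => htK (comp_adj hk hkt ⟨ht, htS⟩)
      refine N.solv_attached ho h hKc (fun u hu => hCY (hs hu).1) hKB htS.1 hk hkt ?_
        (Nat.lt_succ_of_le hmK)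
      intro u hu t' ht' ha
      by_contra! hno
      refine hno.1 (comp_adj hu ha ⟨comp_adj (hs hu).1 ha ⟨ht', ?_⟩, fun h' => hno.2 h'.1⟩)
      exact fun h' => hno.2 (hnb' u (hs hu).1 t' ht' h' ha)
    · obtain ⟨b, hbK, hbB⟩ := Set.not_disjoint_iff.1 hKB
      have hbC := (hs hbK).1
      have hbx : b ≠ x := fun h' => hCcl b hbC (.inl h')
      have hbxa : ¬ G.Adj b x := fun h' => hCcl b hbC (.inr h')
      have hbY : b ∈ lev G F c x y (i + 1) := by rw [hlev]; exact ⟨hCY hbC, (hs hbK).2⟩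
      have hbY' : b ∈ lev G F c x y (i + 1) \ {x} := ⟨hbY, hbx⟩
      have hxY : x ∈ lev G F c x y (i + 1) := by rw [hlev]; exact ⟨h.left_mem, hxS⟩
      have hKe' : comp G (lev G F c x y (i + 1) \ cl G x) b = K := by
        rw [hKe]
        exact comp_eq_of_mem (hKe ▸ hbK)
      rw [← hKe'] at hmK ⊢
      -- A neighbour `k` of `x` on the side of `b` lies in the block, so `xk` can replace `xy` in
      -- the next level, which is smaller. If there is none, deleting the closed neighbourhood of
      -- `x` does not affect the component of `b`.
      by_cases hex : ∃ k ∈ comp G (lev G F c x y (i + 1) \ {x}) b, G.Adj x k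
      · obtain ⟨k, hk, hxk⟩ := hex
        have hkB : k ∈ B := by
          refine hnb k ?_ hxk.symm
          rw [← comp_eq_of_mem (hCo hbC)]
          exact comp_mono (Set.sdiff_subset_sdiff_left (lev_antitone (Nat.le_succ i))) hk
        obtain ⟨hn, hln⟩ := hsucc.node_of_edge (Nat.succ_pos i)
          (fun j hj => h.left_bl (Nat.lt_succ_iff.1 hj))
          (fun j hj => bl_antitone (Nat.lt_succ_iff.1 hj) hkB) hxk hxY (comp_subset hk).1
        have := hrec F c x k (i + 1) b (.inr ⟨rfl, ?_⟩) hn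
        · rw [hln] at this
          exact this (Conn.symm hk) hbxa hmK
        · rw [hln, hlev]
          obtain ⟨s, hs⟩ := hS
          exact Set.ncard_lt_ncard ⟨Set.sdiff_subset, fun h' => (h' (bl_subset hs.1)).2 hs⟩
      · push Not at hex
        have he : comp G (lev G F c x y (i + 1)) b =
            comp G (lev G F c x y (i + 1) \ cl G x) b := by
          have hA : ∀ u ∈ comp G (lev G F c x y (i + 1)) b,
              u ∈ comp G (lev G F c x y (i + 1) \ {x}) b := by
            intro u hu
            rwa [comp_congr hbY' (comp_subset.trans Set.sdiff_subset)] at hu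
            rintro u hu t ht ha
            refine ⟨ht, ?_⟩
            rintro rfl
            exact hex u hu ha.symm
          refine comp_eq_of_subset Set.sdiff_subset fun u hu => ⟨comp_subset hu, ?_⟩
          rintro (rfl | hux)
          · exact (comp_subset (hA _ hu)).2 rfl
          · exact hex u (hA u hu) hux.symm
        rw [← he] at hmK ⊢
        exact N.solv_comp ho' hi hsucc hbY
          (fun j hj => bl_antitone (Nat.lt_succ_iff.1 hj) hbB) hmK
  by_cases hSC : (S ∩ C).Nonempty
  swap
  · have hd : C \ S = C := Set.Subset.antisymm Set.sdiff_subset fun u hu =>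
      ⟨hu, fun h' => hSC ⟨u, h', hu⟩⟩
    have := hpieces g (by rwa [hd])
    rwa [hd, comp_eq_self hCc hgC] at this
  refine .of_sel hrow hCc (h.isCut_sel h.left_mem) hSC (isCut_gate c) hpieces ?_
  rintro z ⟨hzS, hzC⟩ v ⟨hv, hvQ⟩
  have hs : comp G (C \ gate G c z) v ⊆ C \ gate G c z := comp_subset
  have hvK : v ∈ comp G (C \ gate G c z) v := mem_comp_self ⟨hv, hvQ⟩
  have hmK := hle _ (hs.trans Set.sdiff_subset)
  by_cases hcK : c ∈ comp G (C \ gate G c z) v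
  · exact N.solv_root h.toPeel hzS hCY hcK
  have hKe : comp G (C \ gate G c z) v = comp G ((Y \ cl G x) \ gate G c z) v := comp_diff hv _
  by_cases hKB : Disjoint (comp G (C \ gate G c z) v) B
  · obtain ⟨k, hk, p, hp, hpK, hkp⟩ := (hCc v hv b₀ hb₀C).exists_exit hvK
      (fun hK => Set.disjoint_left.1 hKB hK hb₀B)
    have hpQ : p ∈ gate G c z := by_contra fun hpQ => hpK (comp_adj hk hkp ⟨hp, hpQ⟩)
    have hm' := hlt _ (hs.trans Set.sdiff_subset) p hp hpK
    have hsC : ∀ u ∈ comp G (C \ gate G c z) v, u ∈ C := fun u hu => (hs hu).1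
    rw [hKe] at hKB hk hm' hsC ⊢
    exact N.solv_gate ho' hi h (X := cl G x) hzS.1 (hCcl z hzC) ⟨comp_subset hv, hvQ⟩ hKB
      (fun u hu t ht htx ha => hnb' u (hsC u hu) t ht htx ha) (comp_subset hp) hpQ hk hkp hm'
  · obtain ⟨b, hbK, hbB⟩ := Set.not_disjoint_iff.1 hKB
    have hbc : b ≠ c := fun hbc => hcK (hbc ▸ hbK)
    rw [hKe] at hbK hmK ⊢
    rw [← comp_eq_of_mem hbK] at hmK ⊢
    exact key z hzS (fun h' => hCcl z hzC (.inr h'.symm)) b hbB (comp_subset hbK) hbc hmK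

/-- Inner induction on the size of the starting set. -/
theorem Nested.outSolv_succ (ho : OutSolv G D m) (hi : InSolv G D m) : OutSolv G D (m + 1) := by
  have key : ∀ l F c x y i, F.ncard = l → Node G D F c x y i →
      (comp G (lev G F c x y i \ {x}) y).ncard ≤ m →
      Solv G (comp G (lev G F c x y i \ {x}) y) := by
    intro l
    induction l using Nat.strong_induction_on with
    | _ l ih =>
      rintro F c x y i rfl h hm
      exact N.solv_out_step ho hi h (fun F' c' x' y' i' hF' h' hm' => ih _ hF' _ _ _ _ _ rfl h' hm')
        hm
  exact fun F c x y i h hm => key _ F c x y i rfl h (Nat.lt_succ_iff.1 hm)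

/-- Inner induction on the sizes of the starting set and of the level, in lexicographic order. The
vertex case for `m + 1` has to be established before. -/
theorem Nested.inSolv_succ (ho : OutSolv G D (m + 1)) (hi : InSolv G D m) :
    InSolv G D (m + 1) := by
  have key : ∀ (l : ℕ ×ₗ ℕ) F c x y i g, toLex (F.ncard, (lev G F c x y i).ncard) = l →
      Node G D F c x y i → g ∈ comp G (lev G F c x y i \ {x}) y → ¬ G.Adj g x →
      (comp G (lev G F c x y i \ cl G x) g).ncard ≤ m →
      Solv G (comp G (lev G F c x y i \ cl G x) g) := by
    intro l
    induction l using WellFoundedLT.induction with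
    | _ l ih =>
      rintro F c x y i g rfl h hg hgx hm
      refine N.solv_in_step ho hi h hg hgx ?_ hm
      intro F' c' x' y' i' g' hlt h' hg' hgx' hm'
      exact ih _ (Prod.Lex.toLex_lt_toLex.2 hlt) _ _ _ _ _ _ rfl h' hg' hgx' hm'
  exact fun F c x y i g h hg hgx hm => key _ F c x y i g rfl h hg hgx (Nat.lt_succ_iff.1 hm)

theorem Nested.outSolv_inSolv (m : ℕ) : OutSolv G D m ∧ InSolv G D m := by
  induction m with
  | zero => exact ⟨fun _ _ _ _ _ _ h => by simp at h, fun _ _ _ _ _ _ _ _ _ h => by simp at h⟩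
  | succ m ih =>
    have := N.outSolv_succ ih.1 ih.2
    exact ⟨this, N.inSolv_succ this ih.2⟩

/-- The components of the graph are solvable. -/
theorem Nested.solv_univ (f : V) : Solv G (comp G Set.univ f) := by
  have hf : f ∈ comp G Set.univ f := mem_comp_self trivial
  by_cases hz : ∃ z, G.Adj f z
  · obtain ⟨z, hz⟩ := hz
    -- For adjacent `f` and `z` the gate is empty, so components of the whole graph occur among the
    -- starting sets.
    have hQ : gate G f z = ∅ := by
      refine Set.eq_empty_of_forall_notMem ?_
      rintro p ⟨-, h | ⟨o, ho, -⟩⟩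
      exacts [hz.ne h, Conn.left_mem ho (.inr hz)]
    obtain ⟨ho, hi⟩ := N.outSolv_inSolv (comp G Set.univ f).ncard
    refine N.solv_valid ho hi (q := f) ⟨⟨f, z, f, by rw [hQ, Set.compl_empty]⟩, ?_⟩ hf le_rfl
    intro u _ x hx _
    rw [← comp_eq_of_mem hx]
    exact comp_mono (Set.subset_univ _)
  · push Not at hz
    have : comp G Set.univ f = {f} := by
      refine Set.Subset.antisymm ?_ (Set.singleton_subset_iff.2 hf)
      refine comp_subset_of_closed (fun _ => rfl) ?_
      rintro _ rfl v hv ha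
      exact (hz v ha).elim
    exact this ▸ .single f

end Induction

end Burling

namespace RAM

/-! ### Running programs within time bounds. -/

section Exec

/-- The program `P`, started in `s`, halts within `c` time units in a state with property `Q`. -/
def Exec (P : Program) (s : State) (c : ℕ) (Q : State → Prop) : Prop :=
  ∃ t s', Runs P s t s' ∧ t ≤ c ∧ Q s'

variable {P P' : Program} {s : State} {c c' : ℕ} {Q R : State → Prop}

theorem Exec.weaken (h : Exec P s c Q) (hc : c ≤ c') (hQ : ∀ s', Q s' → R s') :
    Exec P s c' R := by
  obtain ⟨t, s', h1, h2, h3⟩ := h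
  exact ⟨t, s', h1, h2.trans hc, hQ _ h3⟩

theorem Exec.seq (h : Exec P s c fun s' => Exec P' s' c' Q) : Exec (.seq P P') s (c + c') Q := by
  obtain ⟨t, s', h1, h2, t', s'', h3, h4, h5⟩ := h
  exact ⟨t + t', s'', .seq h1 h3, add_le_add h2 h4, h5⟩

theorem Exec.skip (h : Q s) (hc : 1 ≤ c) : Exec .skip s c Q := ⟨1, s, .skip s, hc, h⟩

theorem Exec.setNat {a : ℕ} {i e : NatExpr} (h : Q (s.setNat a (i.eval s) (e.eval s)))
    (hc : i.cost + e.cost + 1 ≤ c) : Exec (.setNat a i e) s c Q :=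
  ⟨_, _, .setNat a i e s, hc, h⟩

theorem Exec.setReal {a : ℕ} {i : NatExpr} {e : RealExpr}
    (h : Q (s.setReal a (i.eval s) (e.eval s))) (hc : i.cost + e.cost + 1 ≤ c) :
    Exec (.setReal a i e) s c Q :=
  ⟨_, _, .setReal a i e s, hc, h⟩

theorem Exec.ite {b : Test} (h : b.Holds s → Exec P s c Q) (h' : ¬ b.Holds s → Exec P' s c Q)
    (hc : b.cost + c ≤ c') : Exec (.ite b P P') s c' Q := by
  by_cases hb : b.Holds s
  · obtain ⟨t, s', h1, h2, h3⟩ := h hb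
    exact ⟨_, s', .ite_true hb h1, by omega, h3⟩
  · obtain ⟨t, s', h1, h2, h3⟩ := h' hb
    exact ⟨_, s', .ite_false hb h1, by omega, h3⟩

/-- Run `P` with the values `0, …, n - 1` in cell `0` of array `a`, where `n` is in cell `0` of
array `0`. -/
def forUp (a : ℕ) (P : Program) : Program :=
  .seq (.setNat a (.const 0) (.const 0))
    (.loop (.natLt (.read a (.const 0)) (.read 0 (.const 0)))
      (.seq P (.setNat a (.const 0) (.add (.read a (.const 0)) (.const 1)))))

@[simp] theorem State.setNat_nat_self (s : State) (a i v : ℕ) :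
    (s.setNat a i v).nat a = Function.update (s.nat a) i v := by simp [State.setNat]

theorem State.setNat_nat_ne (s : State) {a b : ℕ} (i v : ℕ) (h : b ≠ a) :
    (s.setNat a i v).nat b = s.nat b := by simp [State.setNat, h]

@[simp] theorem State.setNat_real (s : State) (a i v : ℕ) : (s.setNat a i v).real = s.real := rfl

@[simp] theorem State.setReal_nat (s : State) (a i : ℕ) (v : ℝ) :
    (s.setReal a i v).nat = s.nat := rfl

@[simp] theorem State.setReal_real_self (s : State) (a i : ℕ) (v : ℝ) :
    (s.setReal a i v).real a = Function.update (s.real a) i v := by simp [State.setReal]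

theorem State.setReal_real_ne (s : State) {a b : ℕ} (i : ℕ) (v : ℝ) (h : b ≠ a) :
    (s.setReal a i v).real b = s.real b := by simp [State.setReal, h]

/-- The invariant at `i` is required of states whose counter already shows `i`. The constants cover
the test, the increment and the initialization. -/
theorem Exec.forUp {a n : ℕ} {I : ℕ → State → Prop}
    (h0 : I 0 (s.setNat a 0 0)) (hn : ∀ i s, I i s → s.nat 0 0 = n)
    (hs : ∀ i < n, ∀ s, I i s → s.nat a 0 = i →
      Exec P s c fun s' => s'.nat a 0 = i ∧ I (i + 1) (s'.setNat a 0 (i + 1))) :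
    Exec (forUp a P) s (n * (c + 15) + 15) (fun s' => I n s' ∧ s'.nat a 0 = n) := by
  have key : ∀ m i s, i + m = n → I i s → s.nat a 0 = i →
      Exec (.loop (.natLt (.read a (.const 0)) (.read 0 (.const 0)))
        (.seq P (.setNat a (.const 0) (.add (.read a (.const 0)) (.const 1))))) s
        (m * (c + 15) + 10) (fun s' => I n s' ∧ s'.nat a 0 = n) := by
    intro m
    induction m with
    | zero =>
      intro i s hi hI ha
      obtain rfl : i = n := hi
      refine ⟨_, s, .loop_done ?_, ?_, hI, ha⟩
      · simp [Test.Holds, NatExpr.eval, ha, hn i s hI]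
      · simp [Test.cost, NatExpr.cost]
    | succ m ih =>
      intro i s hi hI ha
      obtain ⟨t, s', h1, h2, h3, h4⟩ := hs i (by omega) s hI ha
      obtain ⟨t', s'', h5, h6, h7⟩ := ih (i + 1) _ (by omega) h4 (by simp)
      refine ⟨_, s'', .loop_step (t' := t') ?_ (.seq h1 (.setNat _ _ _ _)) ?_, ?_, h7⟩
      · simp only [Test.Holds, NatExpr.eval, ha, hn i s hI]
        omega
      · simpa only [NatExpr.eval, h3] using h5
      · simp only [Test.cost, NatExpr.cost]
        rw [Nat.succ_mul]
        omega
  have h := key n 0 _ (by omega) h0 (by simp)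
  refine (Exec.seq (Exec.setNat ?_ (c := 5) (by simp [NatExpr.cost]))).weaken
    (by omega : 5 + (n * (c + 15) + 10) ≤ _) fun _ h => h
  simpa only [NatExpr.eval] using h

end Exec

section PolyBounded

/-- A function that is bounded by a polynomial. -/
def PolyBounded (c : ℕ → ℕ) : Prop := ∃ p : Polynomial ℕ, ∀ n, c n ≤ p.eval n

theorem PolyBounded.const (k : ℕ) : PolyBounded fun _ => k := ⟨.C k, fun n => by simp⟩

theorem PolyBounded.id : PolyBounded fun n => n := ⟨.X, fun n => by simp⟩

theorem PolyBounded.add {c d : ℕ → ℕ} (hc : PolyBounded c) (hd : PolyBounded d) :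
    PolyBounded fun n => c n + d n := by
  obtain ⟨p, hp⟩ := hc
  obtain ⟨q, hq⟩ := hd
  exact ⟨p + q, fun n => by simpa using add_le_add (hp n) (hq n)⟩

theorem PolyBounded.mul {c d : ℕ → ℕ} (hc : PolyBounded c) (hd : PolyBounded d) :
    PolyBounded fun n => c n * d n := by
  obtain ⟨p, hp⟩ := hc
  obtain ⟨q, hq⟩ := hd
  exact ⟨p * q, fun n => by simpa using Nat.mul_le_mul (hp n) (hq n)⟩

end PolyBounded

end RAM

/-! ## A language of vertices and sets of vertices, and its compilation -/

namespace SetProg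

open RAM

section Language

/-- The variables of a program: sets of vertices, tables of sets, and indices into the tables. -/
structure Mem (n : ℕ) where
  set : ℕ → Set (Fin n)
  tab : ℕ → ℕ → Set (Fin n)
  ptr : ℕ → ℕ

/-- First-order formulas with a connectivity operator: enough to define gates, blocks and
selections, and still decidable in polynomial time. In `conn v φ x y` the walks stay among the
values of `v` that satisfy `φ`. -/
inductive Formula : Type
  | adj (x y : ℕ)
  | eq (x y : ℕ)
  | mem (x b : ℕ)
  | lighter (b b' : ℕ)
  | not (φ : Formula)
  | and (φ ψ : Formula)
  | ex (v : ℕ) (φ : Formula)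
  | conn (v : ℕ) (φ : Formula) (x y : ℕ)

variable {n : ℕ} (G : SimpleGraph (Fin n)) (w : Fin n → ℝ)

open Classical in
/-- The weight of a set of vertices. -/
noncomputable def weight (S : Set (Fin n)) : ℝ := ∑ i, if i ∈ S then w i else 0

def Formula.Holds : Formula → (ℕ → Fin n) → Mem n → Prop
  | .adj x y, ρ, _ => G.Adj (ρ x) (ρ y)
  | .eq x y, ρ, _ => ρ x = ρ y
  | .mem x b, ρ, σ => ρ x ∈ σ.set b
  | .lighter b b', _, σ => weight w (σ.set b) < weight w (σ.set b')
  | .not φ, ρ, σ => ¬ φ.Holds ρ σ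
  | .and φ ψ, ρ, σ => φ.Holds ρ σ ∧ ψ.Holds ρ σ
  | .ex v φ, ρ, σ => ∃ a, φ.Holds (Function.update ρ v a) σ
  | .conn v φ x y, ρ, σ =>
      Burling.Conn G {a | φ.Holds (Function.update ρ v a) σ} (ρ x) (ρ y)

/-- Each loop makes exactly `n` passes, so every command takes polynomial time. Indices can only be
reset or increased by one, which spares multiplication. -/
inductive Cmd : Type
  | skip
  | assign (b v : ℕ) (φ : Formula)
  | ite (φ : Formula) (c c' : Cmd)
  | seq (c c' : Cmd)
  | forV (v : ℕ) (c : Cmd)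
  | rep (c : Cmd)
  | rzero (p : ℕ)
  | rnext (p : ℕ)
  | load (t p b : ℕ)
  | store (t p b : ℕ)

def Mem.setSet (σ : Mem n) (b : ℕ) (S : Set (Fin n)) : Mem n :=
  { σ with set := Function.update σ.set b S }

def Mem.setTab (σ : Mem n) (t r : ℕ) (S : Set (Fin n)) : Mem n :=
  { σ with tab := Function.update σ.tab t (Function.update (σ.tab t) r S) }

def Mem.setPtr (σ : Mem n) (p r : ℕ) : Mem n := { σ with ptr := Function.update σ.ptr p r }

open Classical in
noncomputable def Cmd.exec : Cmd → (ℕ → Fin n) → Mem n → Mem n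
  | .skip, _, σ => σ
  | .assign b v φ, ρ, σ => σ.setSet b {a | φ.Holds G w (Function.update ρ v a) σ}
  | .ite φ c c', ρ, σ => if φ.Holds G w ρ σ then c.exec ρ σ else c'.exec ρ σ
  | .seq c c', ρ, σ => c'.exec ρ (c.exec ρ σ)
  | .forV v c, ρ, σ =>
      (List.finRange n).foldl (fun σ a => c.exec (Function.update ρ v a) σ) σ
  | .rep c, ρ, σ => (c.exec ρ)^[n] σ
  | .rzero p, _, σ => σ.setPtr p 0
  | .rnext p, _, σ => σ.setPtr p (σ.ptr p + 1)
  | .load t p b, _, σ => σ.setSet b (σ.tab t (σ.ptr p))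
  | .store t p b, _, σ => σ.setTab t (σ.ptr p) (σ.set b)

end Language

/-! ### Representing sets, tables and variables in the arrays. -/

section Representation

/-- The arrays of the machine, in classes: `0` sets, `1` variables, `2` tables, `3` indices,
`4` row starts of the adjacency matrix; the classes from `8` on are working space. -/
def ar (c j : ℕ) : ℕ := 2 + 16 * j + c

open Classical in
noncomputable def ind (p : Prop) : ℕ := if p then 1 else 0

theorem ind_eq_one {p : Prop} : ind p = 1 ↔ p := by
  by_cases h : p <;> simp [ind, h]

theorem ind_of {p : Prop} (h : p) : ind p = 1 := ind_eq_one.2 h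

theorem ind_of_not {p : Prop} (h : ¬ p) : ind p = 0 := by simp [ind, h]

variable {n : ℕ}

/-- In the absence of multiplication, row starts and table indices are stored already multiplied by
`n`. -/
structure Rep (G : SimpleGraph (Fin n)) (w : Fin n → ℝ) (ρ : ℕ → Fin n) (σ : Mem n)
    (s : State) : Prop where
  size : s.nat 0 0 = n
  adj : ∀ i j : Fin n, s.nat 1 (i * n + j) = ind (G.Adj i j)
  weights : ∀ i : Fin n, s.real 0 i = w i
  row : ∀ i : Fin n, s.nat (ar 4 0) i = i * n
  var : ∀ v, s.nat (ar 1 v) 0 = ρ v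
  set : ∀ b, ∀ i : Fin n, s.nat (ar 0 b) i = ind (i ∈ σ.set b)
  tab : ∀ t r, ∀ i : Fin n, s.nat (ar 2 t) (r * n + i) = ind (i ∈ σ.tab t r)
  ptr : ∀ p, s.nat (ar 3 p) 0 = σ.ptr p * n

/-- The working space below `k` is the same in both states. -/
def Keep (k : ℕ) (s s' : State) : Prop :=
  ∀ c j, 8 ≤ c → c < 16 → j < k → s'.nat (ar c j) = s.nat (ar c j)

variable {G : SimpleGraph (Fin n)} {w : Fin n → ℝ} {ρ : ℕ → Fin n} {σ : Mem n}
  {s s' s'' : State} {k k' : ℕ}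

theorem Keep.refl (k : ℕ) (s : State) : Keep k s s := fun _ _ _ _ _ => rfl

theorem Keep.trans (h : Keep k s s') (h' : Keep k s' s'') : Keep k s s'' :=
  fun c j h1 h2 h3 => (h' c j h1 h2 h3).trans (h c j h1 h2 h3)

theorem Keep.mono (h : Keep k s s') (hk : k' ≤ k) : Keep k' s s' :=
  fun c j h1 h2 h3 => h c j h1 h2 (h3.trans_le hk)

theorem Keep.scratch (h : Keep k s s') (c j i x : ℕ) (hc : c < 16) (hj : k ≤ j) :
    Keep k s (s'.setNat (ar c j) i x) := fun c' j' h1 h2 h3 => by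
  rw [State.setNat_nat_ne _ _ _ (by unfold ar; omega)]
  exact h c' j' h1 h2 h3

theorem Keep.data (h : Keep k s s') (c j i x : ℕ) (hc : c < 8) :
    Keep k s (s'.setNat (ar c j) i x) := fun c' j' h1 h2 h3 => by
  rw [State.setNat_nat_ne _ _ _ (by unfold ar; omega)]
  exact h c' j' h1 h2 h3

theorem Keep.setReal (h : Keep k s s') (i : ℕ) (x : ℝ) : Keep k s (s'.setReal 1 i x) := h

theorem Rep.scratch (h : Rep G w ρ σ s) (c j i x : ℕ) (h8 : 8 ≤ c) (hc : c < 16) :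
    Rep G w ρ σ (s.setNat (ar c j) i x) where
  size := by rw [State.setNat_nat_ne _ _ _ (by unfold ar; omega)]; exact h.size
  adj := by rw [State.setNat_nat_ne _ _ _ (by unfold ar; omega)]; exact h.adj
  weights := h.weights
  row := by rw [State.setNat_nat_ne _ _ _ (by unfold ar; omega)]; exact h.row
  var v := by rw [State.setNat_nat_ne _ _ _ (by unfold ar; omega)]; exact h.var v
  set b := by rw [State.setNat_nat_ne _ _ _ (by unfold ar; omega)]; exact h.set b
  tab t := by rw [State.setNat_nat_ne _ _ _ (by unfold ar; omega)]; exact h.tab t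
  ptr p := by rw [State.setNat_nat_ne _ _ _ (by unfold ar; omega)]; exact h.ptr p

theorem Rep.setReal (h : Rep G w ρ σ s) (i : ℕ) (x : ℝ) : Rep G w ρ σ (s.setReal 1 i x) :=
  { h with weights := by rw [State.setReal_real_ne _ _ _ (by omega)]; exact h.weights }

theorem Rep.setVar (h : Rep G w ρ σ s) (v : ℕ) (x : Fin n) :
    Rep G w (Function.update ρ v x) σ (s.setNat (ar 1 v) 0 x) where
  size := by rw [State.setNat_nat_ne _ _ _ (by unfold ar; omega)]; exact h.size
  adj := by rw [State.setNat_nat_ne _ _ _ (by unfold ar; omega)]; exact h.adj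
  weights := h.weights
  row := by rw [State.setNat_nat_ne _ _ _ (by unfold ar; omega)]; exact h.row
  var u := by
    rcases eq_or_ne u v with rfl | hu
    · simp
    · rw [State.setNat_nat_ne _ _ _ (by unfold ar; omega), h.var u, Function.update_of_ne hu]
  set b := by rw [State.setNat_nat_ne _ _ _ (by unfold ar; omega)]; exact h.set b
  tab t := by rw [State.setNat_nat_ne _ _ _ (by unfold ar; omega)]; exact h.tab t
  ptr p := by rw [State.setNat_nat_ne _ _ _ (by unfold ar; omega)]; exact h.ptr p

theorem Rep.setSetCell (h : Rep G w ρ σ s) (b : ℕ) (i : Fin n) {S : Set (Fin n)} {x : ℕ}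
    (hx : x = ind (i ∈ S)) (hS : ∀ j, j ≠ i → (j ∈ S ↔ j ∈ σ.set b)) :
    Rep G w ρ (σ.setSet b S) (s.setNat (ar 0 b) i x) where
  size := by rw [State.setNat_nat_ne _ _ _ (by unfold ar; omega)]; exact h.size
  adj := by rw [State.setNat_nat_ne _ _ _ (by unfold ar; omega)]; exact h.adj
  weights := h.weights
  row := by rw [State.setNat_nat_ne _ _ _ (by unfold ar; omega)]; exact h.row
  var v := by rw [State.setNat_nat_ne _ _ _ (by unfold ar; omega)]; exact h.var v
  set b' j := by
    rcases eq_or_ne b' b with rfl | hb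
    · rcases eq_or_ne j i with rfl | hj
      · simp [Mem.setSet, hx]
      · have : (j : ℕ) ≠ i := fun h => hj (Fin.ext h)
        simp [Mem.setSet, Function.update_of_ne this, h.set, hS j hj]
    · rw [State.setNat_nat_ne _ _ _ (by unfold ar; omega), h.set b']
      simp [Mem.setSet, hb]
  tab t := by rw [State.setNat_nat_ne _ _ _ (by unfold ar; omega)]; exact h.tab t
  ptr p := by rw [State.setNat_nat_ne _ _ _ (by unfold ar; omega)]; exact h.ptr p

theorem cell_inj {r r' : ℕ} {i i' : Fin n} (h : r * n + i = r' * n + i') : r = r' ∧ i = i' := by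
  have hn : 0 < n := i.pos
  have h1 : r = r' := by
    have := congrArg (· / n) h
    simpa [Nat.add_div_of_dvd_right, Nat.mul_div_cancel _ hn, Nat.div_eq_of_lt i.2,
      Nat.div_eq_of_lt i'.2, Nat.add_comm, Nat.add_mul_div_right _ _ hn] using this
  subst h1
  exact ⟨rfl, Fin.ext (by omega)⟩

theorem Rep.setTabCell (h : Rep G w ρ σ s) (t r : ℕ) (i : Fin n) {S : Set (Fin n)} {x : ℕ}
    (hx : x = ind (i ∈ S)) (hS : ∀ j, j ≠ i → (j ∈ S ↔ j ∈ σ.tab t r)) :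
    Rep G w ρ (σ.setTab t r S) (s.setNat (ar 2 t) (r * n + i) x) where
  size := by rw [State.setNat_nat_ne _ _ _ (by unfold ar; omega)]; exact h.size
  adj := by rw [State.setNat_nat_ne _ _ _ (by unfold ar; omega)]; exact h.adj
  weights := h.weights
  row := by rw [State.setNat_nat_ne _ _ _ (by unfold ar; omega)]; exact h.row
  var v := by rw [State.setNat_nat_ne _ _ _ (by unfold ar; omega)]; exact h.var v
  set b := by rw [State.setNat_nat_ne _ _ _ (by unfold ar; omega)]; exact h.set b
  tab t' r' j := by
    rcases eq_or_ne t' t with rfl | ht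
    · by_cases hc : r' * n + j = r * n + i
      · obtain ⟨rfl, rfl⟩ := cell_inj hc
        simp [Mem.setTab, hx]
      · rw [State.setNat_nat_self, Function.update_of_ne hc, h.tab t']
        rcases eq_or_ne r' r with rfl | hr
        · have : j ≠ i := fun h => hc (by rw [h])
          simp [Mem.setTab, hS j this]
        · simp [Mem.setTab, hr]
    · rw [State.setNat_nat_ne _ _ _ (by unfold ar; omega), h.tab t']
      simp [Mem.setTab, ht]
  ptr p := by rw [State.setNat_nat_ne _ _ _ (by unfold ar; omega)]; exact h.ptr p

theorem Rep.setPtr (h : Rep G w ρ σ s) (p r : ℕ) :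
    Rep G w ρ (σ.setPtr p r) (s.setNat (ar 3 p) 0 (r * n)) where
  size := by rw [State.setNat_nat_ne _ _ _ (by unfold ar; omega)]; exact h.size
  adj := by rw [State.setNat_nat_ne _ _ _ (by unfold ar; omega)]; exact h.adj
  weights := h.weights
  row := by rw [State.setNat_nat_ne _ _ _ (by unfold ar; omega)]; exact h.row
  var v := by rw [State.setNat_nat_ne _ _ _ (by unfold ar; omega)]; exact h.var v
  set b := by rw [State.setNat_nat_ne _ _ _ (by unfold ar; omega)]; exact h.set b
  tab t := by rw [State.setNat_nat_ne _ _ _ (by unfold ar; omega)]; exact h.tab t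
  ptr q := by
    rcases eq_or_ne q p with rfl | hq
    · simp [Mem.setPtr]
    · rw [State.setNat_nat_ne _ _ _ (by unfold ar; omega), h.ptr q]
      simp [Mem.setPtr, hq]

/-- The state represents the memory once the variable `v` is given a value. -/
def RepBut (G : SimpleGraph (Fin n)) (w : Fin n → ℝ) (v : ℕ) (ρ : ℕ → Fin n) (σ : Mem n)
    (s : State) : Prop :=
  ∀ x : Fin n, Rep G w (Function.update ρ v x) σ (s.setNat (ar 1 v) 0 x)

theorem setNat_setNat (s : State) (a i x y : ℕ) :
    (s.setNat a i x).setNat a i y = s.setNat a i y := by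
  simp [State.setNat]

theorem setNat_eq_self (s : State) (a i : ℕ) : s.setNat a i (s.nat a i) = s := by
  simp [State.setNat]

theorem Rep.but (h : Rep G w ρ σ s) (v : ℕ) : RepBut G w v ρ σ s := h.setVar v

theorem RepBut.setVar {v : ℕ} (h : RepBut G w v ρ σ s) (x : ℕ) :
    RepBut G w v ρ σ (s.setNat (ar 1 v) 0 x) := fun y => by
  rw [setNat_setNat]; exact h y

theorem RepBut.rep {v : ℕ} (h : RepBut G w v ρ σ s) {x : Fin n} (hx : s.nat (ar 1 v) 0 = x) :
    Rep G w (Function.update ρ v x) σ s := by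
  have := h x
  rwa [← hx, setNat_eq_self] at this

theorem Rep.but' {v : ℕ} {x : Fin n} (h : Rep G w (Function.update ρ v x) σ s) :
    RepBut G w v ρ σ s := fun y => by
  have := h.setVar v y
  rwa [Function.update_idem] at this

theorem RepBut.size {v : ℕ} (h : RepBut G w v ρ σ s) : s.nat 0 0 = n := by
  have := (h (ρ 0)).size
  rwa [State.setNat_nat_ne _ _ _ (by unfold ar; omega)] at this

end Representation

/-! ### Specifications of compiled code, and loops over vertices. -/

section Loops

variable {n : ℕ}

/-- A loop whose counter belongs to the working space. -/
theorem exec_forScratch {P : Program} {s : State} {c a : ℕ} {J : ℕ → State → Prop}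
    (h0 : J 0 s) (hn : ∀ i s, J i s → s.nat 0 0 = n)
    (hst : ∀ i s x, J i s → J i (s.setNat a 0 x))
    (hs : ∀ i : Fin n, ∀ s, J i s → s.nat a 0 = i →
      Exec P s c fun s' => s'.nat a 0 = i ∧ J (i + 1) s') :
    Exec (forUp a P) s (n * (c + 15) + 15) (J n) := by
  refine (Exec.forUp (I := J) (hst _ _ _ h0) hn ?_).weaken le_rfl fun _ h => h.1
  intro i hi s hJ ha
  exact (hs ⟨i, hi⟩ s hJ ha).weaken le_rfl fun s' h => ⟨h.1, hst _ _ _ h.2⟩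

/-- The content of cell `0` of an array. -/
abbrev rd (a : ℕ) : NatExpr := .read a (.const 0)

/-- The number `k` is the nesting depth: code at depth `k` leaves the working space of smaller
depths alone, so intermediate results of an enclosing construct survive. The time bound is chosen
before the graph and the weights. -/
def FSpec (φ : Formula) (P : Program) (k : ℕ) : Prop :=
  ∃ c, PolyBounded c ∧ ∀ {n : ℕ} (G : SimpleGraph (Fin n)) (w : Fin n → ℝ)
    (ρ : ℕ → Fin n) (σ : Mem n) (s : State), Rep G w ρ σ s → Exec P s (c n) fun s' =>
      Rep G w ρ σ s' ∧ Keep k s s' ∧ s'.nat (ar 8 k) 0 = ind (φ.Holds G w ρ σ)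

def CSpec (d : Cmd) (P : Program) (k : ℕ) : Prop :=
  ∃ c, PolyBounded c ∧ ∀ {n : ℕ} (G : SimpleGraph (Fin n)) (w : Fin n → ℝ)
    (ρ : ℕ → Fin n) (σ : Mem n) (s : State), Rep G w ρ σ s → Exec P s (c n) fun s' =>
      Rep G w ρ (d.exec G w ρ σ) s' ∧ Keep k s s'

/-- Run `P` for all values of the variable `v`, and restore `v`. -/
def forVar (v k : ℕ) (P : Program) : Program :=
  .seq (.setNat (ar 9 k) (.const 0) (rd (ar 1 v)))
    (.seq (forUp (ar 1 v) P) (.setNat (ar 1 v) (.const 0) (rd (ar 9 k))))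

/-- The variable itself is the loop counter. Between passes its cell may hold `n`, which is no
vertex, so the invariant represents the memory only up to `v`; the old value is kept in `ar 9 k`. -/
theorem exec_forVar {G : SimpleGraph (Fin n)} {w : Fin n → ℝ} {ρ : ℕ → Fin n} {τ : ℕ → Mem n}
    {s : State} {v k c : ℕ} {P : Program} {J : ℕ → State → Prop} (h : Rep G w ρ (τ 0) s)
    (h0 : ∀ x, J 0 (s.setNat (ar 9 k) 0 x))
    (hst : ∀ i s x, J i s → J i (s.setNat (ar 1 v) 0 x))
    (hs : ∀ i : Fin n, ∀ s, Rep G w (Function.update ρ v i) (τ i) s → J i s →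
      Exec P s c fun s' => Rep G w (Function.update ρ v i) (τ (i + 1)) s' ∧ Keep k s s' ∧
        s'.nat (ar 9 k) 0 = s.nat (ar 9 k) 0 ∧ J (i + 1) s') :
    Exec (forVar v k P) s (n * (c + 15) + 30) fun s' =>
      Rep G w ρ (τ n) s' ∧ Keep k s s' ∧ J n s' := by
  refine (Exec.seq (Exec.setNat (c := 5) ?_ (by simp [NatExpr.cost]))).weaken
    (by omega : 5 + ((n * (c + 15) + 15) + 5) ≤ _) fun _ h => h
  refine Exec.seq ((Exec.forUp (n := n) (c := c) (I := fun i s' => RepBut G w v ρ (τ i) s' ∧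
    Keep k s s' ∧ s'.nat (ar 9 k) 0 = ρ v ∧ J i s') ?_ ?_ ?_).weaken le_rfl ?_)
  · refine ⟨((h.scratch 9 k _ _ (by omega) (by omega)).but v).setVar _,
      ((Keep.refl k s).scratch 9 k _ _ (by omega) le_rfl).data _ _ _ _ (by omega), ?_,
      hst _ _ _ (h0 _)⟩
    rw [State.setNat_nat_ne _ _ _ (by unfold ar; omega)]
    simp [NatExpr.eval, h.var]
  · exact fun i s h => h.1.size
  · rintro i hi s1 ⟨hr, hk, hsv, hJ⟩ hv
    refine (hs ⟨i, hi⟩ s1 (hr.rep hv) hJ).weaken le_rfl ?_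
    rintro s2 ⟨hr2, hk2, hsv2, hJ2⟩
    refine ⟨?_, hr2.but'.setVar _, (hk.trans hk2).data _ _ _ _ (by omega), ?_,
      hst _ _ _ hJ2⟩
    · rw [hr2.var v]; simp
    · rw [State.setNat_nat_ne _ _ _ (by unfold ar; omega), hsv2, hsv]
  · rintro s1 ⟨⟨hr, hk, hsv, hJ⟩, -⟩
    refine Exec.setNat ?_ (by simp [NatExpr.cost])
    simp only [NatExpr.eval, hsv]
    refine ⟨?_, hk.data _ _ _ _ (by omega), hst _ _ _ hJ⟩
    have := hr (ρ v)
    rwa [Function.update_eq_self] at this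

end Loops

end SetProg

namespace SetProg

open RAM

/-! ### Evaluating equality, adjacency, membership, Boolean connectives and quantifiers. -/

section Formulas

theorem PolyBounded.loop {c : ℕ → ℕ} (hc : PolyBounded c) (k l : ℕ) :
    PolyBounded fun n => n * (c n + k) + l :=
  (PolyBounded.id.mul (hc.add (.const k))).add (.const l)

/-- Store the truth values of a formula with respect to the values of `v` in an array. -/
def fill (v k : ℕ) (P : Program) : Program :=
  forVar v k (.seq P (.setNat (ar 10 k) (rd (ar 1 v)) (rd (ar 8 (k + 1)))))

theorem exec_fill {φ : Formula} {P : Program} {k : ℕ} (hP : FSpec φ P (k + 1)) (v : ℕ) :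
    ∃ c, PolyBounded c ∧ ∀ {n : ℕ} (G : SimpleGraph (Fin n)) (w : Fin n → ℝ) (ρ : ℕ → Fin n)
      (σ : Mem n) (s : State), Rep G w ρ σ s → Exec (fill v k P) s (c n) fun s' =>
        Rep G w ρ σ s' ∧ Keep k s s' ∧
        ∀ i : Fin n, s'.nat (ar 10 k) i = ind (φ.Holds G w (Function.update ρ v i) σ) := by
  obtain ⟨c, hc, hP⟩ := hP
  refine ⟨_, PolyBounded.loop (hc.add (.const 5)) 15 30, fun {n} G w ρ σ s hs => ?_⟩
  refine (exec_forVar (τ := fun _ => σ) (c := c n + 5) (J := fun m s' => ∀ i : Fin n, i < m →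
    s'.nat (ar 10 k) i = ind (φ.Holds G w (Function.update ρ v i) σ)) hs (by simp) ?_ ?_).weaken
    le_rfl fun s' h => ⟨h.1, h.2.1, fun i => h.2.2 i i.2⟩
  · intro i s x h j hj
    rw [State.setNat_nat_ne _ _ _ (by unfold ar; omega)]
    exact h j hj
  · intro i s1 h1 hJ
    refine Exec.seq ((hP G w _ σ s1 h1).weaken le_rfl ?_)
    rintro s2 ⟨h2, hk, hf⟩
    refine Exec.setNat ?_ (by simp [NatExpr.cost])
    simp only [NatExpr.eval, h2.var v, Function.update_self, hf]
    refine ⟨h2.scratch _ _ _ _ (by omega) (by omega),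
      (hk.mono (Nat.le_succ k)).scratch _ _ _ _ (by omega) le_rfl, ?_, ?_⟩
    · rw [State.setNat_nat_ne _ _ _ (by unfold ar; omega), hk 9 k (by omega) (by omega) (by omega)]
    · intro j hj
      rcases eq_or_ne j i with rfl | hji
      · simp
      · have : (j : ℕ) ≠ i := fun h => hji (Fin.ext h)
        rw [State.setNat_nat_self, Function.update_of_ne this,
          hk 10 k (by omega) (by omega) (by omega)]
        exact hJ j (by omega)

theorem fSpec_flag {φ : Formula} {k : ℕ} (e : NatExpr) (he : e.cost ≤ 20)
    (h : ∀ {n : ℕ} (G : SimpleGraph (Fin n)) (w : Fin n → ℝ) (ρ : ℕ → Fin n) (σ : Mem n)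
      (s : State), Rep G w ρ σ s → e.eval s = ind (φ.Holds G w ρ σ)) :
    FSpec φ (.setNat (ar 8 k) (.const 0) e) k := by
  refine ⟨_, .const 22, fun {n} G w ρ σ s hs => Exec.setNat ?_ ?_⟩
  · refine ⟨hs.scratch _ _ _ _ (by omega) (by omega),
      (Keep.refl k s).scratch _ _ _ _ (by omega) le_rfl, ?_⟩
    simpa [NatExpr.eval] using h G w ρ σ s hs
  · simp only [NatExpr.cost]; omega

theorem fSpec_adj (x y k : ℕ) : FSpec (.adj x y) (.setNat (ar 8 k) (.const 0)
    (.read 1 (.add (.read (ar 4 0) (rd (ar 1 x))) (rd (ar 1 y))))) k :=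
  fSpec_flag _ (by simp [NatExpr.cost]) fun G w ρ σ s hs => by
    simp only [NatExpr.eval, hs.var, hs.row, hs.adj, Formula.Holds]

theorem fSpec_mem (x b k : ℕ) : FSpec (.mem x b) (.setNat (ar 8 k) (.const 0)
    (.read (ar 0 b) (rd (ar 1 x)))) k :=
  fSpec_flag _ (by simp [NatExpr.cost]) fun G w ρ σ s hs => by
    simp only [NatExpr.eval, hs.var, hs.set, Formula.Holds]

/-- Set a flag to the truth value of a test. -/
def flag (k : ℕ) (b : Test) : Program :=
  .ite b (.setNat (ar 8 k) (.const 0) (.const 1)) (.setNat (ar 8 k) (.const 0) (.const 0))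

theorem exec_flag {k : ℕ} {b : Test} {s : State} {p : Prop} {Q : State → Prop}
    (hb : b.Holds s ↔ p) (hQ : Q (s.setNat (ar 8 k) 0 (ind p))) :
    Exec (flag k b) s (b.cost + 5) Q := by
  refine Exec.ite (fun h => Exec.setNat ?_ (by simp [NatExpr.cost]))
    (fun h => Exec.setNat ?_ (by simp [NatExpr.cost])) le_rfl
  · rwa [ind_of (hb.1 h)] at hQ
  · rwa [ind_of_not fun h' => h (hb.2 h')] at hQ

theorem fSpec_eq (x y k : ℕ) :
    FSpec (.eq x y) (flag k (.natEq (rd (ar 1 x)) (rd (ar 1 y)))) k := by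
  refine ⟨_, .const 20, fun {n} G w ρ σ s hs => ?_⟩
  refine (exec_flag (p := ρ x = ρ y) ?_ ⟨hs.scratch _ _ _ _ (by omega) (by omega),
      (Keep.refl k s).scratch _ _ _ _ (by omega) le_rfl, ?_⟩).weaken
      (by simp [Test.cost, NatExpr.cost]) fun _ h => h
  · simp only [Test.Holds, NatExpr.eval, hs.var, Fin.ext_iff]
  · simp [Formula.Holds]

theorem fSpec_not {φ : Formula} {P : Program} {k : ℕ} (h : FSpec φ P k) :
    FSpec (.not φ) (.seq P (flag k (.natEq (rd (ar 8 k)) (.const 0)))) k := by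
  obtain ⟨c, hc, hP⟩ := h
  refine ⟨_, hc.add (.const 20), fun {n} G w ρ σ s hs => ?_⟩
  refine Exec.seq ((hP G w ρ σ s hs).weaken le_rfl ?_)
  rintro s1 ⟨h1, hk, hf⟩
  refine (exec_flag (p := ¬ φ.Holds G w ρ σ) ?_ ⟨h1.scratch _ _ _ _ (by omega) (by omega),
      hk.scratch _ _ _ _ (by omega) le_rfl, ?_⟩).weaken
      (by simp [Test.cost, NatExpr.cost]) fun _ h => h
  · by_cases hφ : φ.Holds G w ρ σ <;> simp [Test.Holds, NatExpr.eval, hf, ind, hφ]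
  · simp [Formula.Holds]

theorem fSpec_and {φ ψ : Formula} {P Q : Program} {k : ℕ} (h : FSpec φ P k)
    (h' : FSpec ψ Q (k + 1)) :
    FSpec (.and φ ψ) (.seq P (.seq Q (flag k
      (.and (.natEq (rd (ar 8 k)) (.const 1)) (.natEq (rd (ar 8 (k + 1))) (.const 1)))))) k := by
  obtain ⟨c, hc, hP⟩ := h
  obtain ⟨d, hd, hQ⟩ := h'
  refine ⟨_, hc.add (hd.add (.const 20)), fun {n} G w ρ σ s hs => ?_⟩
  refine Exec.seq ((hP G w ρ σ s hs).weaken le_rfl ?_)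
  rintro s1 ⟨h1, hk, hf⟩
  refine Exec.seq ((hQ G w ρ σ s1 h1).weaken le_rfl ?_)
  rintro s2 ⟨h2, hk2, hf2⟩
  refine (exec_flag (p := φ.Holds G w ρ σ ∧ ψ.Holds G w ρ σ) ?_
    ⟨h2.scratch _ _ _ _ (by omega) (by omega),
      (hk.trans (hk2.mono (Nat.le_succ k))).scratch _ _ _ _ (by omega) le_rfl, ?_⟩).weaken
      (by simp [Test.cost, NatExpr.cost]) fun _ h => h
  · have := hk2 8 k (by omega) (by omega) (by omega)
    simp only [Test.Holds, NatExpr.eval, this, hf, hf2, ind_eq_one]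
  · simp [Formula.Holds]

/-- Some value of the array `ar 10 k` is `1`. -/
def anyCell (k : ℕ) : Program :=
  .seq (.setNat (ar 8 k) (.const 0) (.const 0))
    (forUp (ar 13 k) (.ite (.natEq (.read (ar 10 k) (rd (ar 13 k))) (.const 1))
      (.setNat (ar 8 k) (.const 0) (.const 1)) .skip))

theorem fSpec_ex {φ : Formula} {P : Program} {k : ℕ} (hP : FSpec φ P (k + 1)) (v : ℕ) :
    FSpec (.ex v φ) (.seq (fill v k P) (anyCell k)) k := by
  obtain ⟨c, hc, hP⟩ := exec_fill hP v
  refine ⟨_, hc.add ((PolyBounded.const 10).add (PolyBounded.loop (.const 20) 15 15)),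
    fun {n} G w ρ σ s hs => ?_⟩
  refine Exec.seq ((hP G w ρ σ s hs).weaken le_rfl ?_)
  rintro s1 ⟨h1, hk1, hf1⟩
  refine Exec.seq (Exec.setNat ?_ (by simp [NatExpr.cost]))
  refine (exec_forScratch (n := n) (J := fun m s' => Rep G w ρ σ s' ∧ Keep k s s' ∧
    (∀ i : Fin n, s'.nat (ar 10 k) i = ind (φ.Holds G w (Function.update ρ v i) σ)) ∧
    s'.nat (ar 8 k) 0 = ind (∃ i : Fin n, i < m ∧ φ.Holds G w (Function.update ρ v i) σ))
    ?_ ?_ ?_ ?_).weaken le_rfl ?_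
  · refine ⟨h1.scratch _ _ _ _ (by omega) (by omega),
      hk1.scratch _ _ _ _ (by omega) le_rfl, ?_, ?_⟩
    · rw [State.setNat_nat_ne _ _ _ (by unfold ar; omega)]
      exact hf1
    · simp [NatExpr.eval, ind]
  · exact fun _ _ h => h.1.size
  · rintro i s2 x ⟨h2, hk2, hf2, hg2⟩
    refine ⟨h2.scratch _ _ _ _ (by omega) (by omega),
      hk2.scratch _ _ _ _ (by omega) le_rfl, ?_, ?_⟩
    · rwa [State.setNat_nat_ne _ _ _ (by unfold ar; omega)]
    · rwa [State.setNat_nat_ne _ _ _ (by unfold ar; omega)]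
  · rintro i s2 ⟨h2, hk2, hf2, hg2⟩ hi
    refine Exec.ite (c := 10) (fun hb => Exec.setNat ?_ (by simp [NatExpr.cost]))
      (fun hb => Exec.skip ?_ (by omega)) (by simp [Test.cost, NatExpr.cost])
    · simp only [Test.Holds, NatExpr.eval, hi, hf2, ind_eq_one] at hb
      refine ⟨?_, h2.scratch _ _ _ _ (by omega) (by omega),
        hk2.scratch _ _ _ _ (by omega) le_rfl, ?_, ?_⟩
      · rw [State.setNat_nat_ne _ _ _ (by unfold ar; omega)]
        exact hi
      · rw [State.setNat_nat_ne _ _ _ (by unfold ar; omega)]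
        exact hf2
      · rw [ind_of ⟨i, Nat.lt_succ_self _, hb⟩]
        simp [NatExpr.eval]
    · simp only [Test.Holds, NatExpr.eval, hi, hf2, ind_eq_one] at hb
      refine ⟨hi, h2, hk2, hf2, hg2.trans ?_⟩
      congr 1
      refine propext (exists_congr fun j => and_congr_left fun hj => ?_)
      have : (j : ℕ) ≠ i := fun h => hb (Fin.ext h ▸ hj)
      omega
  · rintro s2 ⟨h2, hk2, -, hg2⟩
    refine ⟨h2, hk2, hg2.trans ?_⟩
    congr 1
    exact propext (exists_congr fun j => and_iff_right j.2)

end Formulas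

end SetProg

namespace SetProg

open RAM

/-! ### Evaluating connectivity by graph search. -/

section Connectivity

/-- One step of the search: `j` is reached if it is an admissible neighbour of the reached `i`. -/
def reachStep (k : ℕ) : Program :=
  .ite (.and (.natEq (.read (ar 11 k) (rd (ar 13 k))) (.const 1))
      (.and (.natEq (.read (ar 10 k) (rd (ar 14 k))) (.const 1))
        (.natEq (.read 1 (.add (.read (ar 4 0) (rd (ar 13 k))) (rd (ar 14 k)))) (.const 1))))
    (.setNat (ar 11 k) (rd (ar 14 k)) (.const 1)) .skip

/-- `n` rounds of the search for the vertices that can be reached from `x`. -/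
def reach (k x : ℕ) : Program :=
  .seq (forUp (ar 13 k) (.setNat (ar 11 k) (rd (ar 13 k)) (.const 0)))
    (.seq (.setNat (ar 11 k) (rd (ar 1 x)) (.read (ar 10 k) (rd (ar 1 x))))
      (forUp (ar 12 k) (forUp (ar 13 k) (forUp (ar 14 k) (reachStep k)))))

variable {n : ℕ} {G : SimpleGraph (Fin n)} {w : Fin n → ℝ} {ρ : ℕ → Fin n} {σ : Mem n}
  {s s₀ : State} {k : ℕ} {W S : Set (Fin n)}

/-- Invariant of the search: `S` has been reached, and `W` is the set of admissible vertices. -/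
structure Reached (G : SimpleGraph (Fin n)) (w : Fin n → ℝ) (ρ : ℕ → Fin n) (σ : Mem n)
    (k : ℕ) (s₀ : State) (W S : Set (Fin n)) (s : State) : Prop where
  rep : Rep G w ρ σ s
  keep : Keep k s₀ s
  admissible : ∀ i : Fin n, s.nat (ar 10 k) i = ind (i ∈ W)
  reached : ∀ i : Fin n, s.nat (ar 11 k) i = ind (i ∈ S)

theorem Reached.counter (h : Reached G w ρ σ k s₀ W S s) (c x : ℕ) (hc : 12 ≤ c) (hc' : c < 16) :
    Reached G w ρ σ k s₀ W S (s.setNat (ar c k) 0 x) where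
  rep := h.rep.scratch _ _ _ _ (by omega) (by omega)
  keep := h.keep.scratch _ _ _ _ (by omega) le_rfl
  admissible := by rw [State.setNat_nat_ne _ _ _ (by unfold ar; omega)]; exact h.admissible
  reached := by rw [State.setNat_nat_ne _ _ _ (by unfold ar; omega)]; exact h.reached

theorem Reached.insert (h : Reached G w ρ σ k s₀ W S s) (j : Fin n) :
    Reached G w ρ σ k s₀ W (insert j S) (s.setNat (ar 11 k) j 1) where
  rep := h.rep.scratch _ _ _ _ (by omega) (by omega)
  keep := h.keep.scratch _ _ _ _ (by omega) le_rfl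
  admissible := by rw [State.setNat_nat_ne _ _ _ (by unfold ar; omega)]; exact h.admissible
  reached i := by
    rw [State.setNat_nat_self]
    rcases eq_or_ne i j with rfl | hij
    · simp [ind]
    · have : (i : ℕ) ≠ j := fun h => hij (Fin.ext h)
      rw [Function.update_of_ne this, h.reached]
      simp [hij]

/-- Closed under admissible neighbours. -/
def Closed (G : SimpleGraph (Fin n)) (W S : Set (Fin n)) : Prop :=
  ∀ i ∈ S, ∀ j ∈ W, G.Adj i j → j ∈ S

/-- `S'` is a result of searching from `S`, where the edges in `E` have been used. -/
structure Grown (G : SimpleGraph (Fin n)) (W S S' : Set (Fin n)) (E : Fin n → Fin n → Prop) :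
    Prop where
  subset : S ⊆ S'
  least : ∀ T, S ⊆ T → Closed G W T → S' ⊆ T
  used : ∀ i ∈ S, ∀ j ∈ W, G.Adj i j → E i j → j ∈ S'

theorem exec_reachStep {S' : Set (Fin n)} {E E' : Fin n → Fin n → Prop} {i j : Fin n}
    (h : Reached G w ρ σ k s₀ W S' s) (hS : Grown G W S S' E) (hi : s.nat (ar 13 k) 0 = i)
    (hj : s.nat (ar 14 k) 0 = j) (hE : ∀ a b, E' a b → E a b ∨ (a = i ∧ b = j)) :
    Exec (reachStep k) s 50 fun s' => s'.nat (ar 13 k) 0 = i ∧ s'.nat (ar 14 k) 0 = j ∧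
      s'.nat (ar 12 k) = s.nat (ar 12 k) ∧
      ∃ S'', Reached G w ρ σ k s₀ W S'' s' ∧ Grown G W S S'' E' := by
  have hb : Test.Holds s (.and (.natEq (.read (ar 11 k) (rd (ar 13 k))) (.const 1))
      (.and (.natEq (.read (ar 10 k) (rd (ar 14 k))) (.const 1))
        (.natEq (.read 1 (.add (.read (ar 4 0) (rd (ar 13 k))) (rd (ar 14 k)))) (.const 1)))) ↔
      i ∈ S' ∧ j ∈ W ∧ G.Adj i j := by
    simp only [Test.Holds, NatExpr.eval, hi, hj, h.admissible, h.reached, h.rep.row, h.rep.adj,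
      ind_eq_one]
  refine Exec.ite (c := 10) (fun hT => Exec.setNat ?_ (by simp [NatExpr.cost]))
    (fun hT => Exec.skip ?_ (by omega)) (by simp [Test.cost, NatExpr.cost])
  · obtain ⟨hiS, hjW, hij⟩ := hb.1 hT
    simp only [NatExpr.eval, hj]
    refine ⟨?_, ?_, ?_, insert j S', h.insert j, hS.subset.trans (Set.subset_insert _ _), ?_, ?_⟩
    · rwa [State.setNat_nat_ne _ _ _ (by unfold ar; omega)]
    · rwa [State.setNat_nat_ne _ _ _ (by unfold ar; omega)]
    · rw [State.setNat_nat_ne _ _ _ (by unfold ar; omega)]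
    · exact fun T hST hT => Set.insert_subset (hT i (hS.least T hST hT hiS) j hjW hij)
        (hS.least T hST hT)
    · intro a ha b hb hab hE'
      rcases hE a b hE' with h' | ⟨rfl, rfl⟩
      exacts [.inr (hS.used a ha b hb hab h'), .inl rfl]
  · refine ⟨hi, hj, rfl, S', h, hS.subset, hS.least, ?_⟩
    intro a ha b hb' hab hE'
    rcases hE a b hE' with h' | ⟨rfl, rfl⟩
    · exact hS.used a ha b hb' hab h'
    · exact (hT (hb.2 ⟨hS.subset ha, hb', hab⟩)).elim

theorem exec_reachRound (h : Reached G w ρ σ k s₀ W S s) :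
    Exec (forUp (ar 13 k) (forUp (ar 14 k) (reachStep k))) s
      (n * ((n * (50 + 15) + 15) + 15) + 15) fun s' => s'.nat (ar 12 k) = s.nat (ar 12 k) ∧
        ∃ S', Reached G w ρ σ k s₀ W S' s' ∧ Grown G W S S' fun _ _ => True := by
  refine (exec_forScratch (n := n) (J := fun m s' => s'.nat (ar 12 k) = s.nat (ar 12 k) ∧
    ∃ S', Reached G w ρ σ k s₀ W S' s' ∧ Grown G W S S' fun i _ => (i : ℕ) < m)
    ?_ ?_ ?_ ?_).weaken le_rfl ?_
  · exact ⟨rfl, S, h, subset_rfl, fun _ h _ => h, by simp⟩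
  · exact fun i s h => h.2.choose_spec.1.rep.size
  · rintro i s1 x ⟨h12, S', h1, h2⟩
    refine ⟨?_, S', h1.counter _ _ (by omega) (by omega), h2⟩
    rwa [State.setNat_nat_ne _ _ _ (by unfold ar; omega)]
  · rintro i s1 ⟨h12, S', h1, h2⟩ hi
    refine (exec_forScratch (n := n) (J := fun m s' => s'.nat (ar 12 k) = s.nat (ar 12 k) ∧
      s'.nat (ar 13 k) 0 = i ∧ ∃ S', Reached G w ρ σ k s₀ W S' s' ∧
      Grown G W S S' fun a b => (a : ℕ) < i ∨ (a = i ∧ (b : ℕ) < m)) ?_ ?_ ?_ ?_).weaken le_rfl ?_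
    · exact ⟨h12, hi, S', h1, h2.subset, h2.least, fun a ha b hb hab h =>
        h2.used a ha b hb hab (by simpa using h)⟩
    · exact fun i s h => h.2.2.choose_spec.1.rep.size
    · rintro j s2 x ⟨h12, h13, S', h1, h2⟩
      refine ⟨?_, ?_, S', h1.counter _ _ (by omega) (by omega), h2⟩
      · rwa [State.setNat_nat_ne _ _ _ (by unfold ar; omega)]
      · rwa [State.setNat_nat_ne _ _ _ (by unfold ar; omega)]
    · rintro j s2 ⟨h12', h13, S'', h1', h2'⟩ hj
      refine (exec_reachStep h1' h2' h13 hj (E' := fun a b => (a : ℕ) < i ∨ (a = i ∧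
        (b : ℕ) < j + 1)) ?_).weaken le_rfl ?_
      · rintro a b (h | ⟨rfl, h⟩)
        · exact .inl (.inl h)
        · rcases Nat.lt_succ_iff_lt_or_eq.1 h with h | h
          exacts [.inl (.inr ⟨rfl, h⟩), .inr ⟨rfl, Fin.ext h⟩]
      · rintro s3 ⟨h13, h14, h12, hex⟩
        exact ⟨h14, h12.trans h12', h13, hex⟩
    · rintro s2 ⟨h12, h13, S', h1, h2⟩
      refine ⟨h13, h12, S', h1, h2.subset, h2.least, fun a ha b hb hab h =>
        h2.used a ha b hb hab ?_⟩
      rcases Nat.lt_succ_iff_lt_or_eq.1 h with h | h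
      exacts [.inl h, .inr ⟨Fin.ext h, b.2⟩]
  · rintro s1 ⟨h12, S', h1, h2⟩
    exact ⟨h12, S', h1, h2.subset, h2.least, fun a ha b hb hab _ => h2.used a ha b hb hab a.2⟩

/-- A round that starts from a set that is not closed adds a vertex, so after `n` rounds the search
is complete. -/
theorem Grown.closed_or {m : ℕ} (hS : Closed G W S ∨ m ≤ S.ncard) {S' : Set (Fin n)}
    (h : Grown G W S S' fun _ _ => True) : Closed G W S' ∨ m + 1 ≤ S'.ncard := by
  by_cases hc : Closed G W S
  · have : S' = S := (h.least S subset_rfl hc).antisymm h.subset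
    exact .inl (this ▸ hc)
  · refine .inr ((hS.resolve_left hc).trans_lt (Set.ncard_lt_ncard ⟨h.subset, fun hs => hc ?_⟩))
    exact fun i hi j hj ha => hs (h.used i hi j hj ha trivial)

theorem exec_reach (h : Rep G w ρ σ s) (x : ℕ)
    (hW : ∀ i : Fin n, s.nat (ar 10 k) i = ind (i ∈ W)) :
    Exec (reach k x) s (n * (20 + 15) + 15 + (10 +
      (n * ((n * ((n * (50 + 15) + 15) + 15) + 15) + 15) + 15))) fun s' =>
      Reached G w ρ σ k s W (Burling.comp G W (ρ x)) s' := by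
  refine Exec.seq ((exec_forScratch (n := n) (J := fun m s' => Rep G w ρ σ s' ∧ Keep k s s' ∧
    (∀ i : Fin n, s'.nat (ar 10 k) i = ind (i ∈ W)) ∧
    ∀ i : Fin n, i < m → s'.nat (ar 11 k) i = 0) ?_ ?_ ?_ ?_).weaken le_rfl ?_)
  · exact ⟨h, .refl k s, hW, by simp⟩
  · exact fun _ _ h => h.1.size
  · rintro i s1 x ⟨h1, h2, h3, h4⟩
    refine ⟨h1.scratch _ _ _ _ (by omega) (by omega), h2.scratch _ _ _ _ (by omega) le_rfl,
      ?_, ?_⟩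
    · rwa [State.setNat_nat_ne _ _ _ (by unfold ar; omega)]
    · rwa [State.setNat_nat_ne _ _ _ (by unfold ar; omega)]
  · rintro i s1 ⟨h1, h2, h3, h4⟩ hi
    refine Exec.setNat ⟨?_, h1.scratch _ _ _ _ (by omega) (by omega),
      h2.scratch _ _ _ _ (by omega) le_rfl, ?_, ?_⟩ (by simp [NatExpr.cost])
    · rwa [State.setNat_nat_ne _ _ _ (by unfold ar; omega)]
    · rwa [State.setNat_nat_ne _ _ _ (by unfold ar; omega)]
    · intro j hj
      simp only [NatExpr.eval, hi, State.setNat_nat_self]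
      rcases eq_or_ne (j : ℕ) i with hji | hji
      · simp [hji]
      · rw [Function.update_of_ne hji]
        exact h4 j (by omega)
  · rintro s1 ⟨h1, h2, h3, h4⟩
    refine Exec.seq (Exec.setNat ?_ (by simp [NatExpr.cost]))
    simp only [NatExpr.eval, h1.var, h3]
    have hstart : Reached G w ρ σ k s W {i | i = ρ x ∧ i ∈ W}
        (s1.setNat (ar 11 k) (ρ x) (ind (ρ x ∈ W))) := by
      refine ⟨h1.scratch _ _ _ _ (by omega) (by omega),
        h2.scratch _ _ _ _ (by omega) le_rfl, ?_, ?_⟩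
      · rwa [State.setNat_nat_ne _ _ _ (by unfold ar; omega)]
      · intro j
        rw [State.setNat_nat_self]
        rcases eq_or_ne j (ρ x) with rfl | hj
        · simp
        · have : (j : ℕ) ≠ ρ x := fun h => hj (Fin.ext h)
          rw [Function.update_of_ne this, h4 j j.2, ind_of_not]
          exact fun h => hj h.1
    refine (exec_forScratch (n := n) (J := fun m s' => ∃ S, Reached G w ρ σ k s W S s' ∧
      {i | i = ρ x ∧ i ∈ W} ⊆ S ∧ S ⊆ Burling.comp G W (ρ x) ∧
      (Closed G W S ∨ m ≤ S.ncard)) ?_ ?_ ?_ ?_).weaken le_rfl ?_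
    · refine ⟨_, hstart, subset_rfl, ?_, .inr (Nat.zero_le _)⟩
      rintro i ⟨rfl, hi⟩
      exact Burling.mem_comp_self hi
    · exact fun _ _ h => h.choose_spec.1.rep.size
    · rintro i s2 y ⟨S, hS, hS'⟩
      exact ⟨S, hS.counter _ _ (by omega) (by omega), hS'⟩
    · rintro i s2 ⟨S, hS, hxS, hSc, hcl⟩ hi
      refine (exec_reachRound hS).weaken le_rfl ?_
      rintro s3 ⟨h12, S', hS', hg⟩
      refine ⟨by rw [h12]; exact hi, S', hS', hxS.trans hg.subset, ?_, hg.closed_or hcl⟩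
      exact hg.least _ hSc fun i hi j hj ha => Burling.comp_adj hi ha hj
    · rintro s2 ⟨S, hS, hxS, hSc, hcl⟩
      -- Either the reached set is closed, or it has `n` elements and is everything.
      have : S = Burling.comp G W (ρ x) := by
        rcases hcl with hcl | hcl
        · exact hSc.antisymm (Burling.comp_subset_of_closed (fun hx => hxS ⟨rfl, hx⟩) hcl)
        · have huniv : S = Set.univ := by
            refine Set.eq_of_subset_of_ncard_le (Set.subset_univ _) ?_
            simpa [Set.ncard_univ] using hcl
          exact hSc.antisymm (huniv ▸ Set.subset_univ _)
      exact this ▸ hS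

theorem fSpec_conn {φ : Formula} {P : Program} {k : ℕ} (hP : FSpec φ P (k + 1)) (v x y : ℕ) :
    FSpec (.conn v φ x y) (.seq (fill v k P) (.seq (reach k x)
      (.setNat (ar 8 k) (.const 0) (.read (ar 11 k) (rd (ar 1 y)))))) k := by
  obtain ⟨c, hc, hP⟩ := exec_fill hP v
  refine ⟨_, hc.add (((PolyBounded.loop (.const 20) 15 15).add ((PolyBounded.const 10).add
    (PolyBounded.loop (PolyBounded.loop (PolyBounded.loop (.const 50) 15 15) 15 15) 15 15))).add
    (PolyBounded.const 10)), fun {n} G w ρ σ s hs => ?_⟩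
  refine Exec.seq ((hP G w ρ σ s hs).weaken le_rfl ?_)
  rintro s1 ⟨h1, hk1, hf1⟩
  refine Exec.seq ((exec_reach (W := {a | φ.Holds G w (Function.update ρ v a) σ}) h1 x hf1).weaken
    le_rfl ?_)
  rintro s2 ⟨h2, hk2, -, hr2⟩
  refine Exec.setNat ⟨h2.scratch _ _ _ _ (by omega) (by omega),
    (hk1.trans hk2).scratch _ _ _ _ (by omega) le_rfl, ?_⟩ (by simp [NatExpr.cost])
  simp only [NatExpr.eval, h2.var, hr2, State.setNat_nat_self, Function.update_self,
    Formula.Holds, Burling.mem_comp]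

end Connectivity

/-! ### Comparing the weights of sets. -/

section Weights

/-- Sum up the weights of the elements of the set `b` in a cell of the real array `1`. -/
def sumUp (k b cell : ℕ) : Program :=
  .seq (.setReal 1 (.const cell) (.sub (.read 1 (.const cell)) (.read 1 (.const cell))))
    (forUp (ar 13 k) (.ite (.natEq (.read (ar 0 b) (rd (ar 13 k))) (.const 1))
      (.setReal 1 (.const cell) (.add (.read 1 (.const cell)) (.read 0 (rd (ar 13 k))))) .skip))

open Classical in
theorem exec_sumUp {n : ℕ} {G : SimpleGraph (Fin n)} {w : Fin n → ℝ} {ρ : ℕ → Fin n} {σ : Mem n}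
    {s : State} (k b cell : ℕ) (h : Rep G w ρ σ s) :
    Exec (sumUp k b cell) s (10 + (n * (30 + 15) + 15)) fun s' => Rep G w ρ σ s' ∧ Keep k s s' ∧
      s'.real 1 cell = weight w (σ.set b) ∧ ∀ c ≠ cell, s'.real 1 c = s.real 1 c := by
  -- There are no real constants; zero is obtained by subtracting the cell from itself.
  refine Exec.seq (Exec.setReal ?_ (by simp [NatExpr.cost, RealExpr.cost]))
  refine (exec_forScratch (n := n) (J := fun m s' => Rep G w ρ σ s' ∧ Keep k s s' ∧
    s'.real 1 cell = ∑ i ∈ Finset.range m,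
      (if hi : i < n then if ⟨i, hi⟩ ∈ σ.set b then w ⟨i, hi⟩ else 0 else 0) ∧
    ∀ c ≠ cell, s'.real 1 c = s.real 1 c) ?_ ?_ ?_ ?_).weaken le_rfl ?_
  · refine ⟨h.setReal _ _, (Keep.refl k s).setReal _ _, ?_, fun c hc => ?_⟩
    · simp [RealExpr.eval, NatExpr.eval]
    · simp [NatExpr.eval, hc]
  · exact fun _ _ h => h.1.size
  · rintro i s1 x ⟨h1, h2, h3⟩
    exact ⟨h1.scratch _ _ _ _ (by omega) (by omega), h2.scratch _ _ _ _ (by omega) le_rfl, h3⟩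
  · rintro i s1 ⟨h1, h2, h3, h4⟩ hi
    refine Exec.ite (c := 20) (fun hb => Exec.setReal ?_ (by simp [NatExpr.cost, RealExpr.cost]))
      (fun hb => Exec.skip ?_ (by omega)) (by simp [Test.cost, NatExpr.cost])
    · simp only [Test.Holds, NatExpr.eval, hi, h1.set, ind_eq_one] at hb
      refine ⟨hi, h1.setReal _ _, h2.setReal _ _, ?_, fun c hc => ?_⟩
      · simp [RealExpr.eval, NatExpr.eval, Finset.sum_range_succ, hi, h1.weights, h3, hb]
      · simp [NatExpr.eval, hc, h4 c hc]
    · simp only [Test.Holds, NatExpr.eval, hi, h1.set, ind_eq_one] at hb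
      exact ⟨hi, h1, h2, by simp [Finset.sum_range_succ, h3, hb], h4⟩
  · rintro s1 ⟨h1, h2, h3, h4⟩
    refine ⟨h1, h2, h3.trans ?_, h4⟩
    rw [Finset.sum_range]
    simp [weight]

theorem fSpec_lighter (b b' k : ℕ) : FSpec (.lighter b b') (.seq (sumUp k b 0) (.seq (sumUp k b' 1)
    (flag k (.realLt (.read 1 (.const 0)) (.read 1 (.const 1)))))) k := by
  have hc := (PolyBounded.const 10).add (PolyBounded.loop (.const 30) 15 15)
  refine ⟨_, hc.add (hc.add (.const 20)), fun {n} G w ρ σ s hs => ?_⟩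
  refine Exec.seq ((exec_sumUp k b 0 hs).weaken le_rfl ?_)
  rintro s1 ⟨h1, hk1, hr1, -⟩
  refine Exec.seq ((exec_sumUp k b' 1 h1).weaken le_rfl ?_)
  rintro s2 ⟨h2, hk2, hr2, hr2'⟩
  refine (exec_flag (p := weight w (σ.set b) < weight w (σ.set b')) ?_
    ⟨h2.scratch _ _ _ _ (by omega) (by omega),
      (hk1.trans hk2).scratch _ _ _ _ (by omega) le_rfl, ?_⟩).weaken
      (by simp [Test.cost, NatExpr.cost, RealExpr.cost]) fun _ h => h
  · simp only [Test.Holds, RealExpr.eval, NatExpr.eval, hr2, hr2' 0 (by omega), hr1]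
  · simp [Formula.Holds]

end Weights

/-! ### Compiling formulas and commands. -/

section Compilation

def Formula.compile : Formula → ℕ → Program
  | .adj x y, k => .setNat (ar 8 k) (.const 0)
      (.read 1 (.add (.read (ar 4 0) (rd (ar 1 x))) (rd (ar 1 y))))
  | .eq x y, k => flag k (.natEq (rd (ar 1 x)) (rd (ar 1 y)))
  | .mem x b, k => .setNat (ar 8 k) (.const 0) (.read (ar 0 b) (rd (ar 1 x)))
  | .lighter b b', k => .seq (sumUp k b 0) (.seq (sumUp k b' 1)
      (flag k (.realLt (.read 1 (.const 0)) (.read 1 (.const 1)))))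
  | .not φ, k => .seq (φ.compile k) (flag k (.natEq (rd (ar 8 k)) (.const 0)))
  | .and φ ψ, k => .seq (φ.compile k) (.seq (ψ.compile (k + 1)) (flag k
      (.and (.natEq (rd (ar 8 k)) (.const 1)) (.natEq (rd (ar 8 (k + 1))) (.const 1)))))
  | .ex v φ, k => .seq (fill v k (φ.compile (k + 1))) (anyCell k)
  | .conn v φ x y, k => .seq (fill v k (φ.compile (k + 1))) (.seq (reach k x)
      (.setNat (ar 8 k) (.const 0) (.read (ar 11 k) (rd (ar 1 y)))))

theorem Formula.fSpec (φ : Formula) : ∀ k, FSpec φ (φ.compile k) k := by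
  induction φ with
  | adj x y => exact fSpec_adj x y
  | eq x y => exact fSpec_eq x y
  | mem x b => exact fSpec_mem x b
  | lighter b b' => exact fSpec_lighter b b'
  | not φ ih => exact fun k => fSpec_not (ih k)
  | and φ ψ ih ih' => exact fun k => fSpec_and (ih k) (ih' (k + 1))
  | ex v φ ih => exact fun k => fSpec_ex (ih (k + 1)) v
  | conn v φ x y ih => exact fun k => fSpec_conn (ih (k + 1)) v x y

/-- Copy the array `a`, from the position `e` on, to the set `b`. -/
def copyTo (k b a : ℕ) (e : NatExpr) : Program :=
  forUp (ar 13 k) (.setNat (ar 0 b) (rd (ar 13 k)) (.read a (.add e (rd (ar 13 k)))))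

def Cmd.compile : Cmd → ℕ → Program
  | .skip, _ => .skip
  | .assign b v φ, k => .seq (fill v k (φ.compile (k + 1))) (copyTo k b (ar 10 k) (.const 0))
  | .ite φ c c', k => .seq (φ.compile k)
      (.ite (.natEq (rd (ar 8 k)) (.const 1)) (c.compile k) (c'.compile k))
  | .seq c c', k => .seq (c.compile k) (c'.compile k)
  | .forV v c, k => forVar v k (c.compile (k + 1))
  | .rep c, k => forUp (ar 13 k) (c.compile (k + 1))
  | .rzero p, _ => .setNat (ar 3 p) (.const 0) (.const 0)
  | .rnext p, _ => .setNat (ar 3 p) (.const 0) (.add (rd (ar 3 p)) (rd 0))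
  | .load t p b, k => copyTo k b (ar 2 t) (rd (ar 3 p))
  | .store t p b, k => forUp (ar 13 k) (.setNat (ar 2 t) (.add (rd (ar 3 p)) (rd (ar 13 k)))
      (.read (ar 0 b) (rd (ar 13 k))))

theorem Mem.setSet_setSet {n : ℕ} (σ : Mem n) (b : ℕ) (S T : Set (Fin n)) :
    (σ.setSet b S).setSet b T = σ.setSet b T := by simp [Mem.setSet]

theorem Mem.setTab_setTab {n : ℕ} (σ : Mem n) (t r : ℕ) (S T : Set (Fin n)) :
    (σ.setTab t r S).setTab t r T = σ.setTab t r T := by simp [Mem.setTab]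

/-- After `m` steps the target agrees with `S` below `m` and with its old contents from `m` on. The
predicate `J` carries what is known about the source through these writes. -/
theorem exec_copyTo {n : ℕ} {G : SimpleGraph (Fin n)} {w : Fin n → ℝ} {ρ : ℕ → Fin n} {σ : Mem n}
    {s : State} {k b a : ℕ} {e : NatExpr} {S : Set (Fin n)} (h : Rep G w ρ σ s)
    (he : e.cost ≤ 10) (J : State → Prop) (hJ : J s)
    (hJc : ∀ s x, J s → J (s.setNat (ar 13 k) 0 x))
    (hJb : ∀ s i x, J s → J (s.setNat (ar 0 b) i x))
    (hS : ∀ σ' s', Rep G w ρ σ' s' → σ'.ptr = σ.ptr → σ'.tab = σ.tab → J s' →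
      ∀ i : Fin n, s'.nat a (e.eval s' + i) = ind (i ∈ S)) :
    Exec (copyTo k b a e) s (n * (30 + 15) + 15) fun s' =>
      Rep G w ρ (σ.setSet b S) s' ∧ Keep k s s' := by
  have hfull : ∀ T : Set (Fin n), σ.setSet b {i | ((i : ℕ) < n ∧ i ∈ T) ∨
      (n ≤ (i : ℕ) ∧ i ∈ σ.set b)} = σ.setSet b T := by
    intro T
    congr 1
    ext i
    have := i.2
    simp only [Set.mem_ofPred_eq]
    constructor
    · rintro (h | h)
      exacts [h.2, by omega]
    · exact fun h => .inl ⟨this, h⟩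
  rw [← hfull]
  refine (exec_forScratch (n := n) (J := fun m s' => Rep G w ρ (σ.setSet b
    {i | ((i : ℕ) < m ∧ i ∈ S) ∨ (m ≤ (i : ℕ) ∧ i ∈ σ.set b)}) s' ∧ Keep k s s' ∧ J s')
    ?_ ?_ ?_ ?_).weaken le_rfl fun s' h => ⟨h.1, h.2.1⟩
  · refine ⟨?_, .refl k s, hJ⟩
    have : σ.setSet b {i | ((i : ℕ) < 0 ∧ i ∈ S) ∨ (0 ≤ (i : ℕ) ∧ i ∈ σ.set b)} = σ := by
      simp [Mem.setSet]
    rwa [this]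
  · exact fun _ _ h => h.1.size
  · rintro i s1 x ⟨h1, h2, h3⟩
    exact ⟨h1.scratch _ _ _ _ (by omega) (by omega), h2.scratch _ _ _ _ (by omega) le_rfl,
      hJc _ _ h3⟩
  · rintro i s1 ⟨h1, h2, h3⟩ hi
    refine Exec.setNat ?_ (by simp only [NatExpr.cost]; omega)
    simp only [NatExpr.eval, hi]
    refine ⟨?_, ?_, h2.data _ _ _ _ (by omega), hJb _ _ _ h3⟩
    · rw [State.setNat_nat_ne _ _ _ (by unfold ar; omega)]
      exact hi
    · rw [hS _ _ h1 rfl rfl h3, ← Mem.setSet_setSet]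
      refine h1.setSetCell b i ?_ ?_
      · simp
      · intro j hj
        have : (j : ℕ) ≠ i := fun h => hj (Fin.ext h)
        simp only [Mem.setSet, Function.update_self, Set.mem_ofPred_eq]
        have h1 : (j : ℕ) < i + 1 ↔ (j : ℕ) < i := by omega
        have h2 : (i : ℕ) + 1 ≤ j ↔ (i : ℕ) ≤ j := by omega
        rw [h1, h2]

theorem Cmd.cSpec (d : Cmd) : ∀ k, CSpec d (d.compile k) k := by
  induction d with
  | skip => exact fun k => ⟨_, .const 1, fun G w ρ σ s h => Exec.skip ⟨h, .refl k s⟩ le_rfl⟩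
  | assign b v φ =>
    intro k
    obtain ⟨c, hc, hP⟩ := exec_fill (φ.fSpec (k + 1)) v
    refine ⟨_, hc.add (PolyBounded.loop (.const 30) 15 15), fun {n} G w ρ σ s h => ?_⟩
    refine Exec.seq ((hP G w ρ σ s h).weaken le_rfl ?_)
    rintro s1 ⟨h1, hk1, hf1⟩
    refine (exec_copyTo (S := {a | φ.Holds G w (Function.update ρ v a) σ}) h1
      (by simp [NatExpr.cost]) (fun s => ∀ i : Fin n, s.nat (ar 10 k) i =
        ind (φ.Holds G w (Function.update ρ v i) σ)) hf1 ?_ ?_ ?_).weaken le_rfl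
      fun s' h' => ⟨h'.1, hk1.trans h'.2⟩
    · intro s x h
      rwa [State.setNat_nat_ne _ _ _ (by unfold ar; omega)]
    · intro s i x h
      rwa [State.setNat_nat_ne _ _ _ (by unfold ar; omega)]
    · intro σ' s' _ _ _ h i
      simpa [NatExpr.eval] using h i
  | ite φ c c' ih ih' =>
    intro k
    obtain ⟨e, he, hφ⟩ := φ.fSpec k
    obtain ⟨a, ha, hc⟩ := ih k
    obtain ⟨a', ha', hc'⟩ := ih' k
    refine ⟨_, he.add ((PolyBounded.const 10).add (ha.add ha')), fun {n} G w ρ σ s h => ?_⟩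
    refine Exec.seq ((hφ G w ρ σ s h).weaken le_rfl ?_)
    rintro s1 ⟨h1, hk1, hf1⟩
    have hiff : Test.Holds s1 (.natEq (rd (ar 8 k)) (.const 1)) ↔ φ.Holds G w ρ σ := by
      simp only [Test.Holds, NatExpr.eval, hf1, ind_eq_one]
    refine Exec.ite (c := a n + a' n) (fun hb => ?_) (fun hb => ?_)
      (by simp [Test.cost, NatExpr.cost])
    · rw [hiff] at hb
      simp only [Cmd.exec, hb, if_true]
      exact (hc G w ρ σ s1 h1).weaken (by omega) fun s2 h2 => ⟨h2.1, hk1.trans h2.2⟩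
    · rw [hiff] at hb
      simp only [Cmd.exec, hb, if_false]
      exact (hc' G w ρ σ s1 h1).weaken (by omega) fun s2 h2 => ⟨h2.1, hk1.trans h2.2⟩
  | seq c c' ih ih' =>
    intro k
    obtain ⟨a, ha, hc⟩ := ih k
    obtain ⟨a', ha', hc'⟩ := ih' k
    refine ⟨_, ha.add ha', fun {n} G w ρ σ s h => ?_⟩
    refine Exec.seq ((hc G w ρ σ s h).weaken le_rfl ?_)
    rintro s1 ⟨h1, hk1⟩
    exact (hc' G w ρ _ s1 h1).weaken le_rfl fun s2 h2 => ⟨h2.1, hk1.trans h2.2⟩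
  | forV v c ih =>
    intro k
    obtain ⟨a, ha, hc⟩ := ih (k + 1)
    refine ⟨_, PolyBounded.loop ha 15 30, fun {n} G w ρ σ s h => ?_⟩
    have hl : ((List.finRange n).take n) = List.finRange n :=
      List.take_of_length_le (by simp)
    have := exec_forVar (v := v) (k := k) (P := c.compile (k + 1)) (c := a n) (s := s)
      (J := fun _ _ => True) (w := w) (G := G) (ρ := ρ) (τ := fun i => ((List.finRange n).take i).foldl
      (fun σ a => c.exec G w (Function.update ρ v a) σ) σ) (by simpa using h) (by simp) (by simp) ?_
    · rw [hl] at this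
      exact this.weaken le_rfl fun s' h => ⟨h.1, h.2.1⟩
    · intro i s1 h1 _
      refine (hc G w _ _ s1 h1).weaken le_rfl ?_
      rintro s2 ⟨h2, hk2⟩
      refine ⟨?_, hk2.mono (Nat.le_succ k), ?_, trivial⟩
      · have ht : (List.finRange n).take (i + 1) = (List.finRange n).take i ++ [i] := by
          rw [List.take_add_one]
          simp
        rw [ht, List.foldl_append]
        exact h2
      · rw [hk2 9 k (by omega) (by omega) (by omega)]
  | rep c ih =>
    intro k
    obtain ⟨a, ha, hc⟩ := ih (k + 1)
    refine ⟨_, PolyBounded.loop ha 15 15, fun {n} G w ρ σ s h => ?_⟩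
    refine exec_forScratch (n := n) (J := fun m s' => Rep G w ρ ((c.exec G w ρ)^[m] σ) s' ∧
      Keep k s s') ⟨h, .refl k s⟩ (fun _ _ h => h.1.size) ?_ ?_
    · rintro i s1 x ⟨h1, h2⟩
      exact ⟨h1.scratch _ _ _ _ (by omega) (by omega), h2.scratch _ _ _ _ (by omega) le_rfl⟩
    · rintro i s1 ⟨h1, h2⟩ hi
      refine (hc G w _ _ s1 h1).weaken le_rfl ?_
      rintro s2 ⟨h3, hk⟩
      rw [Function.iterate_succ_apply']
      refine ⟨?_, h3, h2.trans (hk.mono (Nat.le_succ k))⟩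
      rw [hk 13 k (by omega) (by omega) (by omega), hi]
  | rzero p =>
    refine fun k => ⟨_, .const 10, fun {n} G w ρ σ s h => Exec.setNat ?_ (by simp [NatExpr.cost])⟩
    refine ⟨?_, (Keep.refl k s).data _ _ _ _ (by omega)⟩
    simpa [Cmd.exec, NatExpr.eval] using h.setPtr p 0
  | rnext p =>
    refine fun k => ⟨_, .const 10, fun {n} G w ρ σ s h => Exec.setNat ?_ (by simp [NatExpr.cost])⟩
    refine ⟨?_, (Keep.refl k s).data _ _ _ _ (by omega)⟩
    simpa [Cmd.exec, NatExpr.eval, h.ptr, h.size, Nat.succ_mul] using h.setPtr p (σ.ptr p + 1)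
  | load t p b =>
    refine fun k => ⟨_, PolyBounded.loop (.const 30) 15 15, fun {n} G w ρ σ s h => ?_⟩
    refine exec_copyTo h (by simp [NatExpr.cost]) (fun _ => True) trivial (by simp) (by simp) ?_
    intro σ' s' h' hp ht _ i
    simp only [NatExpr.eval, h'.ptr, hp]
    rw [h'.tab, ht]
  | store t p b =>
    refine fun k => ⟨_, PolyBounded.loop (.const 30) 15 15, fun {n} G w ρ σ s h => ?_⟩
    have hfull : σ.setTab t (σ.ptr p) {i | ((i : ℕ) < n ∧ i ∈ σ.set b) ∨
        (n ≤ (i : ℕ) ∧ i ∈ σ.tab t (σ.ptr p))} = σ.setTab t (σ.ptr p) (σ.set b) := by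
      congr 1
      ext i
      have := i.2
      simp only [Set.mem_ofPred_eq]
      constructor
      · rintro (h | h)
        exacts [h.2, by omega]
      · exact fun h => .inl ⟨this, h⟩
    simp only [Cmd.exec]
    rw [← hfull]
    refine exec_forScratch (n := n) (J := fun m s' => Rep G w ρ (σ.setTab t (σ.ptr p)
      {i | ((i : ℕ) < m ∧ i ∈ σ.set b) ∨ (m ≤ (i : ℕ) ∧ i ∈ σ.tab t (σ.ptr p))}) s' ∧ Keep k s s')
      ?_ ?_ ?_ ?_
    · refine ⟨?_, .refl k s⟩
      have : σ.setTab t (σ.ptr p) {i | ((i : ℕ) < 0 ∧ i ∈ σ.set b) ∨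
          (0 ≤ (i : ℕ) ∧ i ∈ σ.tab t (σ.ptr p))} = σ := by
        simp [Mem.setTab]
      rwa [this]
    · exact fun _ _ h => h.1.size
    · rintro i s1 x ⟨h1, h2⟩
      exact ⟨h1.scratch _ _ _ _ (by omega) (by omega), h2.scratch _ _ _ _ (by omega) le_rfl⟩
    · rintro i s1 ⟨h1, h2⟩ hi
      refine Exec.setNat ?_ (by simp [NatExpr.cost])
      simp only [NatExpr.eval, hi, h1.ptr, h1.set]
      refine ⟨?_, ?_, h2.data _ _ _ _ (by omega)⟩
      · rw [State.setNat_nat_ne _ _ _ (by unfold ar; omega)]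
        exact hi
      · rw [← Mem.setTab_setTab]
        refine h1.setTabCell t _ i ?_ ?_
        · simp [Mem.setTab]
        · intro j hj
          have : (j : ℕ) ≠ i := fun h => hj (Fin.ext h)
          simp only [Mem.setTab, Function.update_self, Set.mem_ofPred_eq]
          have h1 : (j : ℕ) < i + 1 ↔ (j : ℕ) < i := by omega
          have h2 : (i : ℕ) + 1 ≤ j ↔ (i : ℕ) ≤ j := by omega
          rw [h1, h2]

end Compilation

end SetProg

namespace SetProg

/-! ### Reasoning about loops of commands. -/

section Control

variable {n : ℕ} {G : SimpleGraph (Fin n)} {w : Fin n → ℝ} {ρ : ℕ → Fin n} {σ σ' σ'' : Mem n}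

theorem forV_induct {I : Mem n → Prop} {v : ℕ} {c : Cmd}
    (h : ∀ a σ, I σ → I (c.exec G w (Function.update ρ v a) σ)) (hσ : I σ) :
    I ((Cmd.forV v c).exec G w ρ σ) := by
  rw [Cmd.exec]
  induction List.finRange n generalizing σ with
  | nil => exact hσ
  | cons a l ih => exact ih (h a σ hσ)

/-- What one pass of a loop establishes holds at the end if the other passes preserve it. -/
theorem forV_reach {I Q : Mem n → Prop} {v : ℕ} {c : Cmd} (a : Fin n)
    (h : ∀ a σ, I σ → I (c.exec G w (Function.update ρ v a) σ))
    (h1 : ∀ σ, I σ → Q (c.exec G w (Function.update ρ v a) σ))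
    (h2 : ∀ a σ, I σ → Q σ → Q (c.exec G w (Function.update ρ v a) σ)) (hσ : I σ) :
    Q ((Cmd.forV v c).exec G w ρ σ) := by
  rw [Cmd.exec]
  have hQ : ∀ (l : List (Fin n)) σ, I σ → Q σ →
      Q (l.foldl (fun σ a => c.exec G w (Function.update ρ v a) σ) σ) := by
    intro l
    induction l with
    | nil => exact fun _ _ h => h
    | cons b l ih => exact fun σ hI hQ => ih _ (h b σ hI) (h2 b σ hI hQ)
  have ha := List.mem_finRange a
  generalize List.finRange n = l at ha ⊢
  induction l generalizing σ with
  | nil => simp at ha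
  | cons b l ih =>
    rcases List.mem_cons.1 ha with rfl | ha
    · exact hQ l _ (h a σ hσ) (h1 σ hσ)
    · exact ih (h b σ hσ) ha

/-- Nine nested loops. -/
def rep9 (c : Cmd) : Cmd := .rep (.rep (.rep (.rep (.rep (.rep (.rep (.rep (.rep c))))))))

theorem exec_rep9 (c : Cmd) : (rep9 c).exec G w ρ = (c.exec G w ρ)^[n ^ 9] := by
  have h : ∀ c : Cmd, (Cmd.rep c).exec G w ρ = (c.exec G w ρ)^[n] := fun c => rfl
  rw [rep9]
  simp only [h, ← Function.iterate_mul]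
  congr 1
  ring

/-- Run `c` for the rows `0, …, 4 * n ^ 9 - 1` as values of the index `p`. -/
def forRows (p : ℕ) (c : Cmd) : Cmd :=
  .seq (.rzero p) (rep9 (.seq (.seq (.seq c (.rnext p)) (.seq c (.rnext p)))
    (.seq (.seq c (.rnext p)) (.seq c (.rnext p)))))

theorem forRows_induct {I : ℕ → Mem n → Prop} {p : ℕ} {c : Cmd}
    (h0 : I 0 (σ.setPtr p 0))
    (h : ∀ r < 4 * n ^ 9, ∀ σ, σ.ptr p = r → I r σ → (c.exec G w ρ σ).ptr p = r ∧
      I (r + 1) ((c.exec G w ρ σ).setPtr p (r + 1))) :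
    I (4 * n ^ 9) ((forRows p c).exec G w ρ σ) := by
  have he : (forRows p c).exec G w ρ σ =
      ((Cmd.seq c (.rnext p)).exec G w ρ)^[4 * n ^ 9] (σ.setPtr p 0) := by
    rw [forRows, Cmd.exec, exec_rep9, Function.iterate_mul]
    rfl
  rw [he]
  have key : ∀ r ≤ 4 * n ^ 9, I r (((Cmd.seq c (.rnext p)).exec G w ρ)^[r] (σ.setPtr p 0)) ∧
      (((Cmd.seq c (.rnext p)).exec G w ρ)^[r] (σ.setPtr p 0)).ptr p = r := by
    intro r hr
    induction r with
    | zero => exact ⟨h0, by simp [Mem.setPtr]⟩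
    | succ r ih =>
      obtain ⟨h1, h2⟩ := ih (by omega)
      obtain ⟨h3, h4⟩ := h r (by omega) _ h2 h1
      have hstep : ∀ τ, (Cmd.seq c (.rnext p)).exec G w ρ τ =
          (c.exec G w ρ τ).setPtr p ((c.exec G w ρ τ).ptr p + 1) := fun _ => rfl
      rw [Function.iterate_succ_apply', hstep, h3]
      exact ⟨h4, by simp [Mem.setPtr]⟩
  exact (key _ le_rfl).1

/-- Disjunction. -/
def Formula.or (φ ψ : Formula) : Formula := .not (.and (.not φ) (.not ψ))

@[simp] theorem holds_or {φ ψ : Formula} :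
    (φ.or ψ).Holds G w ρ σ ↔ φ.Holds G w ρ σ ∨ ψ.Holds G w ρ σ := by
  simp only [Formula.or, Formula.Holds]
  tauto

end Control

/-! ### Appending rows to the tables. -/

section Rows

variable {n : ℕ} {G : SimpleGraph (Fin n)} {w : Fin n → ℝ} {ρ : ℕ → Fin n} {σ σ' σ'' : Mem n}
  {m m' : ℕ}

/-- The row `r` of the tables: a set of vertices and an independent set in it. -/
def SoundRow (G : SimpleGraph (Fin n)) (σ : Mem n) (r : ℕ) : Prop :=
  σ.tab 2 r ⊆ σ.tab 0 r ∧ G.IsIndepSet (σ.tab 2 r)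

/-- `m` rows have been appended to the tables. -/
structure Appends (G : SimpleGraph (Fin n)) (m : ℕ) (σ σ' : Mem n) : Prop where
  ptr : σ'.ptr 0 = σ.ptr 0 + m
  tab : ∀ t, ∀ r < σ.ptr 0, σ'.tab t r = σ.tab t r
  sound : ∀ r, σ.ptr 0 ≤ r → r < σ'.ptr 0 → SoundRow G σ' r

/-- There is a row with the given entries. -/
def HasRow (X : ℕ → Set (Fin n)) (σ : Mem n) : Prop :=
  ∃ r < σ.ptr 0, ∀ t < 3, σ.tab t r = X t

theorem Appends.hasRow {X : ℕ → Set (Fin n)} (h : Appends G m σ σ') (hX : HasRow X σ) :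
    HasRow X σ' := by
  obtain ⟨r, hr, hX⟩ := hX
  exact ⟨r, by rw [h.ptr]; omega, fun t ht => (h.tab t r hr).trans (hX t ht)⟩

theorem Appends.trans (h : Appends G m σ σ') (h' : Appends G m' σ' σ'') :
    Appends G (m + m') σ σ'' where
  ptr := by rw [h'.ptr, h.ptr]; omega
  tab t r hr := by rw [h'.tab t r (by rw [h.ptr]; omega), h.tab t r hr]
  sound r hr hr' := by
    by_cases hlt : r < σ'.ptr 0
    · have := h.sound r hr hlt
      rwa [SoundRow, ← h'.tab 2 r hlt, ← h'.tab 0 r hlt] at this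
    · exact h'.sound r (by omega) hr'

theorem Appends.of_eq (h1 : σ'.ptr 0 = σ.ptr 0) (h2 : σ'.tab = σ.tab) : Appends G 0 σ σ' where
  ptr := h1
  tab t r _ := by rw [h2]
  sound r hr hr' := by omega

theorem appends_forV {v : ℕ} {c : Cmd}
    (h : ∀ a σ, Appends G m σ (c.exec G w (Function.update ρ v a) σ)) :
    Appends G (n * m) σ ((Cmd.forV v c).exec G w ρ σ) := by
  rw [Cmd.exec]
  have : ∀ (l : List (Fin n)) σ, Appends G (l.length * m) σ
      (l.foldl (fun σ a => c.exec G w (Function.update ρ v a) σ) σ) := by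
    intro l
    induction l with
    | nil => exact fun σ => by simpa using Appends.of_eq rfl rfl
    | cons a l ih =>
      intro σ
      have := (h a σ).trans (ih _)
      rwa [Nat.add_comm, ← Nat.succ_mul] at this
  simpa using this (List.finRange n) σ

theorem appends_iterate {c : Cmd} (h : ∀ σ, Appends G m σ (c.exec G w ρ σ)) (k : ℕ) :
    Appends G (k * m) σ ((c.exec G w ρ)^[k] σ) := by
  induction k with
  | zero => simpa using Appends.of_eq rfl rfl
  | succ k ih =>
    rw [Function.iterate_succ_apply', Nat.succ_mul]
    exact ih.trans (h _)

/-- Append a row given by three formulas in the variable `10`. -/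
def emit (φ ψ χ : Formula) : Cmd :=
  .seq (.assign 6 10 φ) (.seq (.assign 7 10 ψ) (.seq (.assign 8 10 χ)
    (.seq (.store 0 0 6) (.seq (.store 1 0 7) (.seq (.store 2 0 8) (.rnext 0))))))

/-- The second and third formulas may refer to the sets `6` and `7`, which have been assigned by the
time they are evaluated. -/
theorem exec_emit {φ ψ χ : Formula} {C K T : Set (Fin n)}
    (hC : ∀ a, φ.Holds G w (Function.update ρ 10 a) σ ↔ a ∈ C)
    (hK : ∀ a, ψ.Holds G w (Function.update ρ 10 a) (σ.setSet 6 C) ↔ a ∈ K)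
    (hT : ∀ a, χ.Holds G w (Function.update ρ 10 a) ((σ.setSet 6 C).setSet 7 K) ↔ a ∈ T)
    (hs : T ⊆ C) (hi : G.IsIndepSet T) :
    Appends G 1 σ ((emit φ ψ χ).exec G w ρ σ) ∧
      HasRow (fun t => if t = 0 then C else if t = 1 then K else T)
        ((emit φ ψ χ).exec G w ρ σ) ∧
      ∀ b, b < 6 ∨ 8 < b → ((emit φ ψ χ).exec G w ρ σ).set b = σ.set b := by
  have hC' : {a | φ.Holds G w (Function.update ρ 10 a) σ} = C := Set.ext hC
  have hK' : {a | ψ.Holds G w (Function.update ρ 10 a) (σ.setSet 6 C)} = K := Set.ext hK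
  have hT' : {a | χ.Holds G w (Function.update ρ 10 a) ((σ.setSet 6 C).setSet 7 K)} = T :=
    Set.ext hT
  simp only [emit, Cmd.exec, hC', hK', hT']
  refine ⟨⟨by simp [Mem.setPtr, Mem.setSet, Mem.setTab], ?_, ?_⟩, ⟨σ.ptr 0, ?_, ?_⟩, ?_⟩
  · intro t r hr
    have hr' : r ≠ σ.ptr 0 := by omega
    simp only [Mem.setPtr, Mem.setSet, Mem.setTab, Function.update_apply]
    split_ifs <;> simp_all
  · intro r hr hr'
    have : r = σ.ptr 0 := by
      simp [Mem.setPtr, Mem.setSet, Mem.setTab] at hr'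
      omega
    subst this
    simp only [SoundRow, Mem.setPtr, Mem.setSet, Mem.setTab, Function.update_apply]
    simpa using ⟨hs, hi⟩
  · simp [Mem.setPtr, Mem.setSet, Mem.setTab]
  · intro t ht
    simp only [Mem.setPtr, Mem.setSet, Mem.setTab, Function.update_apply]
    interval_cases t <;> simp
  · intro b hb
    have h6 : b ≠ 6 := by omega
    have h7 : b ≠ 7 := by omega
    have h8 : b ≠ 8 := by omega
    simp [Mem.setPtr, Mem.setSet, Mem.setTab, h6, h7, h8]

end Rows

/-! ### Enumerating all rows and cuts. -/

section Generation

open Burling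

variable {n : ℕ} {G : SimpleGraph (Fin n)} {w : Fin n → ℝ} {ρ : ℕ → Fin n} {σ σ' σ'' : Mem n}

/-- `v` is in the closed neighbourhood of `z`. -/
def clF (v z : ℕ) : Formula := .or (.eq v z) (.adj v z)

/-- `v` is in the current level of the peeling. -/
def levF (v : ℕ) : Formula := .and (.mem v 2) (.not (.mem v 3))

def falseF : Formula := .not (.eq 10 10)

/-- Conventions: the variables `0` to `5` hold `a, z, f, c, x, y`, the variables `7` and `8` hold
`e` and `g`, and `10` is the vertex in question. The sets `1` to `5` hold the gate, the starting
set, the deleted vertices, the block and the selection; `9` is kept empty. -/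
def gateF : Formula :=
  .and (.adj 10 1) (.or (.eq 0 1) (.ex 11 (.and (.conn 20 (.not (clF 20 1)) 0 11) (.adj 10 11))))

def blkF : Formula :=
  .and (levF 10) (.not (.ex 11 (.and (.not (.eq 11 10))
    (.and (.not (.conn 20 (.and (levF 20) (.not (.eq 20 11))) 10 4))
      (.not (.conn 20 (.and (levF 20) (.not (.eq 20 11))) 10 5))))))

def selF : Formula :=
  .and (.mem 10 4) (.and (.not (.adj 3 10))
    (.not (.ex 11 (.and (.conn 20 (.not (clF 20 10)) 3 11) (.mem 11 4)))))

theorem holds_clF {v z : ℕ} : (clF v z).Holds G w ρ σ ↔ ρ v ∈ cl G (ρ z) := holds_or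

theorem holds_levF {v : ℕ} : (levF v).Holds G w ρ σ ↔ ρ v ∈ σ.set 2 \ σ.set 3 := Iff.rfl

theorem holds_gateF : gateF.Holds G w ρ σ ↔ ρ 10 ∈ gate G (ρ 0) (ρ 1) := by
  simp only [gateF, Formula.Holds, holds_or, holds_clF]
  simp
  rfl

theorem holds_blkF :
    blkF.Holds G w ρ σ ↔ ρ 10 ∈ blk G (σ.set 2 \ σ.set 3) (ρ 4) (ρ 5) := by
  simp only [blkF, Formula.Holds, holds_levF]
  simp [-Set.mem_sdiff, ← or_iff_not_imp_left]
  exact and_congr_right fun _ => forall_congr' fun x => or_iff_not_imp_left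

theorem holds_selF : selF.Holds G w ρ σ ↔ ρ 10 ∈ sel G (ρ 3) (σ.set 4) := by
  simp only [selF, Formula.Holds, holds_clF]
  simp
  rfl

/-- The four rows for given vertices `7` and `8`. -/
def emitRows : Cmd :=
  .seq (emit (.conn 20 (.and (levF 20) (.not (.eq 20 7))) 8 10) (.eq 10 7) falseF)
  (.seq (emit (.conn 20 (.and (levF 20) (.not (clF 20 7))) 8 10) (.adj 10 7) falseF)
  (.seq (emit (.eq 10 8) (.mem 10 1) (.and (.eq 10 8) (.lighter 9 6)))
    (emit (.conn 20 (levF 20) 8 10) (.mem 10 5) falseF)))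

/-- One round of peeling. -/
def peelRound : Cmd :=
  .seq (.assign 4 10 blkF) (.seq (.assign 5 10 selF)
    (.seq (.forV 7 (.forV 8 emitRows)) (.assign 3 10 (.or (.mem 10 3) (.mem 10 5)))))

def peeling : Cmd :=
  .seq (.assign 1 10 gateF) (.seq (.assign 2 10 (.conn 20 (.not (.mem 20 1)) 2 10))
    (.seq (.assign 3 10 falseF) (.seq (.assign 9 10 falseF) (.rep peelRound))))

/-- Fill the tables. -/
def generate : Cmd :=
  .forV 0 (.forV 1 (.forV 2 (.forV 3 (.forV 4 (.forV 5 peeling)))))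

/-- The sets that a round of peeling reads. -/
structure Level (Q F L : Set (Fin n)) (σ : Mem n) : Prop where
  gate : σ.set 1 = Q
  start : σ.set 2 = F
  del : σ.set 3 = L
  empty : σ.set 9 = ∅

theorem weight_empty : weight w ∅ = 0 := by simp [weight]

theorem weight_singleton (g : Fin n) : weight w {g} = w g := by
  simp [weight]

theorem isIndepSet_of_subset_singleton {T : Set (Fin n)} {g : Fin n} (h : T ⊆ {g}) :
    G.IsIndepSet T := fun _ ha _ hb hab => (hab ((h ha).trans (h hb).symm)).elim

/-- The rows that `emitRows` appends, numbered by `j`. -/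
def rowOf (G : SimpleGraph (Fin n)) (w : Fin n → ℝ) (Q Y S : Set (Fin n)) (e g : Fin n) (j : ℕ) :
    ℕ → Set (Fin n) :=
  if j = 0 then fun t => if t = 0 then comp G (Y \ {e}) g else if t = 1 then {e} else ∅
  else if j = 1 then fun t => if t = 0 then comp G (Y \ cl G e) g else if t = 1 then nb G e else ∅
  else if j = 2 then fun t => if t = 0 then {g} else if t = 1 then Q else {v | v = g ∧ 0 < w g}
  else fun t => if t = 0 then comp G Y g else if t = 1 then S else ∅

/-- The third row compares the empty set `9` with the set `6`, which is `{g}` at that time, so its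
initial solution is `{g}` exactly if the weight of `g` is positive. The other rows start with the
empty solution. -/
theorem exec_emitRows (ρ : ℕ → Fin n) (σ : Mem n) :
    Appends G 4 σ (emitRows.exec G w ρ σ) ∧
    (∀ b, b < 6 ∨ 8 < b → (emitRows.exec G w ρ σ).set b = σ.set b) ∧
    (σ.set 9 = ∅ → ∀ j < 4, HasRow
      (rowOf G w (σ.set 1) (σ.set 2 \ σ.set 3) (σ.set 5) (ρ 7) (ρ 8) j)
      (emitRows.exec G w ρ σ)) := by
  have e1 := fun σ : Mem n => exec_emit (G := G) (w := w) (ρ := ρ) (σ := σ)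
    (φ := .conn 20 (.and (levF 20) (.not (.eq 20 7))) 8 10) (ψ := .eq 10 7) (χ := falseF)
    (C := comp G ((σ.set 2 \ σ.set 3) \ {ρ 7}) (ρ 8)) (K := {ρ 7}) (T := ∅)
    (fun a => by simp [Formula.Holds, levF, mem_comp]; rfl) (fun a => by simp [Formula.Holds])
    (fun a => by simp [Formula.Holds, falseF]) (by simp) (by simp)
  have e2 := fun σ : Mem n => exec_emit (G := G) (w := w) (ρ := ρ) (σ := σ)
    (φ := .conn 20 (.and (levF 20) (.not (clF 20 7))) 8 10) (ψ := .adj 10 7) (χ := falseF)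
    (C := comp G ((σ.set 2 \ σ.set 3) \ cl G (ρ 7)) (ρ 8)) (K := nb G (ρ 7)) (T := ∅)
    (fun a => by simp [Formula.Holds, levF, holds_clF, mem_comp]; rfl)
    (fun a => by simp [Formula.Holds, nb])
    (fun a => by simp [Formula.Holds, falseF]) (by simp) (by simp)
  have e3 := fun σ : Mem n => exec_emit (G := G) (w := w) (ρ := ρ) (σ := σ)
    (φ := .eq 10 8) (ψ := .mem 10 1) (χ := .and (.eq 10 8) (.lighter 9 6))
    (C := {ρ 8}) (K := σ.set 1) (T := {v | v = ρ 8 ∧ weight w (σ.set 9) < weight w {ρ 8}})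
    (fun a => by simp [Formula.Holds])
    (fun a => by simp [Formula.Holds, Mem.setSet])
    (fun a => by simp [Formula.Holds, Mem.setSet]) (fun v hv => hv.1)
    (isIndepSet_of_subset_singleton (g := ρ 8) fun v hv => hv.1)
  have e4 := fun σ : Mem n => exec_emit (G := G) (w := w) (ρ := ρ) (σ := σ)
    (φ := .conn 20 (levF 20) 8 10) (ψ := .mem 10 5) (χ := falseF)
    (C := comp G (σ.set 2 \ σ.set 3) (ρ 8)) (K := σ.set 5) (T := ∅)
    (fun a => by simp [Formula.Holds, levF, mem_comp]; rfl)
    (fun a => by simp [Formula.Holds, Mem.setSet])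
    (fun a => by simp [Formula.Holds, falseF]) (by simp) (by simp)
  obtain ⟨a1, b1, c1⟩ := e1 σ
  obtain ⟨a2, b2, c2⟩ := e2 ((emit (.conn 20 (.and (levF 20) (.not (.eq 20 7))) 8 10) (.eq 10 7)
    falseF).exec G w ρ σ)
  obtain ⟨a3, b3, c3⟩ := e3 ((emit (.conn 20 (.and (levF 20) (.not (clF 20 7))) 8 10) (.adj 10 7)
    falseF).exec G w ρ ((emit (.conn 20 (.and (levF 20) (.not (.eq 20 7))) 8 10) (.eq 10 7)
    falseF).exec G w ρ σ))
  obtain ⟨a4, b4, c4⟩ := e4 ((emit (.eq 10 8) (.mem 10 1) (.and (.eq 10 8) (.lighter 9 6))).exec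
    G w ρ ((emit (.conn 20 (.and (levF 20) (.not (clF 20 7))) 8 10) (.adj 10 7)
    falseF).exec G w ρ ((emit (.conn 20 (.and (levF 20) (.not (.eq 20 7))) 8 10) (.eq 10 7)
    falseF).exec G w ρ σ)))
  have he : emitRows.exec G w ρ σ = (emit (.conn 20 (levF 20) 8 10) (.mem 10 5) falseF).exec G w ρ
    ((emit (.eq 10 8) (.mem 10 1) (.and (.eq 10 8) (.lighter 9 6))).exec
    G w ρ ((emit (.conn 20 (.and (levF 20) (.not (clF 20 7))) 8 10) (.adj 10 7)
    falseF).exec G w ρ ((emit (.conn 20 (.and (levF 20) (.not (.eq 20 7))) 8 10) (.eq 10 7)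
    falseF).exec G w ρ σ))) := rfl
  rw [← he] at a4 b4 c4
  refine ⟨((a1.trans a2).trans a3).trans a4, fun b hb => ?_, fun h9 j hj => ?_⟩
  · rw [c4 b hb, c3 b hb, c2 b hb, c1 b hb]
  · rw [c1 2 (by simp), c1 3 (by simp)] at b2
    rw [c2 9 (by simp), c1 9 (by simp), c2 1 (by simp), c1 1 (by simp), h9, weight_empty,
      weight_singleton] at b3
    rw [c3 2 (by simp), c3 3 (by simp), c2 2 (by simp), c2 3 (by simp), c1 2 (by simp),
      c1 3 (by simp), c3 5 (by simp), c2 5 (by simp), c1 5 (by simp)] at b4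
    interval_cases j
    · exact a4.hasRow (a3.hasRow (a2.hasRow b1))
    · exact a4.hasRow (a3.hasRow b2)
    · exact a4.hasRow b3
    · exact b4

theorem Level.of_eq {Q F L : Set (Fin n)} (h : Level Q F L σ)
    (he : ∀ b, b < 4 ∨ 8 < b → σ'.set b = σ.set b) : Level Q F L σ' :=
  ⟨(he 1 (by simp)).trans h.gate, (he 2 (by simp)).trans h.start, (he 3 (by simp)).trans h.del,
    (he 9 (by simp)).trans h.empty⟩

theorem exec_peelRound (ρ : ℕ → Fin n) (σ : Mem n) :
    Appends G (n * (n * 4)) σ (peelRound.exec G w ρ σ) ∧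
    ∀ {Q F : Set (Fin n)} {i : ℕ}, Level Q F (del G F (ρ 3) (ρ 4) (ρ 5) i) σ →
      Level Q F (del G F (ρ 3) (ρ 4) (ρ 5) (i + 1)) (peelRound.exec G w ρ σ) ∧
      ∀ e g, ∀ j < 4, HasRow (rowOf G w Q (lev G F (ρ 3) (ρ 4) (ρ 5) i)
        (sel G (ρ 3) (bl G F (ρ 3) (ρ 4) (ρ 5) i)) e g j) (peelRound.exec G w ρ σ) := by
  have hA : ∀ σ : Mem n, Appends G (n * (n * 4)) σ
      ((Cmd.forV 7 (.forV 8 emitRows)).exec G w ρ σ) := fun σ =>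
    appends_forV fun a σ => appends_forV fun b σ => (exec_emitRows _ σ).1
  have hassign : ∀ (σ : Mem n) (b v : ℕ) (φ : Formula),
      Appends G 0 σ ((Cmd.assign b v φ).exec G w ρ σ) := fun σ b v φ => .of_eq rfl rfl
  refine ⟨?_, fun {Q F i} hL => ?_⟩
  · have := (((hassign σ 4 10 blkF).trans (hassign _ 5 10 selF)).trans (hA _)).trans
      (hassign _ 3 10 (.or (.mem 10 3) (.mem 10 5)))
    simp only [zero_add, add_zero] at this
    exact this
  set B := bl G F (ρ 3) (ρ 4) (ρ 5) i with hB
  set S := sel G (ρ 3) B with hS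
  set σ1 := (Cmd.assign 4 10 blkF).exec G w ρ σ with hσ1
  have h1 : σ1 = σ.setSet 4 B := by
    rw [hσ1, Cmd.exec]
    congr 1
    ext a
    refine holds_blkF.trans ?_
    simp [hL.start, hL.del, hB, bl, lev]
  set σ2 := (Cmd.assign 5 10 selF).exec G w ρ σ1 with hσ2
  have h2 : σ2 = (σ.setSet 4 B).setSet 5 S := by
    rw [hσ2, h1, Cmd.exec]
    congr 1
    ext a
    refine holds_selF.trans ?_
    simp [Mem.setSet, hS]
  have hL2 : Level Q F (del G F (ρ 3) (ρ 4) (ρ 5) i) σ2 ∧ σ2.set 5 = S := by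
    rw [h2]
    refine ⟨hL.of_eq fun b hb => ?_, by simp [Mem.setSet]⟩
    have h4 : b ≠ 4 := by omega
    have h5 : b ≠ 5 := by omega
    simp [Mem.setSet, h4, h5]
  set σ3 := (Cmd.forV 7 (.forV 8 emitRows)).exec G w ρ σ2 with hσ3
  let I : Mem n → Prop := fun σ => Level Q F (del G F (ρ 3) (ρ 4) (ρ 5) i) σ ∧ σ.set 5 = S
  have hI : ∀ ρ' σ', I σ' → I (emitRows.exec G w ρ' σ') := fun ρ' σ' h =>
    ⟨h.1.of_eq fun b hb => (exec_emitRows ρ' σ').2.1 b (by omega),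
      ((exec_emitRows ρ' σ').2.1 5 (by simp)).trans h.2⟩
  have hL3 : I σ3 := forV_induct (fun a σ h => forV_induct (fun b σ h => hI _ σ h) h) hL2
  have hfin : peelRound.exec G w ρ σ =
      (Cmd.assign 3 10 (.or (.mem 10 3) (.mem 10 5))).exec G w ρ σ3 :=
    rfl
  rw [hfin]
  refine ⟨⟨?_, ?_, ?_, ?_⟩, fun e g j hj => (hassign σ3 _ _ _).hasRow ?_⟩
  · simpa [Cmd.exec, Mem.setSet] using hL3.1.gate
  · simpa [Cmd.exec, Mem.setSet] using hL3.1.start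
  · ext a
    simp [Cmd.exec, Mem.setSet, Formula.Holds, hL3.1.del, hL3.2, del, hS, hB, bl, lev]
  · simpa [Cmd.exec, Mem.setSet] using hL3.1.empty
  · refine forV_reach (I := I) (Q := HasRow _) e (fun a σ h => forV_induct (fun b σ h => hI _ σ h) h)
      (fun σ' h => ?_) (fun a σ' h h' => ?_) hL2
    · refine forV_reach (I := I) g (fun b σ h => hI _ σ h) (fun σ' h => ?_) (fun b σ' h h' => ?_) h
      · have := (exec_emitRows (G := G) (w := w) (Function.update (Function.update ρ 7 e) 8 g) σ').2.2
          h.1.empty j hj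
        rw [h.1.gate, h.1.start, h.1.del, h.2] at this
        simpa [lev] using this
      · exact (exec_emitRows _ σ').1.hasRow h'
    · exact (appends_forV fun b σ => (exec_emitRows _ σ).1).hasRow h'

theorem exec_peeling (ρ : ℕ → Fin n) (σ : Mem n) :
    Appends G (n * (n * (n * 4))) σ (peeling.exec G w ρ σ) ∧
    ∀ e g, ∀ i < n, ∀ j < 4, HasRow (rowOf G w (gate G (ρ 0) (ρ 1))
      (lev G (comp G (gate G (ρ 0) (ρ 1))ᶜ (ρ 2)) (ρ 3) (ρ 4) (ρ 5) i)
      (sel G (ρ 3) (bl G (comp G (gate G (ρ 0) (ρ 1))ᶜ (ρ 2)) (ρ 3) (ρ 4) (ρ 5) i)) e g j)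
      (peeling.exec G w ρ σ) := by
  set Q := gate G (ρ 0) (ρ 1) with hQ
  set F := comp G Qᶜ (ρ 2) with hF
  set σ1 := (Cmd.assign 1 10 gateF).exec G w ρ σ with hσ1
  set σ2 := (Cmd.assign 2 10 (.conn 20 (.not (.mem 20 1)) 2 10)).exec G w ρ σ1 with hσ2
  set σ3 := (Cmd.assign 3 10 falseF).exec G w ρ σ2 with hσ3
  set σ4 := (Cmd.assign 9 10 falseF).exec G w ρ σ3 with hσ4
  have he : peeling.exec G w ρ σ = (peelRound.exec G w ρ)^[n] σ4 := rfl
  have h1 : σ1.set 1 = Q := by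
    ext a
    simp [hσ1, Cmd.exec, Mem.setSet, holds_gateF, hQ]
  have h2 : σ2.set 2 = F := by
    ext a
    simp [hσ2, Cmd.exec, Mem.setSet, Formula.Holds, h1, hF, mem_comp]
    rfl
  have h0 : Level Q F (del G F (ρ 3) (ρ 4) (ρ 5) 0) σ4 := by
    refine ⟨?_, ?_, ?_, ?_⟩
    · rw [← h1]
      simp [hσ4, hσ3, hσ2, Cmd.exec, Mem.setSet]
    · rw [← h2]
      simp [hσ4, hσ3, Cmd.exec, Mem.setSet]
    · simp [hσ4, hσ3, Cmd.exec, Mem.setSet, falseF, Formula.Holds, del]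
    · simp [hσ4, Cmd.exec, Mem.setSet, falseF, Formula.Holds]
  have hA4 : Appends G 0 σ σ4 := .of_eq rfl rfl
  rw [he]
  refine ⟨?_, fun e g i hi j hj => ?_⟩
  · have := hA4.trans (appends_iterate (fun σ => (exec_peelRound (G := G) (w := w) ρ σ).1) n)
    simpa using this
  have hlev : ∀ i, Level Q F (del G F (ρ 3) (ρ 4) (ρ 5) i) ((peelRound.exec G w ρ)^[i] σ4) := by
    intro i
    induction i with
    | zero => exact h0
    | succ i ih =>
      rw [Function.iterate_succ_apply']
      exact ((exec_peelRound ρ _).2 ih).1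
  -- The required row is written in round `i`, and the remaining `k` rounds only append.
  obtain ⟨k, hk⟩ := Nat.exists_eq_add_of_lt hi
  have hit : (peelRound.exec G w ρ)^[n] σ4 =
      (peelRound.exec G w ρ)^[k] (peelRound.exec G w ρ ((peelRound.exec G w ρ)^[i] σ4)) := by
    rw [← Function.iterate_succ_apply' (peelRound.exec G w ρ), ← Function.iterate_add_apply]
    congr 1
    omega
  rw [hit]
  exact (appends_iterate (fun σ => (exec_peelRound (G := G) (w := w) ρ σ).1) k).hasRow
    (((exec_peelRound ρ _).2 (hlev i)).2 e g j hj)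

/-- The exponent counts six loops over `a, z, f, c, x, y`, the `n` rounds, and two loops over `e`
and `g`; each innermost pass appends four rows. -/
theorem exec_generate (ρ : ℕ → Fin n) (σ : Mem n) :
    Appends G (4 * n ^ 9) σ (generate.exec G w ρ σ) ∧
    ∀ a z f c x y e g, ∀ i < n, ∀ j < 4, HasRow (rowOf G w (gate G a z)
      (lev G (comp G (gate G a z)ᶜ f) c x y i)
      (sel G c (bl G (comp G (gate G a z)ᶜ f) c x y i)) e g j) (generate.exec G w ρ σ) := by
  have h6 := fun ρ σ => (exec_peeling (G := G) (w := w) ρ σ).1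
  have h5 := fun ρ σ => appends_forV (v := 5) (ρ := ρ) (σ := σ) fun a σ => h6 _ σ
  have h4 := fun ρ σ => appends_forV (v := 4) (ρ := ρ) (σ := σ) fun a σ => h5 _ σ
  have h3 := fun ρ σ => appends_forV (v := 3) (ρ := ρ) (σ := σ) fun a σ => h4 _ σ
  have h2 := fun ρ σ => appends_forV (v := 2) (ρ := ρ) (σ := σ) fun a σ => h3 _ σ
  have h1 := fun ρ σ => appends_forV (v := 1) (ρ := ρ) (σ := σ) fun a σ => h2 _ σ
  have h0 := appends_forV (v := 0) (ρ := ρ) (σ := σ) fun a σ => h1 _ σ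
  refine ⟨?_, fun a z f c x y e g i hi j hj => ?_⟩
  · have hc : n * (n * (n * (n * (n * (n * (n * (n * (n * 4)))))))) = 4 * n ^ 9 := by ring
    exact hc ▸ h0
  · refine forV_reach (I := fun _ => True) a (by simp) (fun σ _ => ?_)
      (fun _ σ _ h => (h1 _ σ).hasRow h) trivial
    refine forV_reach (I := fun _ => True) z (by simp) (fun σ _ => ?_)
      (fun _ σ _ h => (h2 _ σ).hasRow h) trivial
    refine forV_reach (I := fun _ => True) f (by simp) (fun σ _ => ?_)
      (fun _ σ _ h => (h3 _ σ).hasRow h) trivial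
    refine forV_reach (I := fun _ => True) c (by simp) (fun σ _ => ?_)
      (fun _ σ _ h => (h4 _ σ).hasRow h) trivial
    refine forV_reach (I := fun _ => True) x (by simp) (fun σ _ => ?_)
      (fun _ σ _ h => (h5 _ σ).hasRow h) trivial
    refine forV_reach (I := fun _ => True) y (by simp) (fun σ _ => ?_)
      (fun _ σ _ h => (h6 _ σ).hasRow h) trivial
    simpa using (exec_peeling (G := G) (w := w) (Function.update (Function.update
      (Function.update (Function.update (Function.update (Function.update ρ 0 a) 1 z) 2 f) 3 c)
      4 x) 5 y) σ).2 e g i hi j hj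

end Generation

end SetProg

namespace SetProg

open Burling

/-! ### Additivity of weights. -/

section Weight

variable {n : ℕ} {w : Fin n → ℝ} {S T : Set (Fin n)}

theorem weight_union (h : Disjoint S T) : weight w (S ∪ T) = weight w S + weight w T := by
  classical
  simp only [weight, ← Finset.sum_add_distrib]
  refine Finset.sum_congr rfl fun i _ => ?_
  by_cases h1 : i ∈ S
  · simp [h1, Set.disjoint_left.1 h h1]
  · simp [h1]

theorem weight_coe (J : Finset (Fin n)) : weight w (J : Set (Fin n)) = ∑ v ∈ J, w v := by
  classical
  simp [weight, Finset.sum_ite_mem]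

end Weight

/-! ### Dynamic programming over the tables. -/

section DynamicProgram

variable {n : ℕ} {G : SimpleGraph (Fin n)} {w : Fin n → ℝ} {ρ : ℕ → Fin n} {σ σ' σ'' τ τ' : Mem n}

/-- The weight of every independent set in `C` is at most that of `T`. -/
def Dominates (G : SimpleGraph (Fin n)) (w : Fin n → ℝ) (T C : Set (Fin n)) : Prop :=
  ∀ J ⊆ C, G.IsIndepSet J → weight w J ≤ weight w T

theorem Dominates.mono {T T' C : Set (Fin n)} (h : Dominates G w T C)
    (hT : weight w T ≤ weight w T') : Dominates G w T' C :=
  fun J hJ hi => (h J hJ hi).trans hT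

/-- The tables contain an optimal solution in `C`. -/
def Solved (G : SimpleGraph (Fin n)) (w : Fin n → ℝ) (σ : Mem n) (C : Set (Fin n)) : Prop :=
  ∃ r < 4 * n ^ 9, σ.tab 0 r = C ∧ Dominates G w (σ.tab 2 r) C

/-- The rows of the tables are sound. -/
def Sound (G : SimpleGraph (Fin n)) (σ : Mem n) : Prop := ∀ r < 4 * n ^ 9, SoundRow G σ r

/-- The tables, the indices below `3` and the sets below `k` are the same in both memories. -/
structure Frame (k : ℕ) (σ σ' : Mem n) : Prop where
  tab : σ'.tab = σ.tab
  ptr : ∀ p < 3, σ'.ptr p = σ.ptr p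
  set : ∀ b < k, σ'.set b = σ.set b

theorem Frame.refl (k : ℕ) (σ : Mem n) : Frame k σ σ := ⟨rfl, fun _ _ => rfl, fun _ _ => rfl⟩

theorem Frame.trans {k k' : ℕ} (h : Frame k σ σ') (h' : Frame k' σ' σ'') (hk : k ≤ k') :
    Frame k σ σ'' :=
  ⟨h'.tab.trans h.tab, fun p hp => (h'.ptr p hp).trans (h.ptr p hp),
    fun b hb => (h'.set b (hb.trans_le hk)).trans (h.set b hb)⟩

theorem Frame.setSet {k : ℕ} (h : Frame k σ σ') {b : ℕ} (hb : k ≤ b) (S : Set (Fin n)) :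
    Frame k σ (σ'.setSet b S) :=
  ⟨h.tab, h.ptr, fun b' hb' =>
    (Function.update_of_ne (by omega) _ _).trans (h.set b' hb')⟩

theorem Frame.setPtr {k : ℕ} (h : Frame k σ σ') (r : ℕ) : Frame k σ (σ'.setPtr 3 r) :=
  ⟨h.tab, fun p hp => (Function.update_of_ne (by omega) _ _).trans (h.ptr p hp), h.set⟩

theorem Mem.setSet_set (σ : Mem n) (b b' : ℕ) (S : Set (Fin n)) :
    (σ.setSet b S).set b' = if b' = b then S else σ.set b' := by
  simp [Mem.setSet, Function.update_apply]

/-- The sets `b` and `c` are different. -/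
def neF (b c : ℕ) : Formula :=
  .ex 10 (.or (.and (.mem 10 b) (.not (.mem 10 c))) (.and (.mem 10 c) (.not (.mem 10 b))))

theorem holds_neF {b c : ℕ} : (neF b c).Holds G w ρ σ ↔ σ.set b ≠ σ.set c := by
  simp only [neF, Formula.Holds, holds_or, Function.update_self, ne_eq, Set.ext_iff, not_forall]
  refine exists_congr fun a => ?_
  tauto

/-- If row `3` of the tables solves the set `15` better than the set `16` does, use it. -/
def tryRow : Cmd :=
  .seq (.load 0 3 17) (.seq (.load 2 3 18)
    (.ite (.and (.not (neF 17 15)) (.lighter 16 18)) (.assign 16 10 (.mem 10 18)) .skip))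

/-- Find the best solution for the set `15` in the tables. -/
def lookUp : Cmd := .seq (.assign 16 10 falseF) (forRows 3 tryRow)

/-- The result is independent whatever the tables contain, as long as they are sound. Optimality is
claimed only if some row already solves the set; several rows may hold the same set, and the best of
them wins. -/
theorem exec_lookUp (hs : Sound G σ) :
    Frame 16 σ (lookUp.exec G w ρ σ) ∧
    (lookUp.exec G w ρ σ).set 16 ⊆ σ.set 15 ∧ G.IsIndepSet ((lookUp.exec G w ρ σ).set 16) ∧
    (Solved G w σ (σ.set 15) → Dominates G w ((lookUp.exec G w ρ σ).set 16) (σ.set 15)) := by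
  obtain ⟨h1, h2, h3, h4⟩ := forRows_induct (G := G) (w := w) (ρ := ρ)
    (σ := (Cmd.assign 16 10 falseF).exec G w ρ σ) (p := 3) (c := tryRow)
    (I := fun r τ => Frame 16 σ τ ∧ τ.set 16 ⊆ σ.set 15 ∧ G.IsIndepSet (τ.set 16) ∧
      ∀ q < r, σ.tab 0 q = σ.set 15 → weight w (σ.tab 2 q) ≤ weight w (τ.set 16)) (by
    have : ((Cmd.assign 16 10 falseF).exec G w ρ σ).set 16 = ∅ := by
      simp [Cmd.exec, Mem.setSet, falseF, Formula.Holds]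
    refine ⟨(Frame.setSet (.refl 16 σ) le_rfl _).setPtr 0, ?_⟩
    simp [Mem.setPtr, this]) (by
    rintro r hr τ hp ⟨hF, hK, hi, hle⟩
    have hF' : Frame 16 σ (((τ.setSet 17 (σ.tab 0 r)).setSet 18 (σ.tab 2 r))) :=
      (hF.setSet (by omega) _).setSet (by omega) _
    have h15 : τ.set 15 = σ.set 15 := hF.set 15 (by omega)
    have he : tryRow.exec G w ρ τ = if σ.tab 0 r = σ.set 15 ∧
        weight w (τ.set 16) < weight w (σ.tab 2 r) then
        ((τ.setSet 17 (σ.tab 0 r)).setSet 18 (σ.tab 2 r)).setSet 16 (σ.tab 2 r)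
        else (τ.setSet 17 (σ.tab 0 r)).setSet 18 (σ.tab 2 r) := by
      have h17 : (τ.setSet 17 (σ.tab 0 r)).ptr 3 = r := hp
      have h17' : (τ.setSet 17 (σ.tab 0 r)).tab = σ.tab := hF.tab
      simp only [tryRow, Cmd.exec, Formula.Holds, holds_neF, hF.tab, hp, h17, h17', not_not]
      simp [Mem.setSet_set, h15]
    rw [he]
    split_ifs with hc
    · refine ⟨hp, (hF'.setSet le_rfl _).setPtr _, ?_, ?_, fun q hq hq' => ?_⟩
      · exact hc.1 ▸ (hs r hr).1
      · exact (hs r hr).2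
      · rcases Nat.lt_succ_iff_lt_or_eq.1 hq with hq | rfl
        · exact (hle q hq hq').trans hc.2.le
        · exact le_rfl
    · refine ⟨hp, hF'.setPtr _, ?_, ?_, fun q hq hq' => ?_⟩
      · exact hK
      · exact hi
      · rcases Nat.lt_succ_iff_lt_or_eq.1 hq with hq | rfl
        · exact hle q hq hq'
        · exact not_lt.1 fun h => hc ⟨hq', h⟩)
  refine ⟨h1, h2, h3, ?_⟩
  rintro ⟨r, hr, hr', hd⟩
  exact hd.mono (h4 r hr hr')

/-- Solve the component of the vertex `9` unless it has been solved. -/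
def addComp : Cmd :=
  .ite (.mem 9 13)
    (.seq (.assign 15 10 (.conn 20 (.mem 20 12) 9 10)) (.seq lookUp
      (.seq (.assign 14 10 (.or (.mem 10 14) (.mem 10 16)))
        (.assign 13 10 (.and (.mem 10 13) (.not (.mem 10 15)))))))
    .skip

/-- Collect solutions for the components of the set `12` in the set `14`. -/
def combine : Cmd :=
  .seq (.assign 13 10 (.mem 10 12)) (.seq (.assign 14 10 falseF) (.forV 9 addComp))

/-- The components outside of the set `13` have been solved. -/
structure Partial (G : SimpleGraph (Fin n)) (w : Fin n → ℝ) (σ τ : Mem n) : Prop where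
  frame : Frame 13 σ τ
  closed : ∀ v ∈ τ.set 13, comp G (σ.set 12) v ⊆ τ.set 13
  subset : τ.set 13 ⊆ σ.set 12
  new : τ.set 14 ⊆ σ.set 12 \ τ.set 13
  indep : G.IsIndepSet (τ.set 14)
  best : (∀ v ∈ σ.set 12, Solved G w σ (comp G (σ.set 12) v)) →
    Dominates G w (τ.set 14) (σ.set 12 \ τ.set 13)

/-- Different components have no edges between them, so their solutions can be united, and the
bounds on the weight add up. Once a component is treated it leaves the set `13` as a whole, so its
other vertices trigger nothing. -/
theorem exec_addComp (hs : Sound G σ) (h : Partial G w σ τ) :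
    Partial G w σ (addComp.exec G w ρ τ) ∧ ρ 9 ∉ (addComp.exec G w ρ τ).set 13 ∧
      (addComp.exec G w ρ τ).set 13 ⊆ τ.set 13 := by
  by_cases hv : ρ 9 ∈ τ.set 13
  swap
  · have : addComp.exec G w ρ τ = τ := by simp [addComp, Cmd.exec, Formula.Holds, hv]
    rw [this]
    exact ⟨h, hv, subset_rfl⟩
  set W := σ.set 12 with hW
  have h12 : τ.set 12 = W := h.frame.set 12 (by omega)
  set K := comp G W (ρ 9) with hK
  set τ1 := τ.setSet 15 K with hτ1
  have hF1 : Frame 15 τ τ1 := (Frame.refl 15 τ).setSet le_rfl _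
  have hs1 : Sound G τ1 := fun r hr => by
    have := hs r hr
    rwa [SoundRow, ← h.frame.tab] at this
  obtain ⟨hF2, hT, hTi, hTd⟩ := exec_lookUp (w := w) (ρ := ρ) hs1
  set τ2 := lookUp.exec G w ρ τ1 with hτ2
  set T := τ2.set 16 with hTdef
  have h15 : τ1.set 15 = K := by simp [hτ1, Mem.setSet]
  rw [h15] at hT hTd
  have h2 : ∀ b < 15, τ2.set b = τ.set b := fun b hb =>
    (hF2.set b (by omega)).trans (hF1.set b hb)
  have h215 : τ2.set 15 = K := (hF2.set 15 (by omega)).trans h15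
  have he : addComp.exec G w ρ τ = (τ2.setSet 14 (τ.set 14 ∪ T)).setSet 13 (τ.set 13 \ K) := by
    have hK' : {a | Conn G {b | b ∈ τ.set 12} (ρ 9) a} = K := by rw [h12]; rfl
    simp only [addComp, Cmd.exec, Formula.Holds, hv, if_true, holds_or, Function.update_self,
      ne_eq, not_false_eq_true, Nat.reduceEqDiff, Function.update_of_ne, hK']
    rw [← hτ1, ← hτ2]
    simp only [Mem.setSet_set]
    congr 1
    · rw [h2 14 (by omega)]
      rfl
    · simp only [Nat.reduceEqDiff, if_false, h2 13 (by omega), h215]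
      rfl
  rw [he]
  have e13 : ((τ2.setSet 14 (τ.set 14 ∪ T)).setSet 13 (τ.set 13 \ K)).set 13 = τ.set 13 \ K := by
    simp [Mem.setSet_set]
  have e14 : ((τ2.setSet 14 (τ.set 14 ∪ T)).setSet 13 (τ.set 13 \ K)).set 14 = τ.set 14 ∪ T := by
    simp [Mem.setSet_set]
  have hKs : K ⊆ τ.set 13 := h.closed _ hv
  refine ⟨⟨?_, ?_, ?_, ?_, ?_, ?_⟩, ?_, ?_⟩
  · exact ((h.frame.trans (hF1.trans hF2 (by omega)) (by omega)).setSet (by omega) _).setSet le_rfl _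
  · rw [e13]
    rintro v ⟨hv1, hv2⟩ u hu
    refine ⟨h.closed v hv1 hu, fun huK => hv2 ?_⟩
    have : comp G W v = K := (comp_eq_of_mem hu).symm.trans (comp_eq_of_mem huK)
    exact this ▸ mem_comp_self (h.subset hv1)
  · rw [e13]
    exact Set.sdiff_subset.trans h.subset
  · rw [e13, e14]
    rintro v (hv' | hv')
    · exact ⟨(h.new hv').1, fun hc => (h.new hv').2 hc.1⟩
    · exact ⟨h.subset (hKs (hT hv')), fun hc => hc.2 (hT hv')⟩
  · rw [e14]
    have hno : ∀ u ∈ τ.set 14, ∀ t ∈ T, ¬ G.Adj u t := fun u hu t ht ha =>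
      (h.new hu).2 (hKs (comp_adj (hT ht) ha.symm (h.new hu).1))
    rintro a (ha | ha) b (hb | hb) hab
    exacts [h.indep ha hb hab, hno a ha b hb, fun hc => hno b hb a ha hc.symm, hTi ha hb hab]
  · intro hall J hJ hJi
    rw [e13] at hJ
    rw [e14]
    have hd : Disjoint (τ.set 14) T :=
      Set.disjoint_left.2 fun v h1 h2 => (h.new h1).2 (hKs (hT h2))
    have hJK : Disjoint (J \ τ.set 13) (J ∩ K) :=
      Set.disjoint_left.2 fun v h1 h2 => h1.2 (hKs h2.2)
    -- The competitor splits into its part in the components treated before and its part in the new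
    -- component `K`.
    have hJe : J = (J \ τ.set 13) ∪ (J ∩ K) := by
      ext v
      refine ⟨fun hv' => ?_, fun hv' => hv'.elim (fun h => h.1) fun h => h.1⟩
      by_cases h13 : v ∈ τ.set 13
      · exact .inr ⟨hv', by_contra fun hc => (hJ hv').2 ⟨h13, hc⟩⟩
      · exact .inl ⟨hv', h13⟩
    have hsol : Solved G w τ1 K := by
      have := hall (ρ 9) (h.subset hv)
      rwa [Solved, ← h.frame.tab] at this
    rw [weight_union hd, hJe, weight_union hJK]
    refine add_le_add (h.best hall _ (fun v hv' => ⟨(hJ hv'.1).1, hv'.2⟩)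
      (hJi.mono Set.sdiff_subset)) (hTd hsol _ Set.inter_subset_right
        (hJi.mono Set.inter_subset_left))
  · rw [e13]
    exact fun hc => hc.2 (mem_comp_self (h.subset hv))
  · rw [e13]
    exact Set.sdiff_subset

theorem exec_combine (hs : Sound G σ) :
    Frame 13 σ (combine.exec G w ρ σ) ∧
    (combine.exec G w ρ σ).set 14 ⊆ σ.set 12 ∧ G.IsIndepSet ((combine.exec G w ρ σ).set 14) ∧
    ((∀ v ∈ σ.set 12, Solved G w σ (comp G (σ.set 12) v)) →
      Dominates G w ((combine.exec G w ρ σ).set 14) (σ.set 12)) := by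
  set τ := (σ.setSet 13 (σ.set 12)).setSet 14 ∅ with hτ
  have he : combine.exec G w ρ σ = (Cmd.forV 9 addComp).exec G w ρ τ := by
    simp [combine, Cmd.exec, Formula.Holds, falseF, hτ]
  have h13 : τ.set 13 = σ.set 12 := by simp [hτ, Mem.setSet_set]
  have h14 : τ.set 14 = ∅ := by simp [hτ, Mem.setSet_set]
  have h0 : Partial G w σ τ := by
    refine ⟨((Frame.refl 13 σ).setSet le_rfl _).setSet (by omega) _, ?_, ?_, ?_, ?_, ?_⟩
    · rw [h13]
      exact fun v _ => comp_subset
    · rw [h13]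
    · simp [h14]
    · simp [h14]
    · intro _ J hJ _
      rw [h13, Set.sdiff_self] at hJ
      rw [h14, Set.subset_empty_iff.1 hJ]
  rw [he]
  have h1 : Partial G w σ ((Cmd.forV 9 addComp).exec G w ρ τ) :=
    forV_induct (fun a τ h => (exec_addComp hs h).1) h0
  have h2 : ((Cmd.forV 9 addComp).exec G w ρ τ).set 13 = ∅ := by
    refine Set.eq_empty_of_forall_notMem fun a => ?_
    refine forV_reach (I := Partial G w σ) (Q := fun τ => a ∉ τ.set 13) a
      (fun a τ h => (exec_addComp hs h).1) (fun τ h => ?_)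
      (fun b τ h h' => fun hc => h' ((exec_addComp hs h).2.2 hc)) h0
    have := (exec_addComp (ρ := Function.update ρ 9 a) hs h).2.1
    rwa [Function.update_self] at this
  have h3 := h1.new
  have h4 := h1.best
  rw [h2, Set.sdiff_empty] at h3 h4
  exact ⟨h1.frame, h3, h1.indep, h4⟩

/-- Improve row `1` of the tables by means of the cut in row `2`. -/
def update : Cmd :=
  .seq (.load 0 1 10) (.seq (.load 1 2 11)
    (.seq (.assign 12 10 (.and (.mem 10 10) (.not (.mem 10 11)))) (.seq combine
      (.seq (.load 2 1 19) (.ite (.lighter 19 14) (.store 2 1 14) .skip)))))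

/-- One round of dynamic programming. -/
def improve : Cmd := forRows 1 (forRows 2 update)

/-- The tables of `σ'` arise from those of `σ` by better solutions. -/
structure Improves (G : SimpleGraph (Fin n)) (w : Fin n → ℝ) (σ σ' : Mem n) : Prop where
  tab : ∀ t < 2, σ'.tab t = σ.tab t
  weight : ∀ r, weight w (σ.tab 2 r) ≤ weight w (σ'.tab 2 r)
  sound : Sound G σ → Sound G σ'

theorem Improves.refl (σ : Mem n) : Improves G w σ σ := ⟨fun _ _ => rfl, fun _ => le_rfl, id⟩

theorem Improves.setPtr (σ : Mem n) (p r : ℕ) : Improves G w σ (σ.setPtr p r) :=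
  ⟨fun _ _ => rfl, fun _ => le_rfl, id⟩

theorem Improves.trans (h : Improves G w σ σ') (h' : Improves G w σ' σ'') : Improves G w σ σ'' :=
  ⟨fun t ht => (h'.tab t ht).trans (h.tab t ht), fun r => (h.weight r).trans (h'.weight r),
    fun hs => h'.sound (h.sound hs)⟩

theorem Solved.improves {C : Set (Fin n)} (h : Solved G w σ C) (hσ : Improves G w σ σ') :
    Solved G w σ' C := by
  obtain ⟨r, hr, hC, hd⟩ := h
  exact ⟨r, hr, by rw [hσ.tab 0 (by omega), hC], hd.mono (hσ.weight r)⟩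

/-- If the components left by cut `d` of row `r` are solved in `σ`, then their solution has been
taken into account in `τ`. -/
def Done (G : SimpleGraph (Fin n)) (w : Fin n → ℝ) (σ τ : Mem n) (r d : ℕ) : Prop :=
  (∀ v ∈ σ.tab 0 r \ σ.tab 1 d, Solved G w σ (comp G (σ.tab 0 r \ σ.tab 1 d) v)) →
    Dominates G w (τ.tab 2 r) (σ.tab 0 r \ σ.tab 1 d)

theorem Done.improves {r d : ℕ} (h : Done G w σ τ r d) (hτ : Improves G w τ τ') :
    Done G w σ τ' r d := fun hs => (h hs).mono (hτ.weight r)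

theorem Improves.done {r d : ℕ} (hσ : Improves G w σ σ') (h : Done G w σ' τ r d) :
    Done G w σ τ r d := by
  rw [Done, hσ.tab 0 (by omega), hσ.tab 1 (by omega)] at h
  exact fun hs => h fun v hv => (hs v hv).improves hσ

/-- If the comparison fails, the old entry is at least as heavy as the combined solution and hence
dominates as well. -/
theorem exec_update {r d : ℕ} (hs : Sound G σ) (h1 : σ.ptr 1 = r)
    (h2 : σ.ptr 2 = d) :
    Improves G w σ (update.exec G w ρ σ) ∧ (∀ p < 3, (update.exec G w ρ σ).ptr p = σ.ptr p) ∧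
      Done G w σ (update.exec G w ρ σ) r d := by
  set W := σ.tab 0 r \ σ.tab 1 d with hW
  set τ := ((σ.setSet 10 (σ.tab 0 r)).setSet 11 (σ.tab 1 d)).setSet 12 W with hτ
  have h12 : τ.set 12 = W := by simp [hτ, Mem.setSet_set]
  obtain ⟨hF, hN, hi, hd⟩ := exec_combine (w := w) (ρ := ρ) (show Sound G τ from hs)
  rw [h12] at hN hd
  set τ2 := combine.exec G w ρ τ with hτ2
  have hp : ∀ p < 3, τ2.ptr p = σ.ptr p := hF.ptr
  have ht : τ2.tab = σ.tab := hF.tab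
  have he : update.exec G w ρ σ = if weight w (σ.tab 2 r) < weight w (τ2.set 14) then
      (τ2.setSet 19 (σ.tab 2 r)).setTab 2 r (τ2.set 14) else τ2.setSet 19 (σ.tab 2 r) := by
    have e1 : (Cmd.assign 12 10 (.and (.mem 10 10) (.not (.mem 10 11)))).exec G w ρ
        ((Cmd.load 1 2 11).exec G w ρ ((Cmd.load 0 1 10).exec G w ρ σ)) = τ := by
      have e2 : (σ.setSet 10 (σ.tab 0 (σ.ptr 1))).ptr 2 = d := h2
      simp only [Cmd.exec, e2]
      rw [hτ, hW, h1]
      congr 1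
    have e3 : update.exec G w ρ σ = (Cmd.ite (.lighter 19 14) (.store 2 1 14) .skip).exec G w ρ
        ((Cmd.load 2 1 19).exec G w ρ τ2) := by
      rw [hτ2, ← e1]
      rfl
    have e4 : τ2.ptr 1 = r := (hp 1 (by omega)).trans h1
    have e5 : (τ2.setSet 19 (σ.tab 2 r)).ptr 1 = r := e4
    rw [e3]
    simp only [Cmd.exec, Formula.Holds, e4, ht, e5]
    simp [Mem.setSet_set]
  rw [he]
  split_ifs with hc
  · have e2 : ∀ q, ((τ2.setSet 19 (σ.tab 2 r)).setTab 2 r (τ2.set 14)).tab 2 q =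
        if q = r then τ2.set 14 else σ.tab 2 q := fun q => by
      simp [Mem.setTab, Mem.setSet, Function.update_apply, ht]
    have e0 : ∀ t < 2, ((τ2.setSet 19 (σ.tab 2 r)).setTab 2 r (τ2.set 14)).tab t = σ.tab t :=
      fun t h => by
        have : t ≠ 2 := by omega
        simp [Mem.setTab, Mem.setSet, this, ht]
    refine ⟨⟨e0, fun q => ?_, fun hs q hq => ?_⟩, hp, fun hall => ?_⟩
    · rw [e2]
      split_ifs with hq
      · exact hq ▸ hc.le
      · exact le_rfl
    · rw [SoundRow, e2, e0 0 (by omega)]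
      split_ifs with hqr
      · exact ⟨hqr ▸ hN.trans Set.sdiff_subset, hi⟩
      · exact hs q hq
    · rw [e2, if_pos rfl]
      exact hd hall
  · have e : (τ2.setSet 19 (σ.tab 2 r)).tab = σ.tab := ht
    refine ⟨⟨fun t _ => by rw [e], fun q => by rw [e], fun hs q hq => ?_⟩, hp, fun hall => ?_⟩
    · rw [SoundRow, e]
      exact hs q hq
    · rw [e]
      exact (hd hall).mono (not_lt.1 hc)

/-- Entries only get heavier during a round, so what was solved when the round started is still
solved when a particular row and cut are treated, and the gain is not lost later. -/
theorem exec_improve (hs : Sound G σ) :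
    Improves G w σ (improve.exec G w ρ σ) ∧
      ∀ r < 4 * n ^ 9, ∀ d < 4 * n ^ 9, Done G w σ (improve.exec G w ρ σ) r d := by
  refine forRows_induct (p := 1) (c := forRows 2 update)
    (I := fun m τ => Improves G w σ τ ∧ ∀ r < m, ∀ d < 4 * n ^ 9, Done G w σ τ r d)
    ⟨.setPtr σ 1 0, by simp⟩ ?_
  rintro r hr τ h1 ⟨hI, hD⟩
  obtain ⟨h2, h3, h4⟩ := forRows_induct (G := G) (w := w) (ρ := ρ) (σ := τ) (p := 2) (c := update)
    (I := fun m τ' => Improves G w τ τ' ∧ τ'.ptr 1 = r ∧ ∀ d < m, Done G w τ τ' r d)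
    ⟨.setPtr τ 2 0, by simp [Mem.setPtr, h1], by simp⟩ (by
      rintro d hd τ' h2 ⟨h3, h4, h5⟩
      obtain ⟨h6, h7, h8⟩ := exec_update (w := w) (ρ := ρ) (h3.sound (hI.sound hs)) h4 h2
      refine ⟨(h7 2 (by omega)).trans h2, h3.trans (h6.trans (.setPtr _ _ _)), ?_, fun d' hd' => ?_⟩
      · simp [Mem.setPtr, h7 1 (by omega), h4]
      · rcases Nat.lt_succ_iff_lt_or_eq.1 hd' with hd' | rfl
        · exact (h5 d' hd').improves (h6.trans (.setPtr _ _ _))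
        · exact h3.done h8)
  refine ⟨h3, hI.trans (h2.trans (.setPtr _ _ _)), fun q hq d hd => ?_⟩
  rcases Nat.lt_succ_iff_lt_or_eq.1 hq with hq | rfl
  · exact (hD q hq d hd).improves (h2.trans (.setPtr _ _ _))
  · exact hI.done (h4 d hd)

/-- The tables contain all rows and all cuts, and solutions for single vertices. -/
structure Full (G : SimpleGraph (Fin n)) (w : Fin n → ℝ) (σ : Mem n) : Prop where
  sound : Sound G σ
  row : ∀ C, IsRow G C → ∃ r < 4 * n ^ 9, σ.tab 0 r = C
  cut : ∀ C, IsCut G C → ∃ r < 4 * n ^ 9, σ.tab 1 r = C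
  single : ∀ v, Solved G w σ {v}

theorem Full.improves (h : Full G w σ) (hσ : Improves G w σ σ') : Full G w σ' where
  sound := hσ.sound h.sound
  row := by rw [hσ.tab 0 (by omega)]; exact h.row
  cut := by rw [hσ.tab 1 (by omega)]; exact h.cut
  single v := (h.single v).improves hσ

theorem exec_generate_full (h0 : σ.ptr 0 = 0) : Full G w (generate.exec G w ρ σ) := by
  obtain ⟨hA, hR⟩ := exec_generate (G := G) (w := w) ρ σ
  set τ := generate.exec G w ρ σ
  have hp : τ.ptr 0 = 4 * n ^ 9 := by rw [hA.ptr, h0, zero_add]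
  simp only [HasRow, hp] at hR
  refine ⟨fun r hr => hA.sound r (by omega) (by omega), ?_, ?_, fun v => ?_⟩
  · rintro C ⟨a, z, f, c, x, y, e, g, i, hi, hC⟩
    rw [Nat.card_fin] at hi
    have hj : ∃ j < 4, ∃ r < 4 * n ^ 9, τ.tab 0 r = C := by
      rcases hC with rfl | rfl | rfl | rfl
      · obtain ⟨r, hr, h⟩ := hR a z f c x y e g i hi 0 (by omega)
        exact ⟨0, by omega, r, hr, h 0 (by omega)⟩
      · obtain ⟨r, hr, h⟩ := hR a z f c x y e g i hi 1 (by omega)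
        exact ⟨0, by omega, r, hr, h 0 (by omega)⟩
      · obtain ⟨r, hr, h⟩ := hR a z f c x y e g i hi 2 (by omega)
        exact ⟨0, by omega, r, hr, h 0 (by omega)⟩
      · obtain ⟨r, hr, h⟩ := hR a z f c x y e g i hi 3 (by omega)
        exact ⟨0, by omega, r, hr, h 0 (by omega)⟩
    obtain ⟨-, -, h⟩ := hj
    exact h
  · rintro C ⟨a, z, f, c, x, y, e, i, hi, hC⟩
    rw [Nat.card_fin] at hi
    rcases hC with rfl | rfl | rfl | rfl
    · obtain ⟨r, hr, h⟩ := hR a z f c x y e a i hi 0 (by omega)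
      exact ⟨r, hr, h 1 (by omega)⟩
    · obtain ⟨r, hr, h⟩ := hR a z f c x y e a i hi 1 (by omega)
      exact ⟨r, hr, h 1 (by omega)⟩
    · obtain ⟨r, hr, h⟩ := hR a z f c x y e a i hi 2 (by omega)
      exact ⟨r, hr, h 1 (by omega)⟩
    · obtain ⟨r, hr, h⟩ := hR a z f c x y e a i hi 3 (by omega)
      exact ⟨r, hr, h 1 (by omega)⟩
  -- The third kind of row solves a single vertex from the beginning; its value is the maximum of
  -- zero and the weight.
  · obtain ⟨r, hr, h⟩ := hR v v v v v v v v 0 v.pos 2 (by omega)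
    refine ⟨r, hr, h 0 (by omega), fun J hJ _ => ?_⟩
    have h2 : τ.tab 2 r = {u | u = v ∧ 0 < w v} := h 2 (by omega)
    have h3 : weight w (τ.tab 2 r) = max 0 (w v) := by
      rw [h2]
      by_cases hv : 0 < w v
      · simp only [hv, and_true, Set.ofPred_eq_eq_singleton, weight_singleton, max_eq_right hv.le]
      · simp only [hv, and_false, Set.ofPred_false, weight_empty, max_eq_left (not_lt.1 hv)]
    rw [h3]
    rcases Set.subset_singleton_iff_eq.1 hJ with rfl | rfl
    · rw [weight_empty]
      exact le_max_left _ _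
    · rw [weight_singleton]
      exact le_max_right _ _

theorem improves_iterate (hs : Sound G σ) (k : ℕ) :
    Improves G w σ ((improve.exec G w ρ)^[k] σ) := by
  induction k with
  | zero => exact .refl σ
  | succ k ih =>
    rw [Function.iterate_succ_apply']
    exact ih.trans (exec_improve (ih.sound hs)).1

/-- The pieces left by a cut are smaller than `C`, so they are solved one round earlier. The cut may
depend on the competitor `J`: the round tries all cuts, and the stored solution beats every `J`
through the cut that suits it. -/
theorem solved_of_solv (hσ : Full G w σ) {C : Set (Fin n)} (hC : Solv G C) {k : ℕ}
    (hk : C.ncard ≤ k) : Solved G w ((improve.exec G w ρ)^[k] σ) C := by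
  induction hC generalizing k with
  | single g => exact (hσ.single g).improves (improves_iterate hσ.sound k)
  | step C hC K hK _ ih =>
    cases k with
    | zero =>
      -- A cut meets `C`, so `C` is not empty.
      obtain ⟨-, -, v, -, hv⟩ := hK ∅ (Set.empty_subset _) (by simp)
      rw [Nat.le_zero, Set.ncard_eq_zero] at hk
      simp [hk] at hv
    | succ k =>
      have hI := improves_iterate (w := w) (ρ := ρ) hσ.sound k
      rw [Function.iterate_succ_apply']
      set τ := (improve.exec G w ρ)^[k] σ with hτ
      have hF := hσ.improves hI
      obtain ⟨h1, h2⟩ := exec_improve (w := w) (ρ := ρ) hF.sound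
      obtain ⟨r, hr, rfl⟩ := hF.row C hC
      refine ⟨r, hr, by rw [h1.tab 0 (by omega)], fun J hJ hJi => ?_⟩
      obtain ⟨hcut, hdisj, u, hu⟩ := hK J hJ hJi
      obtain ⟨d, hd, hd'⟩ := hF.cut _ hcut
      have h3 := h2 r hr d hd
      rw [Done, hd'] at h3
      refine h3 (fun v hv => ih J hJ hJi v hv ?_) J
        (fun v hv => ⟨hJ hv, Set.disjoint_left.1 hdisj hv⟩) hJi
      refine Nat.lt_succ_iff.1 ((Set.ncard_lt_ncard
        ⟨comp_subset.trans Set.sdiff_subset, fun h => ?_⟩).trans_le hk)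
      exact (comp_subset (h hu.2)).2 hu.1

/-- The algorithm: fill the tables, improve them, and combine the solutions for the components
of the graph. -/
def solve : Cmd :=
  .seq generate (.seq (.rep improve) (.seq (.assign 12 10 (.eq 10 10)) (.seq combine
    (.assign 0 10 (.mem 10 14)))))

/-- The sets `D` enter only through `Nested.solv_univ`. Since components have at most `n` vertices,
`n` rounds of improvement are enough. -/
theorem exec_solve {D : Fin n → Set (Fin n)} (N : Nested G D) (h0 : σ.ptr 0 = 0) :
    G.IsIndepSet ((solve.exec G w ρ σ).set 0) ∧
      Dominates G w ((solve.exec G w ρ σ).set 0) Set.univ := by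
  have hF := exec_generate_full (G := G) (w := w) (ρ := ρ) h0
  set σ1 := generate.exec G w ρ σ with hσ1
  have hF2 := hF.improves (improves_iterate (w := w) (ρ := ρ) hF.sound n)
  set σ2 := (improve.exec G w ρ)^[n] σ1 with hσ2
  obtain ⟨-, -, hi, hd⟩ := exec_combine (w := w) (ρ := ρ)
    (show Sound G (σ2.setSet 12 Set.univ) from hF2.sound)
  have he : (solve.exec G w ρ σ).set 0 =
      (combine.exec G w ρ (σ2.setSet 12 Set.univ)).set 14 := by
    have : (Cmd.assign 12 10 (.eq 10 10)).exec G w ρ σ2 = σ2.setSet 12 Set.univ := by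
      simp [Cmd.exec, Formula.Holds]
    rw [← this, hσ2, hσ1]
    simp [solve, Cmd.exec, Formula.Holds, Mem.setSet_set]
  have h12 : (σ2.setSet 12 Set.univ).set 12 = Set.univ := by simp [Mem.setSet_set]
  rw [he]
  rw [h12] at hd
  refine ⟨hi, hd fun v _ => solved_of_solv hF (N.solv_univ v) ?_⟩
  simpa using Set.ncard_le_ncard (Set.subset_univ (comp G Set.univ v))

end DynamicProgram

end SetProg

/-! ### From the input of the machine to the final program. -/

namespace SetProg

open RAM Burling

variable {n : ℕ}

/-- Compute the starts of the rows of the adjacency matrix. -/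
def rowStarts : Program :=
  forUp (ar 13 0) (.setNat (ar 4 0) (.add (rd (ar 13 0)) (.const 1))
    (.add (.read (ar 4 0) (rd (ar 13 0))) (rd 0)))

theorem input_nat_of_ne (G : SimpleGraph (Fin n)) (w : Fin n → ℝ) {a : ℕ} (h0 : a ≠ 0)
    (h1 : a ≠ 1) (i : ℕ) : (MaxIndepSet.input G w).nat a i = 0 := by
  simp [MaxIndepSet.input, h0, h1]

/-- Row starts are computed by repeatedly adding `n`. All other cells that represent variables, sets
and tables contain `0` in the input, which stands for vertex `0` and for empty sets. -/
theorem exec_rowStarts (G : SimpleGraph (Fin n)) (w : Fin n → ℝ) (hn : 0 < n) :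
    Exec rowStarts (MaxIndepSet.input G w) (n * (11 + 15) + 15)
      (Rep G w (fun _ => ⟨0, hn⟩) ⟨fun _ => ∅, fun _ _ => ∅, fun _ => 0⟩) := by
  set s₀ := MaxIndepSet.input G w with hs₀
  have hsize : s₀.nat 0 0 = n := by simp [hs₀, MaxIndepSet.input]
  refine (Exec.forUp (n := n) (c := 11) (I := fun i s =>
    (∀ a, a ≠ ar 13 0 → a ≠ ar 4 0 → s.nat a = s₀.nat a) ∧ s.real = s₀.real ∧
      ∀ j ≤ i, s.nat (ar 4 0) j = j * n) ?_ ?_ ?_).weaken le_rfl ?_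
  · refine ⟨fun a h _ => State.setNat_nat_ne _ _ _ h, rfl, fun j hj => ?_⟩
    rw [State.setNat_nat_ne _ _ _ (by unfold ar; omega), Nat.le_zero.1 hj, Nat.zero_mul]
    exact input_nat_of_ne G w (by unfold ar; omega) (by unfold ar; omega) 0
  · rintro i s ⟨h, -⟩
    rw [h 0 (by unfold ar; omega) (by unfold ar; omega), hsize]
  · rintro i - s ⟨h1, h2, h3⟩ hi
    refine Exec.setNat ?_ (by simp [NatExpr.cost])
    have h0 : s.nat 0 0 = n := by
      rw [h1 0 (by unfold ar; omega) (by unfold ar; omega), hsize]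
    simp only [NatExpr.eval, hi, h0, h3 i le_rfl]
    refine ⟨by rw [State.setNat_nat_ne _ _ _ (by unfold ar; omega), hi], fun a ha ha' => ?_, h2,
      fun j hj => ?_⟩
    · rw [State.setNat_nat_ne _ _ _ ha, State.setNat_nat_ne _ _ _ ha', h1 a ha ha']
    · rw [State.setNat_nat_ne _ _ _ (by unfold ar; omega), State.setNat_nat_self]
      rcases eq_or_ne j (i + 1) with rfl | hj'
      · rw [Function.update_self, Nat.succ_mul]
      · rw [Function.update_of_ne hj', h3 j (by omega)]
  · rintro s ⟨⟨h1, h2, h3⟩, -⟩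
    have hz : ∀ c j i, ¬ (c = 13 ∧ j = 0) → ¬ (c = 4 ∧ j = 0) → c < 16 →
        s.nat (ar c j) i = 0 := fun c j i h h' hc => by
      rw [h1 _ (by unfold ar; omega) (by unfold ar; omega)]
      exact input_nat_of_ne G w (by unfold ar; omega) (by unfold ar; omega) i
    refine ⟨?_, fun i j => ?_, fun i => ?_, fun i => h3 i i.2.le, fun v => ?_, fun b i => ?_,
      fun t r i => ?_, fun p => ?_⟩
    · rw [h1 0 (by unfold ar; omega) (by unfold ar; omega), hsize]
    · rw [h1 1 (by unfold ar; omega) (by unfold ar; omega)]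
      have : (∃ i' j' : Fin n, (i : ℕ) * n + j = i' * n + j' ∧ G.Adj i' j') ↔ G.Adj i j := by
        refine ⟨?_, fun h => ⟨i, j, rfl, h⟩⟩
        rintro ⟨i', j', he, ha⟩
        obtain ⟨h, rfl⟩ := cell_inj he
        rwa [Fin.ext h]
      simp only [hs₀, MaxIndepSet.input, one_ne_zero, false_and, if_false, ind]
      exact @if_congr _ _ _ (_) (_) _ _ _ _ ⟨fun h => this.1 h.2, fun h => ⟨rfl, this.2 h⟩⟩ rfl rfl
    · rw [h2]
      simp [hs₀, MaxIndepSet.input]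
    · exact hz 1 v 0 (by omega) (by omega) (by omega)
    · rw [hz 0 b i (by omega) (by omega) (by omega), ind_of_not (by simp)]
    · rw [hz 2 t _ (by omega) (by omega) (by omega), ind_of_not (by simp)]
    · rw [hz 3 p 0 (by omega) (by omega) (by omega), Nat.zero_mul]

/-- The algorithm as a program of the random access machine. -/
def program : Program :=
  .ite (.natLt (.const 0) (rd 0)) (.seq rowStarts (solve.compile 0)) .skip

/-- Maximum-weight independent sets in Burling graphs are found in polynomial time. -/
theorem polynomialTime_isBurlingGraph : MaxIndepSet.PolynomialTime IsBurlingGraph := by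
  obtain ⟨c, ⟨p, hp⟩, hc⟩ := solve.cSpec 0
  obtain ⟨q, hq⟩ : PolyBounded fun n => (n * (11 + 15) + 15) + c n + 10 :=
    (((PolyBounded.id.mul (.const 26)).add (.const 15)).add ⟨p, hp⟩).add (.const 10)
  refine ⟨program, q, fun n G w hG => ?_⟩
  obtain ⟨B⟩ := hG.nonempty_order
  obtain ⟨t, s, h1, h2, h3⟩ : Exec program (MaxIndepSet.input G w) (n * (11 + 15) + 15 + c n + 10)
      fun s => MaxIndepSet.IsMaxWeightIndepSet G w (MaxIndepSet.output n s) := by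
    have hsize : (MaxIndepSet.input G w).nat 0 0 = n := by simp [MaxIndepSet.input]
    -- The graph without vertices is treated apart, because variables need a vertex as their value.
    refine Exec.ite (c := n * (11 + 15) + 15 + c n + 1) (fun hb => ?_) (fun hb => ?_)
      (by simp [Test.cost, NatExpr.cost]; omega)
    · have hn : 0 < n := by simpa [Test.Holds, NatExpr.eval, hsize] using hb
      refine Exec.weaken (c := n * (11 + 15) + 15 + c n) ?_ (Nat.le_succ _) fun _ h => h
      refine Exec.seq ((exec_rowStarts G w hn).weaken le_rfl fun s hs => ?_)
      refine (hc G w _ _ s hs).weaken le_rfl fun s' hs' => ?_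
      obtain ⟨h1, h2⟩ := exec_solve (w := w) (ρ := fun _ => ⟨0, hn⟩)
        (σ := ⟨fun _ => ∅, fun _ _ => ∅, fun _ => 0⟩) B.nested rfl
      -- The set `0` is stored in the array `ar 0 0`, which is array `2`, the one that holds the
      -- output.
      have ho : (MaxIndepSet.output n s' : Set (Fin n)) = (solve.exec G w (fun _ => ⟨0, hn⟩)
          ⟨fun _ => ∅, fun _ _ => ∅, fun _ => 0⟩).set 0 := by
        ext i
        have := hs'.1.set 0 i
        simp only [MaxIndepSet.output, Finset.coe_filter, Finset.mem_univ, true_and]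
        exact (iff_of_eq (congrArg (· = 1) this)).trans ind_eq_one
      refine ⟨by rwa [ho], fun J hJ => ?_⟩
      rw [← weight_coe, ← weight_coe, ho]
      exact h2 _ (Set.subset_univ _) hJ
    · have hn : n = 0 := by simpa [Test.Holds, NatExpr.eval, hsize] using hb
      subst hn
      refine Exec.skip ⟨fun a => a.elim0, fun J _ => ?_⟩ (by omega)
      rw [Subsingleton.elim J]
  exact ⟨t, s, h1, h2.trans (hq n), h3⟩

end SetProg

/-- The maximum independent set problem with weights is solvable in polynomial time in Burling
graphs, and the class of Burling graphs is hereditary and not `χ`-bounded. -/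
theorem theorem2 :
    MaxIndepSet.PolynomialTime Burling.IsBurlingGraph ∧
      Burling.Hereditary Burling.IsBurlingGraph ∧
      ¬ Burling.ChiBounded Burling.IsBurlingGraph := by
  exact ⟨SetProg.polynomialTime_isBurlingGraph, Burling.hereditary_isBurlingGraph,
    Burling.not_chiBounded_isBurlingGraph⟩
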